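/- Let $\mathbb S^2\subset\mathbb R^3$ be the unit sphere with surface measure, outer normal $n$, gradient $\nabla$, divergence $\operatorname{div}$ and $\nabla^\perp f=n\times\nabla f$. For a smooth tangent field $\Phi$ let $\operatorname{curl}\Phi=-\operatorname{div}(n\times\Phi)$ (so $\operatorname{curl}\nabla^\perp f=\Delta f$), and let $\Delta\Phi=\nabla\operatorname{div}\Phi+\nabla^\perp\operatorname{curl}\Phi$ be the Laplacian on tangent fields. For real $s$ let $W^{s,2}(\mathbb S^2,\mathbb R)$ and $W^{s,2}(\mathbb S^2,\mathbb R^2)$ be the $L^2$-based Sobolev spaces of functions and of tangent fields (distributions that are bounded on smooth test objects for the norm $\|(1-\Delta)^{-s/2}\,\cdot\,\|_{L^2}$), and let $P$ be the (Helmholtz–Leray) projection of distributional tangent fields onto the divergence-free ones. There is exactly one probability measure $\mu$ on $\bigcap_{\epsilon>0}W^{-1-\epsilon,2}(\mathbb S^2,\mathbb R)$, the enstrophy measure, under which every $\langle\omega,\varphi\rangle$, $\varphi\in C^\infty(\mathbb S^2)$, is a centered Gaussian variable and $\int\langle\omega,\varphi\rangle\langle\omega,\psi\rangle\,\mu(d\omega)=\langle\varphi,\psi\rangle_{L^2}$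 for all $\varphi,\psi\in C^\infty(\mathbb S^2)$. Let $K$ be the Biot–Savart map, which sends $\omega$ to the divergence-free field whose curl is the mean-zero part of $\omega$, and let $\xi=K_*\mu$, a measure on $\bigcap_{\epsilon>0}W^{-\epsilon,2}(\mathbb S^2,\mathbb R^2)$. 1. There is exactly one linear map $w\mapsto\langle v,w\rangle$ from $W^{-1,2}(\mathbb S^2,\mathbb R^2)$ to $L^2(\xi)$ which is continuous and which, for $w\in W^{\epsilon,2}(\mathbb S^2,\mathbb R^2)$ with $\epsilon>0$, is $\xi$-almost surely the dual pairing of $v\in W^{-\epsilon,2}$ with $w$. For every $w\in W^{-1,2}(\mathbb S^2,\mathbb R^2)$ there are smooth tangent fields arbitrarily close to $w$ in $W^{-1,2}$, and $\langle v,\Phi\rangle\to\langle v,w\rangle$ in $L^2(\xi)$ as the smooth field $\Phi$ tends to $w$ in $W^{-1,2}$. 2. For every $w\in W^{-1,2}(\mathbb S^2,\mathbb R^2)$ the random variable $\langle v,w\rangle$ is centered Gaussian with variance $\langle(-\Delta)^{-1}Pw,w\rangle$ (the dual pairing of $W^{1,2}$ with $W^{-1,2}$). In particular the variance is $\langle(-\Delta)^{-1}w,w\rangle$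 if $w$ is divergence free. 3. Let $A\subset\mathbb S^2$ be open and connected with Lipschitz boundary, and let $\gamma:[a,b]\to\mathbb S^2$, $a<b$, be a Lipschitz closed curve, injective on $[a,b)$, with $\gamma([a,b])=\partial A$ and $|\gamma'(t)|\ge c$ for almost every $t$ and some constant $c>0$. Then the rectifiable current $\Gamma(\Phi)=\int_a^b\Phi(\gamma(t))\cdot\gamma'(t)\,dt$ is defined for every smooth tangent field $\Phi$ and extends to a divergence-free element of $W^{-s,2}(\mathbb S^2,\mathbb R^2)$ for every $s>\tfrac12$, in particular of $W^{-1,2}$. Hence $\langle v,\Gamma\rangle$, which is the definition of the line integral of the velocity along $\gamma$, is well defined; it is a centered Gaussian random variable with variance $\langle(-\Delta)^{-1}\Gamma,\Gamma\rangle$. -/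

import Mathlib

noncomputable section

namespace SphereEuler

open MeasureTheory ProbabilityTheory Filter Topology
open scoped ContDiff NNReal ENNReal RealInnerProductSpace

/-! ### The round sphere, smooth functions and smooth tangent fields -/

/-- Euclidean three-space. -/
abbrev E3 : Type := EuclideanSpace ℝ (Fin 3)

/-- The unit sphere of Euclidean three-space. -/
abbrev S2 : Type := Metric.sphere (0 : E3) 1

/-- The surface measure of the sphere (total mass `4 π`). -/
def surf : Measure S2 := (volume : Measure E3).toSphere

instance : IsFiniteMeasure surf := by unfold surf; infer_instance

/-- Radial projection of a nonzero vector to the sphere. -/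
def radial (y : E3) (hy : y ≠ 0) : S2 :=
  ⟨‖y‖⁻¹ • y, by
    have : ‖y‖ ≠ 0 := norm_ne_zero_iff.2 hy
    simp [norm_smul, this]⟩

open Classical in
/-- The extension `y ↦ f (y / ‖y‖)` of a map on the sphere, constant along rays. -/
def homExt {X : Type*} [Zero X] (f : S2 → X) (y : E3) : X :=
  if hy : y ≠ 0 then f (radial y hy) else 0

/-- A map on the sphere is smooth if its extension, constant along rays, is smooth off the
origin. -/
def IsSmooth {X : Type*} [NormedAddCommGroup X] [NormedSpace ℝ X] (f : S2 → X) : Prop :=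
  ContDiffOn ℝ ∞ (homExt f) {0}ᶜ

lemma ne_zero_of_sphere (x : S2) : (x : E3) ≠ 0 := by
  intro h
  have := x.2
  simp [h] at this

lemma norm_coe_sphere (x : S2) : ‖(x : E3)‖ = 1 := norm_eq_of_mem_sphere x

lemma radial_smul_coe (x : S2) (t : ℝ) (ht : 0 < t) (h : t • (x : E3) ≠ 0) :
    radial (t • (x : E3)) h = x := by
  apply Subtype.ext
  simp [radial, norm_smul, abs_of_pos ht, smul_smul, ht.ne']

lemma homExt_of_ne {X : Type*} [Zero X] (f : S2 → X) {y : E3} (hy : y ≠ 0) :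
    homExt f y = f (radial y hy) := by simp [homExt, hy]

lemma homExt_smul_coe {X : Type*} [Zero X] (f : S2 → X) (x : S2) (t : ℝ) (ht : 0 < t) :
    homExt f (t • (x : E3)) = f x := by
  have h : t • (x : E3) ≠ 0 := smul_ne_zero ht.ne' (ne_zero_of_sphere x)
  rw [homExt_of_ne f h, radial_smul_coe x t ht h]

lemma homExt_coe {X : Type*} [Zero X] (f : S2 → X) (x : S2) : homExt f (x : E3) = f x := by
  simpa using homExt_smul_coe f x 1 one_pos

lemma isOpen_punctured : IsOpen ({0}ᶜ : Set E3) := isOpen_compl_singleton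

lemma contDiffOn_normalize : ContDiffOn ℝ ∞ (fun y : E3 => ‖y‖⁻¹ • y) {0}ᶜ := by
  intro y hy
  have hy' : y ≠ 0 := hy
  exact (((contDiffAt_norm ℝ hy').inv (norm_ne_zero_iff.2 hy')).smul
    contDiffAt_id).contDiffWithinAt

lemma mapsTo_normalize : Set.MapsTo (fun y : E3 => ‖y‖⁻¹ • y) {0}ᶜ {0}ᶜ := by
  intro y hy
  have hy' : y ≠ 0 := hy
  exact smul_ne_zero (inv_ne_zero (norm_ne_zero_iff.2 hy')) hy'

/-- The restriction to the sphere of a map that is smooth off the origin is smooth. -/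
lemma isSmooth_restrict {X : Type*} [NormedAddCommGroup X] [NormedSpace ℝ X] {F : E3 → X}
    (hF : ContDiffOn ℝ ∞ F {0}ᶜ) : IsSmooth (fun x : S2 => F x) := by
  have h := hF.comp contDiffOn_normalize mapsTo_normalize
  refine h.congr ?_
  intro y hy
  rw [homExt_of_ne _ hy]
  rfl

lemma homExt_add {X : Type*} [NormedAddCommGroup X] (f g : S2 → X) :
    homExt (f + g) = homExt f + homExt g := by
  funext y
  by_cases hy : y ≠ 0 <;> simp [homExt, hy]

lemma homExt_smul {X : Type*} [NormedAddCommGroup X] [NormedSpace ℝ X] (c : ℝ) (f : S2 → X) :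
    homExt (c • f) = c • homExt f := by
  funext y
  by_cases hy : y ≠ 0 <;> simp [homExt, hy]

lemma homExt_zero {X : Type*} [NormedAddCommGroup X] : homExt (0 : S2 → X) = 0 := by
  funext y
  by_cases hy : y ≠ 0 <;> simp [homExt, hy]

lemma IsSmooth.add {X : Type*} [NormedAddCommGroup X] [NormedSpace ℝ X] {f g : S2 → X}
    (hf : IsSmooth f) (hg : IsSmooth g) : IsSmooth (f + g) := by
  unfold IsSmooth; rw [homExt_add]; exact ContDiffOn.add hf hg

lemma IsSmooth.smul {X : Type*} [NormedAddCommGroup X] [NormedSpace ℝ X] (c : ℝ) {f : S2 → X}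
    (hf : IsSmooth f) : IsSmooth (c • f) := by
  unfold IsSmooth; rw [homExt_smul]; exact hf.const_smul c

lemma isSmooth_zero {X : Type*} [NormedAddCommGroup X] [NormedSpace ℝ X] :
    IsSmooth (0 : S2 → X) := by
  unfold IsSmooth; rw [homExt_zero]; exact contDiffOn_const

lemma IsSmooth.continuous {X : Type*} [NormedAddCommGroup X] [NormedSpace ℝ X] {f : S2 → X}
    (hf : IsSmooth f) : Continuous f := by
  have h : Continuous (fun x : S2 => homExt f (x : E3)) :=
    (ContDiffOn.continuousOn hf).comp_continuous continuous_subtype_val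
      (fun x => ne_zero_of_sphere x)
  simpa only [homExt_coe] using h

/-- Smooth real functions on the sphere. -/
def TestFun : Submodule ℝ (S2 → ℝ) where
  carrier := {f | IsSmooth f}
  add_mem' hf hg := IsSmooth.add hf hg
  zero_mem' := isSmooth_zero
  smul_mem' c _ hf := IsSmooth.smul c hf

/-- Smooth tangent vector fields on the sphere. -/
def TestField : Submodule ℝ (S2 → E3) where
  carrier := {Φ | IsSmooth Φ ∧ ∀ x : S2, ⟪Φ x, (x : E3)⟫ = 0}
  add_mem' hf hg := ⟨hf.1.add hg.1, fun x => by simp [inner_add_left, hf.2 x, hg.2 x]⟩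
  zero_mem' := ⟨isSmooth_zero, fun x => by simp⟩
  smul_mem' c _ hf := ⟨hf.1.smul c, fun x => by simp [real_inner_smul_left, hf.2 x]⟩

/-! ### First and second order operators -/

lemma contDiffOn_fderiv_homExt {X : Type*} [NormedAddCommGroup X] [NormedSpace ℝ X]
    {f : S2 → X} (hf : IsSmooth f) : ContDiffOn ℝ ∞ (fderiv ℝ (homExt f)) {0}ᶜ :=
  ContDiffOn.fderiv_of_isOpen hf isOpen_punctured (by simp)

/-- The Riemannian gradient. -/
def grad (f : TestFun) : TestField :=
  ⟨fun x => gradient (homExt f.1) (x : E3), by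
    refine ⟨isSmooth_restrict (F := gradient (homExt f.1)) ?_, ?_⟩
    · exact ((InnerProductSpace.toDual ℝ E3).symm.toContinuousLinearEquiv.contDiff).comp_contDiffOn
        (contDiffOn_fderiv_homExt f.2)
    · intro x
      have hd : DifferentiableAt ℝ (homExt f.1) (x : E3) :=
        ((ContDiffOn.contDiffAt f.2
          (isOpen_punctured.mem_nhds (ne_zero_of_sphere x))).differentiableAt (by simp))
      have hc : HasDerivAt (fun t : ℝ => t • (x : E3)) ((1 : ℝ) • (x : E3)) 1 :=
        (hasDerivAt_id (1 : ℝ)).smul_const (x : E3)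
      have h1 : HasDerivAt (fun t : ℝ => homExt f.1 (t • (x : E3)))
          (fderiv ℝ (homExt f.1) (x : E3) (x : E3)) 1 := by
        have hd' : HasFDerivAt (homExt f.1) (fderiv ℝ (homExt f.1) (x : E3))
            ((1 : ℝ) • (x : E3)) := by simpa using hd.hasFDerivAt
        have h0 := hd'.comp_hasDerivAt (1 : ℝ) hc
        rw [one_smul] at h0
        exact h0
      have h2 : HasDerivAt (fun t : ℝ => homExt f.1 (t • (x : E3))) 0 1 := by
        refine (hasDerivAt_const (1 : ℝ) (f.1 x)).congr_of_eventuallyEq ?_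
        filter_upwards [lt_mem_nhds (zero_lt_one' ℝ)] with t ht
        exact homExt_smul_coe f.1 x t ht
      have h3 := h1.unique h2
      exact (InnerProductSpace.toDual_symm_apply (𝕜 := ℝ)).trans h3⟩

/-- The Riemannian divergence: for a tangent field it is the Euclidean divergence of the
extension constant along rays. -/
def divg (Φ : TestField) : TestFun :=
  ⟨fun x => ∑ i : Fin 3,
      (fderiv ℝ (homExt Φ.1) (x : E3) (EuclideanSpace.single i (1 : ℝ))) i, by
    refine isSmooth_restrict (F := fun y : E3 => ∑ i : Fin 3,
      (fderiv ℝ (homExt Φ.1) y (EuclideanSpace.single i (1 : ℝ))) i) ?_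
    refine ContDiffOn.sum fun i _ => ?_
    have h := (contDiffOn_fderiv_homExt Φ.2.1).clm_apply
      (contDiffOn_const (c := EuclideanSpace.single i (1 : ℝ)))
    exact (EuclideanSpace.proj (𝕜 := ℝ) i).contDiff.comp_contDiffOn h⟩

/-- The cross product of Euclidean three-space. -/
def cross (a b : E3) : E3 := WithLp.toLp 2 (crossProduct (WithLp.ofLp a) (WithLp.ofLp b))

/-- Rotation by a quarter turn in the tangent planes, `Φ ↦ n × Φ`, with `n` the outer normal. -/
def rot (Φ : TestField) : TestField :=
  ⟨fun x => cross (x : E3) (Φ.1 x), by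
    constructor
    · have h : IsSmooth (fun x : S2 => (fun y : E3 => cross y (homExt Φ.1 y)) (x : E3)) := by
        refine isSmooth_restrict (F := fun y : E3 => cross y (homExt Φ.1 y)) ?_
        have hΦ : ContDiffOn ℝ ∞ (homExt Φ.1) {0}ᶜ := Φ.2.1
        rw [contDiffOn_euclidean] at hΦ
        rw [contDiffOn_euclidean]
        have hid : ∀ i : Fin 3, ContDiffOn ℝ ∞ (fun y : E3 => y i) {0}ᶜ := fun i =>
          (EuclideanSpace.proj (𝕜 := ℝ) i).contDiff.contDiffOn
        intro i
        fin_cases i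
        · simpa [cross, cross_apply] using
            ((hid 1).mul (hΦ 2)).sub ((hid 2).mul (hΦ 1))
        · simpa [cross, cross_apply] using
            ((hid 2).mul (hΦ 0)).sub ((hid 0).mul (hΦ 2))
        · simpa [cross, cross_apply] using
            ((hid 0).mul (hΦ 1)).sub ((hid 1).mul (hΦ 0))
      simpa only [homExt_coe] using h
    · intro x
      simp [cross, cross_apply, PiLp.inner_apply, Fin.sum_univ_three]
      ring⟩

/-- The rotated gradient `n × ∇ f`. -/
def perpGrad (f : TestFun) : TestField := rot (grad f)

/-- The scalar curl (normal component of the curl): `curl (n × ∇ f) = Δ f`. -/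
def curl (Φ : TestField) : TestFun := -divg (rot Φ)

/-- The Laplace–Beltrami operator on functions. -/
def lap (f : TestFun) : TestFun := divg (grad f)

/-- The Laplacian on tangent fields (Hodge Laplacian, with the sign of `Δ`):
`∇ div Φ + (n × ∇) curl Φ`. -/
def vlap (Φ : TestField) : TestField := grad (divg Φ) + perpGrad (curl Φ)

/-! ### Inner products and Sobolev spaces -/

/-- The `L²` inner product of functions. -/
def l2 (f g : TestFun) : ℝ := ∫ x, f.1 x * g.1 x ∂surf

/-- The `L²` inner product of tangent fields. -/
def vl2 (Φ Ψ : TestField) : ℝ := ∫ x, ⟪Φ.1 x, Ψ.1 x⟫ ∂surf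

/-- The square of the `L²` norm of the orthogonal projection of `f` to the eigenspace of `-Δ`
with eigenvalue `ℓ (ℓ + 1)` (the spherical harmonics of degree `ℓ`). -/
def levelSq (ℓ : ℕ) (f : TestFun) : ℝ :=
  sSup {a | ∃ h : TestFun, lap h = -((ℓ : ℝ) * (ℓ + 1)) • h ∧ l2 h h ≤ 1 ∧ a = l2 f h ^ 2}

/-- The same for tangent fields and the eigenspaces of the Hodge Laplacian. -/
def vlevelSq (ℓ : ℕ) (Φ : TestField) : ℝ :=
  sSup {a | ∃ Ψ : TestField,
    vlap Ψ = -((ℓ : ℝ) * (ℓ + 1)) • Ψ ∧ vl2 Ψ Ψ ≤ 1 ∧ a = vl2 Φ Ψ ^ 2}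

/-- The norm `‖(1 - Δ) ^ (s / 2) f‖` in `L²` of a smooth function, for real `s`. -/
def sobNorm (s : ℝ) (f : TestFun) : ℝ :=
  Real.sqrt (∑' ℓ : ℕ, (1 + (ℓ : ℝ) * (ℓ + 1)) ^ s * levelSq ℓ f)

/-- The norm `‖(1 - Δ) ^ (s / 2) Φ‖` in `L²` of a smooth tangent field, for real `s`. -/
def vsobNorm (s : ℝ) (Φ : TestField) : ℝ :=
  Real.sqrt (∑' ℓ : ℕ, (1 + (ℓ : ℝ) * (ℓ + 1)) ^ s * vlevelSq ℓ Φ)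

/-- Linear functionals on smooth functions. -/
abbrev Functional : Type := TestFun →ₗ[ℝ] ℝ

/-- Linear functionals on smooth tangent fields. -/
abbrev VFunctional : Type := TestField →ₗ[ℝ] ℝ

/-- The scalar Sobolev space of real order `s`: the distributions that are bounded for the norm
of order `-s`. -/
def Sob (s : ℝ) : Submodule ℝ Functional where
  carrier := {T | ∃ C : ℝ, ∀ f, |T f| ≤ C * sobNorm (-s) f}
  zero_mem' := ⟨0, fun f => by simp⟩
  add_mem' := by
    rintro S T ⟨C, hC⟩ ⟨D, hD⟩
    refine ⟨C + D, fun f => ?_⟩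
    rw [LinearMap.add_apply, add_mul]
    exact (abs_add_le _ _).trans (add_le_add (hC f) (hD f))
  smul_mem' := by
    rintro c T ⟨C, hC⟩
    refine ⟨|c| * C, fun f => ?_⟩
    rw [LinearMap.smul_apply, smul_eq_mul, abs_mul, mul_assoc]
    exact mul_le_mul_of_nonneg_left (hC f) (abs_nonneg c)

/-- The Sobolev space of real order `s` of tangent fields: the distributions that are bounded
for the norm of order `-s`. -/
def VSob (s : ℝ) : Submodule ℝ VFunctional where
  carrier := {T | ∃ C : ℝ, ∀ Φ, |T Φ| ≤ C * vsobNorm (-s) Φ}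
  zero_mem' := ⟨0, fun f => by simp⟩
  add_mem' := by
    rintro S T ⟨C, hC⟩ ⟨D, hD⟩
    refine ⟨C + D, fun f => ?_⟩
    rw [LinearMap.add_apply, add_mul]
    exact (abs_add_le _ _).trans (add_le_add (hC f) (hD f))
  smul_mem' := by
    rintro c T ⟨C, hC⟩
    refine ⟨|c| * C, fun f => ?_⟩
    rw [LinearMap.smul_apply, smul_eq_mul, abs_mul, mul_assoc]
    exact mul_le_mul_of_nonneg_left (hC f) (abs_nonneg c)

/-- The norm of order `s` of a functional on tangent fields: its smallest bound for the norm of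
order `-s`, infinite if there is none. -/
def vnorm (s : ℝ) (T : VFunctional) : ℝ≥0∞ :=
  ⨅ (C : ℝ≥0) (_ : ∀ Φ, |T Φ| ≤ C * vsobNorm (-s) Φ), (C : ℝ≥0∞)

lemma integrable_inner (Φ Ψ : TestField) :
    Integrable (fun x => ⟪Φ.1 x, Ψ.1 x⟫) surf := by
  have hc : Continuous (fun x => ⟪Φ.1 x, Ψ.1 x⟫) :=
    Φ.2.1.continuous.inner Ψ.2.1.continuous
  exact hc.integrable_of_hasCompactSupport (HasCompactSupport.of_compactSpace _)

/-- A smooth tangent field as a distribution. -/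
def toFunctional (Φ : TestField) : VFunctional where
  toFun Ψ := vl2 Φ Ψ
  map_add' Ψ₁ Ψ₂ := by
    simp only [vl2]
    rw [← integral_add (integrable_inner Φ Ψ₁) (integrable_inner Φ Ψ₂)]
    congr 1
    funext x
    exact inner_add_right _ _ _
  map_smul' c Ψ := by
    simp only [vl2, RingHom.id_apply, smul_eq_mul]
    rw [← integral_const_mul]
    congr 1
    funext x
    exact real_inner_smul_right _ _ _

/-- The filter of the smooth tangent fields that approach `w` in the norm of order `s`. -/
def approaching (s : ℝ) (w : VFunctional) : Filter TestField :=
  comap (fun Φ => vnorm s (toFunctional Φ - w)) (𝓝 0)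

/-- The dual pairing of `v` of order `-s` with `w` of order `s`: the limit of `v Φ` as the smooth
field `Φ` approaches `w` in the norm of order `s`. -/
def dualPairing (s : ℝ) (v w : VFunctional) : ℝ := limUnder (approaching s w) v

/-- A distribution is divergence free if it annihilates gradients. -/
def IsDivFree (w : VFunctional) : Prop := ∀ f, w (grad f) = 0

/-- `u` is the divergence-free part of `w`. -/
def IsLeray (w u : VFunctional) : Prop :=
  IsDivFree u ∧ ∀ f, u (perpGrad f) = w (perpGrad f)

open Classical in
/-- The (Helmholtz–Leray) projection to divergence-free distributions. -/
def leray (w : VFunctional) : VFunctional :=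
  if h : ∃ u, IsLeray w u then h.choose else 0

open Classical in
/-- The inverse `(-Δ)⁻¹` of the Hodge Laplacian on distributional tangent fields. -/
def invLap (w : VFunctional) : VFunctional :=
  if h : ∃ u : VFunctional, ∀ Φ, u (-vlap Φ) = w Φ then h.choose else 0

/-! ### The enstrophy measure and its velocity field -/

/-- The intersection of the scalar Sobolev spaces of order below `-1`. -/
def SobBelowMinusOne : Submodule ℝ Functional := ⨅ (ε : ℝ) (_ : 0 < ε), Sob (-1 - ε)

/-- The intersection of the Sobolev spaces of tangent fields of negative order. -/
def VSobBelowZero : Submodule ℝ VFunctional := ⨅ (ε : ℝ) (_ : 0 < ε), VSob (-ε)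

/-- The σ-algebra generated by the evaluations at test functions. -/
instance : MeasurableSpace SobBelowMinusOne :=
  MeasurableSpace.comap (fun T (f : TestFun) => T.1 f) MeasurableSpace.pi

/-- The σ-algebra generated by the evaluations at test fields. -/
instance : MeasurableSpace VSobBelowZero :=
  MeasurableSpace.comap (fun T (Φ : TestField) => T.1 Φ) MeasurableSpace.pi

/-- The enstrophy measure (white noise): the centered Gaussian measure with identity
covariance. -/
structure IsEnstrophyMeasure (μ : Measure SobBelowMinusOne) : Prop where
  isProbability : IsProbabilityMeasure μ
  gaussian : ∀ f : TestFun, ∃ σ2 : ℝ≥0, μ.map (fun η => η.1 f) = gaussianReal 0 σ2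
  covariance : ∀ f g : TestFun, ∫ η, η.1 f * η.1 g ∂μ = l2 f g

/-- `v` is the divergence-free field whose curl is the mean-zero part of `η`; in the
distributional sense, `(curl v) f = -v (n × ∇ f)`. -/
def IsVelocityOf (η : Functional) (v : VFunctional) : Prop :=
  IsDivFree v ∧ ∀ f : TestFun, ∫ x, f.1 x ∂surf = 0 → -v (perpGrad f) = η f

open Classical in
/-- The Biot–Savart map, from vorticity to velocity. -/
def biotSavart (η : SobBelowMinusOne) : VSobBelowZero :=
  if h : ∃ v : VSobBelowZero, IsVelocityOf η.1 v.1 then h.choose else 0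

/-- The law of the velocity field associated with a measure on vorticities. -/
def velocityLaw (μ : Measure SobBelowMinusOne) : Measure VSobBelowZero := μ.map biotSavart

/-- A linear map `J` from tangent fields of order `-1` to `L²(ξ)` which is continuous and, on
fields `w` of positive order, is the random variable `v ↦ ⟨v, w⟩`. -/
def IsPairingExtension (ξ : Measure VSobBelowZero) (J : VSob (-1) →ₗ[ℝ] Lp ℝ 2 ξ) : Prop :=
  (∀ ε : ℝ, 0 < ε → ∀ w : VSob (-1), w.1 ∈ VSob ε →
    J w =ᵐ[ξ] fun v => dualPairing ε v.1 w.1) ∧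
  ∃ C : ℝ≥0, ∀ w : VSob (-1), ‖J w‖ₑ ≤ C * vnorm (-1) w.1

/-- The real random variable `X` is centered Gaussian with variance `σ2`. -/
def IsCenteredGaussian {Ω : Type*} [MeasurableSpace Ω] (P : Measure Ω) (X : Ω → ℝ) (σ2 : ℝ) :
    Prop :=
  0 ≤ σ2 ∧ AEMeasurable X P ∧ P.map X = gaussianReal 0 σ2.toNNReal

/-! ### Curves -/

/-- Lipschitz boundary: near each boundary point `p`, in the coordinates given by the orthogonal
projection to the tangent plane at `p` with a suitable orthonormal frame, the set is the region
above the graph of a Lipschitz function. -/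
def HasLipschitzBoundary (A : Set S2) : Prop :=
  ∀ p ∈ frontier A, ∃ e₁ e₂ : E3,
    ‖e₁‖ = 1 ∧ ‖e₂‖ = 1 ∧ ⟪e₁, e₂⟫ = 0 ∧ ⟪e₁, (p : E3)⟫ = 0 ∧ ⟪e₂, (p : E3)⟫ = 0 ∧
    ∃ (r : ℝ) (L : ℝ≥0) (g : ℝ → ℝ), 0 < r ∧ LipschitzWith L g ∧
      ∀ x : S2, dist x p < r → (x ∈ A ↔ g ⟪e₁, (x : E3)⟫ < ⟪e₂, (x : E3)⟫)

/-- The velocity `γ' t`, as a vector of Euclidean three-space. -/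
def curveDeriv (γ : ℝ → S2) (t : ℝ) : E3 := deriv (fun τ => (γ τ : E3)) t

/-- A regular Lipschitz closed curve on `[a, b]` that parametrizes the boundary of a connected
open set with Lipschitz boundary. -/
structure IsRegularBoundaryCurve (a b : ℝ) (γ : ℝ → S2) : Prop where
  lt : a < b
  lipschitz : ∃ L : ℝ≥0, LipschitzOnWith L γ (Set.Icc a b)
  regular : ∃ c : ℝ, 0 < c ∧ ∀ᵐ t ∂(volume.restrict (Set.Icc a b)), c ≤ ‖curveDeriv γ t‖
  closed : γ a = γ b
  injOn : Set.InjOn γ (Set.Ico a b)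
  boundary : ∃ A : Set S2, IsOpen A ∧ IsConnected A ∧ HasLipschitzBoundary A ∧
    γ '' Set.Icc a b = frontier A

/-- `T` is the rectifiable current of `γ`: `T Φ` is the line integral of `Φ` along `γ`. -/
def IsCurrentOf (a b : ℝ) (γ : ℝ → S2) (T : VFunctional) : Prop :=
  ∀ Φ : TestField,
    IntervalIntegrable (fun t => ⟪Φ.1 (γ t), curveDeriv γ t⟫) volume a b ∧
    T Φ = ∫ t in a..b, ⟪Φ.1 (γ t), curveDeriv γ t⟫

end SphereEuler

end

noncomputable section

namespace SphereEuler

open MeasureTheory ProbabilityTheory Filter Topology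
open scoped ContDiff NNReal ENNReal RealInnerProductSpace

/-! ### Partial derivatives off the origin -/

/-- The partial derivative in the direction of a coordinate axis. -/
def pd (i : Fin 3) (F : E3 → ℝ) (y : E3) : ℝ := fderiv ℝ F y (EuclideanSpace.single i (1 : ℝ))

/-- Smoothness off the origin. -/
abbrev SmoothOff (F : E3 → ℝ) : Prop := ContDiffOn ℝ ∞ F {0}ᶜ

lemma SmoothOff.contDiffAt {F : E3 → ℝ} (hF : SmoothOff F) {y : E3} (hy : y ≠ 0) :
    ContDiffAt ℝ ∞ F y :=
  ContDiffOn.contDiffAt hF (isOpen_punctured.mem_nhds hy)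

lemma SmoothOff.differentiableAt {F : E3 → ℝ} (hF : SmoothOff F) {y : E3} (hy : y ≠ 0) :
    DifferentiableAt ℝ F y := (hF.contDiffAt hy).differentiableAt (by simp)

lemma SmoothOff.pd {F : E3 → ℝ} (hF : SmoothOff F) (i : Fin 3) : SmoothOff (pd i F) :=
  (ContDiffOn.fderiv_of_isOpen hF isOpen_punctured (by simp)).clm_apply contDiffOn_const

lemma smoothOff_coord (i : Fin 3) : SmoothOff (fun y => y i) :=
  (EuclideanSpace.proj (𝕜 := ℝ) i).contDiff.contDiffOn

lemma pd_congr {F G : E3 → ℝ} (h : ∀ y, y ≠ 0 → F y = G y) (i : Fin 3) {y : E3} (hy : y ≠ 0) :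
    pd i F y = pd i G y := by
  have : F =ᶠ[𝓝 y] G := by
    filter_upwards [isOpen_punctured.mem_nhds hy] with z hz using h z hz
  simp only [SphereEuler.pd, this.fderiv_eq]

lemma pd_add {F G : E3 → ℝ} (hF : SmoothOff F) (hG : SmoothOff G) (i : Fin 3) {y : E3}
    (hy : y ≠ 0) : pd i (fun y => F y + G y) y = pd i F y + pd i G y := by
  have := fderiv_add (hF.differentiableAt hy) (hG.differentiableAt hy)
  unfold SphereEuler.pd
  rw [show (fun y => F y + G y) = F + G from rfl, this]; rfl

lemma pd_sub {F G : E3 → ℝ} (hF : SmoothOff F) (hG : SmoothOff G) (i : Fin 3) {y : E3}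
    (hy : y ≠ 0) : pd i (fun y => F y - G y) y = pd i F y - pd i G y := by
  have := fderiv_sub (hF.differentiableAt hy) (hG.differentiableAt hy)
  unfold SphereEuler.pd
  rw [show (fun y => F y - G y) = F - G from rfl, this]; rfl

lemma pd_mul {F G : E3 → ℝ} (hF : SmoothOff F) (hG : SmoothOff G) (i : Fin 3) {y : E3}
    (hy : y ≠ 0) : pd i (fun y => F y * G y) y = F y * pd i G y + pd i F y * G y := by
  have := fderiv_mul (hF.differentiableAt hy) (hG.differentiableAt hy)
  unfold SphereEuler.pd
  rw [show (fun y => F y * G y) = F * G from rfl, this]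
  simp [mul_comm]

lemma pd_const (c : ℝ) (i : Fin 3) (y : E3) : pd i (fun _ => c) y = 0 := by
  simp [SphereEuler.pd]

lemma pd_coord (i j : Fin 3) (y : E3) :
    pd i (fun y : E3 => y j) y = if j = i then 1 else 0 := by
  have : HasFDerivAt (fun y : E3 => y j) (EuclideanSpace.proj (𝕜 := ℝ) j) y :=
    (EuclideanSpace.proj (𝕜 := ℝ) j).hasFDerivAt
  unfold SphereEuler.pd
  rw [this.fderiv]
  simp [PiLp.single_apply]

lemma pd_comm {F : E3 → ℝ} (hF : SmoothOff F) (i j : Fin 3) {y : E3} (hy : y ≠ 0) :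
    pd i (pd j F) y = pd j (pd i F) y := by
  have hd : DifferentiableAt ℝ (fderiv ℝ F) y :=
    ((ContDiffOn.fderiv_of_isOpen hF isOpen_punctured (m := ∞) (by simp)).contDiffAt
      (isOpen_punctured.mem_nhds hy)).differentiableAt (by simp)
  have key : ∀ a b : Fin 3, pd a (pd b F) y =
      fderiv ℝ (fderiv ℝ F) y (EuclideanSpace.single a (1 : ℝ))
        (EuclideanSpace.single b (1 : ℝ)) := by
    intro a b
    have := hd.hasFDerivAt.clm_apply (hasFDerivAt_const (EuclideanSpace.single b (1 : ℝ)) y)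
    unfold SphereEuler.pd
    rw [this.fderiv]
    simp
  rw [key, key]
  exact ((hF.contDiffAt hy).isSymmSndFDerivAt (by simp; exact WithTop.coe_le_coe.2 (le_top : (2 : ℕ∞) ≤ ⊤))) _ _

lemma fderiv_eq_sum_pd (F : E3 → ℝ) (y v : E3) : fderiv ℝ F y v = ∑ i, v i * pd i F y := by
  have hv : v = ∑ i, v i • EuclideanSpace.single i (1 : ℝ) := by
    ext j
    simp [Fin.sum_univ_three, PiLp.single_apply]
    fin_cases j <;> simp
  conv_lhs => rw [hv]
  simp [map_sum, SphereEuler.pd]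

lemma sum_sq_coord (y : E3) : y 0 ^ 2 + y 1 ^ 2 + y 2 ^ 2 = ‖y‖ ^ 2 := by
  simp [EuclideanSpace.norm_sq_eq, Fin.sum_univ_three]

lemma inner_eq_three (a b : E3) : ⟪a, b⟫ = a 0 * b 0 + a 1 * b 1 + a 2 * b 2 := by
  simp [PiLp.inner_apply, Fin.sum_univ_three, mul_comm]

lemma norm_mul_radial (y : E3) (hy : y ≠ 0) : ‖y‖ • ((radial y hy : S2) : E3) = y := by
  simp [radial, smul_smul, norm_ne_zero_iff.2 hy]

/-! ### Functions that are constant along rays -/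

/-- Constancy along rays. -/
def RayConst (F : E3 → ℝ) : Prop := ∀ t : ℝ, 0 < t → ∀ y : E3, y ≠ 0 → F (t • y) = F y

lemma rayConst_homExt (f : S2 → ℝ) : RayConst (homExt f) := by
  intro t ht y hy
  rw [← norm_mul_radial y hy, smul_smul, homExt_smul_coe _ _ _ (mul_pos ht (norm_pos_iff.2 hy)),
    homExt_smul_coe _ _ _ (norm_pos_iff.2 hy)]

lemma RayConst.eq_homExt {F : E3 → ℝ} (hF : RayConst F) {y : E3} (hy : y ≠ 0) :
    homExt (fun x : S2 => F x) y = F y := by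
  rw [homExt_of_ne _ hy]
  exact hF _ (inv_pos.2 (norm_pos_iff.2 hy)) y hy

lemma RayConst.pd_smul {F : E3 → ℝ} (hF : RayConst F) (hs : SmoothOff F) (i : Fin 3) {t : ℝ}
    (ht : 0 < t) {y : E3} (hy : y ≠ 0) : pd i F (t • y) = t⁻¹ * pd i F y := by
  have hty : t • y ≠ 0 := smul_ne_zero ht.ne' hy
  have h1 : HasFDerivAt (fun z : E3 => F (t • z))
      ((fderiv ℝ F (t • y)).comp (t • ContinuousLinearMap.id ℝ E3)) y :=
    (hs.differentiableAt hty).hasFDerivAt.comp y ((hasFDerivAt_id y).const_smul t)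
  have h2 : HasFDerivAt (fun z : E3 => F (t • z)) (fderiv ℝ F y) y := by
    refine (hs.differentiableAt hy).hasFDerivAt.congr_of_eventuallyEq ?_
    filter_upwards [isOpen_punctured.mem_nhds hy] with z hz using hF t ht z hz
  have h3 := congrArg (fun T : E3 →L[ℝ] ℝ => T (EuclideanSpace.single i (1 : ℝ))) (h1.unique h2)
  simp only [ContinuousLinearMap.comp_apply, smul_apply,
    ContinuousLinearMap.id_apply, map_smul, smul_eq_mul] at h3
  unfold SphereEuler.pd
  rw [← h3, ← mul_assoc, inv_mul_cancel₀ ht.ne', one_mul]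

lemma RayConst.euler {F : E3 → ℝ} (hF : RayConst F) (hs : SmoothOff F) {y : E3} (hy : y ≠ 0) :
    y 0 * pd 0 F y + y 1 * pd 1 F y + y 2 * pd 2 F y = 0 := by
  have hc : HasDerivAt (fun t : ℝ => t • y) ((1 : ℝ) • y) 1 :=
    (hasDerivAt_id (1 : ℝ)).smul_const y
  have hd' : HasFDerivAt F (fderiv ℝ F y) ((1 : ℝ) • y) := by
    simpa using (hs.differentiableAt hy).hasFDerivAt
  have h1 := hd'.comp_hasDerivAt (1 : ℝ) hc
  have h2 : HasDerivAt (F ∘ fun t : ℝ => t • y) 0 1 := by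
    refine (hasDerivAt_const (1 : ℝ) (F y)).congr_of_eventuallyEq ?_
    filter_upwards [lt_mem_nhds (zero_lt_one' ℝ)] with t ht using hF t ht y hy
  have h3 := h1.unique h2
  rw [one_smul, fderiv_eq_sum_pd, Fin.sum_univ_three] at h3
  exact h3

lemma smoothOff_homExt (f : TestFun) : SmoothOff (homExt f.1) := f.2

/-! ### Components and angular derivatives -/

lemma homExt_comp (Φ : S2 → E3) (i : Fin 3) (y : E3) :
    homExt (fun x => Φ x i) y = homExt Φ y i := by
  by_cases hy : y ≠ 0 <;> simp [homExt, hy]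

/-- The Cartesian components of a tangent field. -/
def component (i : Fin 3) : TestField →ₗ[ℝ] TestFun where
  toFun Φ := ⟨fun x => Φ.1 x i, by
    have hΦ : ContDiffOn ℝ ∞ (homExt Φ.1) {0}ᶜ := Φ.2.1
    rw [contDiffOn_euclidean] at hΦ
    refine (hΦ i).congr fun y _ => homExt_comp _ _ _⟩
  map_add' _ _ := rfl
  map_smul' _ _ := rfl

/-- The angular derivatives: the components of `n × ∇ f`. -/
def ang (i : Fin 3) (f : TestFun) : TestFun := component i (perpGrad f)

/-- The differential operator `y × ∇` in the ambient space. -/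
def angF (i : Fin 3) (F : E3 → ℝ) (y : E3) : ℝ :=
  y (i + 1) * pd (i + 2) F y - y (i + 2) * pd (i + 1) F y

lemma component_apply (i : Fin 3) (Φ : TestField) (x : S2) : (component i Φ).1 x = Φ.1 x i := rfl

lemma field_ext {Φ Ψ : TestField} (h : ∀ i, component i Φ = component i Ψ) : Φ = Ψ := by
  apply Subtype.ext; funext x; ext i
  exact congrFun (congrArg Subtype.val (h i)) x

lemma grad_apply (f : TestFun) (x : S2) (i : Fin 3) : (grad f).1 x i = pd i (homExt f.1) x := by
  have : (grad f).1 x i = ⟪gradient (homExt f.1) (x : E3), EuclideanSpace.single i (1 : ℝ)⟫ := by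
    rw [EuclideanSpace.inner_single_right]; simp [grad]
  rw [this]
  exact InnerProductSpace.toDual_symm_apply (𝕜 := ℝ)

lemma cross_apply' (a b : E3) (i : Fin 3) :
    cross a b i = a (i + 1) * b (i + 2) - a (i + 2) * b (i + 1) := by
  fin_cases i <;> simp [cross, cross_apply]

lemma ang_apply (i : Fin 3) (f : TestFun) (x : S2) : (ang i f).1 x = angF i (homExt f.1) x := by
  change cross (x : E3) ((grad f).1 x) i = _
  rw [cross_apply', grad_apply, grad_apply]; rfl

lemma RayConst.angF {F : E3 → ℝ} (hF : RayConst F) (hs : SmoothOff F) (i : Fin 3) :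
    RayConst (angF i F) := by
  intro t ht y hy
  simp only [SphereEuler.angF, hF.pd_smul hs _ ht hy, PiLp.smul_apply, smul_eq_mul]
  field_simp

lemma homExt_ang (i : Fin 3) (f : TestFun) {y : E3} (hy : y ≠ 0) :
    homExt (ang i f).1 y = angF i (homExt f.1) y := by
  have h : (ang i f).1 = fun x : S2 => angF i (homExt f.1) x := funext fun x => ang_apply i f x
  rw [h]
  exact ((rayConst_homExt f.1).angF (smoothOff_homExt f) i).eq_homExt hy

lemma divg_apply (Φ : TestField) (x : S2) :
    (divg Φ).1 x = ∑ i, pd i (homExt (component i Φ).1) x := by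
  have hd : DifferentiableAt ℝ (homExt Φ.1) (x : E3) :=
    ((ContDiffOn.contDiffAt Φ.2.1
      (isOpen_punctured.mem_nhds (ne_zero_of_sphere x))).differentiableAt (by simp))
  change ∑ i : Fin 3, (fderiv ℝ (homExt Φ.1) (x : E3) (EuclideanSpace.single i (1 : ℝ))) i = _
  refine Finset.sum_congr rfl fun i _ => ?_
  have h : homExt (component i Φ).1 = fun y => homExt Φ.1 y i := funext fun y => homExt_comp _ _ _
  have h2 : HasFDerivAt (fun y => homExt Φ.1 y i)
      ((EuclideanSpace.proj (𝕜 := ℝ) i).comp (fderiv ℝ (homExt Φ.1) (x : E3))) (x : E3) :=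
    (EuclideanSpace.proj (𝕜 := ℝ) i).hasFDerivAt.comp _ hd.hasFDerivAt
  rw [h]; unfold SphereEuler.pd; rw [h2.fderiv]; rfl

lemma tangent_homExt (Φ : TestField) {y : E3} (hy : y ≠ 0) :
    y 0 * homExt (component 0 Φ).1 y + y 1 * homExt (component 1 Φ).1 y
      + y 2 * homExt (component 2 Φ).1 y = 0 := by
  have h := Φ.2.2 (radial y hy)
  rw [inner_eq_three] at h
  simp only [homExt_of_ne _ hy, component_apply]
  have hn := norm_mul_radial y hy
  have e : ∀ i, y i = ‖y‖ * ((radial y hy : S2) : E3) i := fun i => by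
    conv_lhs => rw [← hn]
    rfl
  rw [e 0, e 1, e 2]
  linear_combination ‖y‖ * h

lemma rot_rot (Φ : TestField) : rot (rot Φ) = -Φ := by
  apply Subtype.ext; funext x; ext i
  have h := Φ.2.2 x
  have hx := sum_sq_coord (x : E3)
  rw [norm_coe_sphere] at hx
  rw [inner_eq_three] at h
  change cross (x : E3) (cross (x : E3) (Φ.1 x)) i = - (Φ.1 x i)
  simp only [cross_apply']
  fin_cases i <;> simp
  · linear_combination (x : E3) 0 * h - (Φ.1 x 0) * hx
  · linear_combination (x : E3) 1 * h - (Φ.1 x 1) * hx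
  · linear_combination (x : E3) 2 * h - (Φ.1 x 2) * hx

/-! ### The algebra of test functions -/

/-- The product of test functions. -/
def tmul (f g : TestFun) : TestFun :=
  ⟨fun x => f.1 x * g.1 x, by
    have h : ContDiffOn ℝ ∞ (fun y => homExt f.1 y * homExt g.1 y) {0}ᶜ :=
      (smoothOff_homExt f).mul (smoothOff_homExt g)
    exact h.congr fun y hy => by
      have hy' : y ≠ 0 := hy
      simp only [homExt_of_ne _ hy']⟩

/-- The constant test functions. -/
def tconst (c : ℝ) : TestFun := ⟨fun _ => c, isSmooth_restrict contDiffOn_const⟩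

/-- The coordinate functions. -/
def tcoord (i : Fin 3) : TestFun := ⟨fun x => (x : E3) i, isSmooth_restrict (smoothOff_coord i)⟩

lemma homExt_tmul (f g : TestFun) (y : E3) :
    homExt (tmul f g).1 y = homExt f.1 y * homExt g.1 y := by
  by_cases hy : y ≠ 0 <;> simp [homExt, hy, tmul]

lemma homExt_tconst (c : ℝ) {y : E3} (hy : y ≠ 0) : homExt (tconst c).1 y = c := by
  simp [homExt_of_ne _ hy, tconst]

lemma homExt_tcoord (i : Fin 3) {y : E3} (hy : y ≠ 0) : homExt (tcoord i).1 y = ‖y‖⁻¹ * y i := by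
  simp [homExt_of_ne _ hy, tcoord, radial]

lemma fun_ext {f g : TestFun} (h : ∀ x, f.1 x = g.1 x) : f = g := Subtype.ext (funext h)

lemma ang_add (i : Fin 3) (f g : TestFun) : ang i (f + g) = ang i f + ang i g := by
  refine fun_ext fun x => ?_
  have hx := ne_zero_of_sphere x
  have h : ∀ j, pd j (homExt (f + g).1) x = pd j (homExt f.1) x + pd j (homExt g.1) x := fun j => by
    rw [← pd_add (smoothOff_homExt f) (smoothOff_homExt g) j hx]
    exact pd_congr (fun y _ => congrFun (homExt_add f.1 g.1) y) j hx
  change _ = (ang i f).1 x + (ang i g).1 x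
  simp only [ang_apply, angF, h]; ring

lemma ang_tmul (i : Fin 3) (f g : TestFun) :
    ang i (tmul f g) = tmul f (ang i g) + tmul (ang i f) g := by
  refine fun_ext fun x => ?_
  have hx := ne_zero_of_sphere x
  have h : ∀ j, pd j (homExt (tmul f g).1) x
      = f.1 x * pd j (homExt g.1) x + pd j (homExt f.1) x * g.1 x := fun j => by
    have := pd_mul (smoothOff_homExt f) (smoothOff_homExt g) j hx
    rw [homExt_coe, homExt_coe] at this
    rw [← this]
    exact pd_congr (fun y _ => homExt_tmul f g y) j hx
  change _ = f.1 x * (ang i g).1 x + (ang i f).1 x * g.1 x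
  simp only [ang_apply, angF, h]; ring

lemma ang_tconst (i : Fin 3) (c : ℝ) : ang i (tconst c) = 0 := by
  refine fun_ext fun x => ?_
  have h : ∀ j, pd j (homExt (tconst c).1) x = 0 := fun j => by
    rw [pd_congr (G := fun _ => c) (fun y hy => homExt_tconst c hy) j (ne_zero_of_sphere x),
      pd_const]
  simp [ang_apply, angF, h]

lemma smul_eq_tmul (c : ℝ) (f : TestFun) : c • f = tmul (tconst c) f := rfl

lemma ang_smul (i : Fin 3) (c : ℝ) (f : TestFun) : ang i (c • f) = c • ang i f := by
  rw [smul_eq_tmul, ang_tmul, ang_tconst, smul_eq_tmul]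
  refine fun_ext fun x => ?_
  change _ + (0 : ℝ) * _ = _
  simp

/-- Angular derivatives as linear maps. -/
def angL (i : Fin 3) : TestFun →ₗ[ℝ] TestFun where
  toFun := ang i
  map_add' := ang_add i
  map_smul' := ang_smul i

/-! ### Powers of the norm -/

lemma smoothOff_zpow_norm (k : ℤ) : SmoothOff (fun y => ‖y‖ ^ k) := by
  intro y hy
  have hy' : y ≠ 0 := hy
  have h : ContDiffAt ℝ ∞ (fun y : E3 => ‖y‖) y := contDiffAt_norm ℝ hy'
  refine ContDiffAt.contDiffWithinAt ?_
  have hn : ‖y‖ ≠ 0 := norm_ne_zero_iff.2 hy'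
  cases k with
  | ofNat n => simpa using h.pow n
  | negSucc n =>
    simp only [zpow_negSucc]
    exact (h.pow (n + 1)).inv (pow_ne_zero _ hn)

lemma smoothOff_norm : SmoothOff (fun y => ‖y‖) := by simpa using smoothOff_zpow_norm 1

lemma pd_norm (i : Fin 3) {y : E3} (hy : y ≠ 0) : pd i (fun y => ‖y‖) y = y i * ‖y‖⁻¹ := by
  have hn : ‖y‖ ≠ 0 := norm_ne_zero_iff.2 hy
  have h1 := pd_mul smoothOff_norm smoothOff_norm i hy
  have h2 : pd i (fun y : E3 => ‖y‖ * ‖y‖) y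
      = pd i (fun y : E3 => (y 0 * y 0 + y 1 * y 1) + y 2 * y 2) y :=
    pd_congr (fun z _ => by have := sum_sq_coord z; linear_combination -this) i hy
  have hc := smoothOff_coord
  rw [h2, pd_add (((hc 0).mul (hc 0)).add ((hc 1).mul (hc 1))) ((hc 2).mul (hc 2)) i hy,
    pd_add ((hc 0).mul (hc 0)) ((hc 1).mul (hc 1)) i hy, pd_mul (hc 0) (hc 0) i hy,
    pd_mul (hc 1) (hc 1) i hy, pd_mul (hc 2) (hc 2) i hy] at h1
  simp only [pd_coord] at h1
  have h3 : 2 * (‖y‖ * pd i (fun y => ‖y‖) y) = 2 * y i := by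
    rw [two_mul]
    nth_rewrite 2 [mul_comm]
    rw [← h1]
    fin_cases i <;> simp <;> ring
  field_simp
  linarith

lemma pd_zpow_norm (k : ℤ) (i : Fin 3) {y : E3} (hy : y ≠ 0) :
    pd i (fun y => ‖y‖ ^ k) y = k * ‖y‖ ^ (k - 2) * y i := by
  have hn : ‖y‖ ≠ 0 := norm_ne_zero_iff.2 hy
  have h1 := (hasDerivAt_zpow k ‖y‖ (Or.inl hn)).comp_hasFDerivAt y
    (smoothOff_norm.differentiableAt hy).hasFDerivAt
  have h2 : pd i (fun y => ‖y‖ ^ k) y = (k * ‖y‖ ^ (k - 1)) * pd i (fun y => ‖y‖) y := by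
    unfold pd
    rw [show (fun y : E3 => ‖y‖ ^ k) = (fun x => x ^ k) ∘ (fun y => ‖y‖) from rfl, h1.fderiv]
    simp
  rw [h2, pd_norm i hy, show k - 1 = (k - 2) + 1 by ring, zpow_add_one₀ hn]
  field_simp

lemma pd_tcoord (k j : Fin 3) (x : S2) : pd k (homExt (tcoord j).1) x
      = (if j = k then 1 else 0) - (x : E3) k * (x : E3) j := by
  have hx := ne_zero_of_sphere x
  rw [pd_congr (G := fun y => ‖y‖ ^ (-1 : ℤ) * y j)
      (fun y hy => by rw [homExt_tcoord j hy]; simp) k hx,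
      pd_mul (smoothOff_zpow_norm _) (smoothOff_coord j) k hx, pd_coord, pd_zpow_norm _ k hx,
      norm_coe_sphere]
  simp; ring

lemma ang_tcoord_self (i : Fin 3) : ang i (tcoord i) = 0 := by
  refine fun_ext fun x => ?_
  rw [ang_apply, angF, pd_tcoord, pd_tcoord]
  change _ = (0 : ℝ)
  fin_cases i <;> simp <;> ring

lemma ang_tcoord_one (i : Fin 3) : ang i (tcoord (i + 1)) = -tcoord (i + 2) := by
  refine fun_ext fun x => ?_
  rw [ang_apply, angF, pd_tcoord, pd_tcoord]
  change _ = - (x : E3) (i + 2)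
  fin_cases i <;> simp <;> ring

lemma ang_tcoord_two (i : Fin 3) : ang i (tcoord (i + 2)) = tcoord (i + 1) := by
  refine fun_ext fun x => ?_
  rw [ang_apply, angF, pd_tcoord, pd_tcoord]
  change _ = (x : E3) (i + 1)
  fin_cases i <;> simp <;> ring

/-! ### The divergence, the curl and the Laplacian through angular derivatives -/

lemma component_rot (i : Fin 3) (Φ : TestField) : component i (rot Φ)
    = tmul (tcoord (i + 1)) (component (i + 2) Φ)
      - tmul (tcoord (i + 2)) (component (i + 1) Φ) := by
  refine fun_ext fun x => ?_
  exact cross_apply' _ _ _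

lemma ang_sub (i : Fin 3) (f g : TestFun) : ang i (f - g) = ang i f - ang i g :=
  (angL i).map_sub f g

lemma ang_neg (i : Fin 3) (f : TestFun) : ang i (-f) = -ang i f := (angL i).map_neg f

lemma tangent (Φ : TestField) (x : S2) : (x : E3) 0 * Φ.1 x 0 + (x : E3) 1 * Φ.1 x 1
    + (x : E3) 2 * Φ.1 x 2 = 0 := by
  have h := Φ.2.2 x
  rw [inner_eq_three] at h
  linarith

lemma tangent_deriv_homExt (Φ : TestField) {y : E3} (hy : y ≠ 0) (j : Fin 3) :
    y 0 * pd j (homExt (component 0 Φ).1) y + y 1 * pd j (homExt (component 1 Φ).1) y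
    + y 2 * pd j (homExt (component 2 Φ).1) y + homExt (component j Φ).1 y = 0 := by
  have hc := smoothOff_coord
  have hs := fun i => smoothOff_homExt (component i Φ)
  have h := pd_congr (G := fun _ => (0 : ℝ)) (fun y hy => tangent_homExt Φ hy) j hy
  rw [pd_const, pd_add (((hc 0).mul (hs 0)).add ((hc 1).mul (hs 1))) ((hc 2).mul (hs 2)) j hy,
    pd_add ((hc 0).mul (hs 0)) ((hc 1).mul (hs 1)) j hy, pd_mul (hc 0) (hs 0) j hy,
    pd_mul (hc 1) (hs 1) j hy, pd_mul (hc 2) (hs 2) j hy] at h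
  simp only [pd_coord] at h
  fin_cases j <;> simp at h ⊢ <;> linarith

lemma tangent_deriv (Φ : TestField) (x : S2) (j : Fin 3) :
    (x : E3) 0 * pd j (homExt (component 0 Φ).1) x + (x : E3) 1 * pd j (homExt (component 1 Φ).1) x
    + (x : E3) 2 * pd j (homExt (component 2 Φ).1) x + Φ.1 x j = 0 := by
  have h := tangent_deriv_homExt Φ (ne_zero_of_sphere x) j
  rwa [homExt_coe] at h

lemma divg_eq (Φ : TestField) : divg Φ = ∑ i, ang i (component i (rot Φ)) := by
  refine fun_ext fun x => ?_
  have hx := ne_zero_of_sphere x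
  have e := fun i => (rayConst_homExt (component i Φ).1).euler (smoothOff_homExt _) hx
  have t := tangent Φ x
  have hn := sum_sq_coord (x : E3)
  rw [norm_coe_sphere] at hn
  have t' := tangent_deriv Φ x
  rw [divg_apply]
  simp only [component_rot, ang_sub, ang_tmul, Fin.sum_univ_three]
  have i0 := ang_tcoord_one 0
  have i1 := ang_tcoord_one 1
  have i2 := ang_tcoord_one 2
  have j0 := ang_tcoord_two 0
  have j1 := ang_tcoord_two 1
  have j2 := ang_tcoord_two 2
  simp only [Fin.isValue, zero_add, Fin.reduceAdd] at i0 i1 i2 j0 j1 j2 ⊢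
  rw [i0, i1, i2, j0, j1, j2]
  change _ = ((x : E3) 1 * (ang 0 (component 2 Φ)).1 x + - (x : E3) 2 * Φ.1 x 2
    - ((x : E3) 2 * (ang 0 (component 1 Φ)).1 x + (x : E3) 1 * Φ.1 x 1))
    + ((x : E3) 2 * (ang 1 (component 0 Φ)).1 x + - (x : E3) 0 * Φ.1 x 0
    - ((x : E3) 0 * (ang 1 (component 2 Φ)).1 x + (x : E3) 2 * Φ.1 x 2))
    + ((x : E3) 0 * (ang 2 (component 1 Φ)).1 x + - (x : E3) 1 * Φ.1 x 1
    - ((x : E3) 1 * (ang 2 (component 0 Φ)).1 x + (x : E3) 0 * Φ.1 x 0))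
  simp only [ang_apply, angF, Fin.isValue, zero_add, Fin.reduceAdd]
  have a0 := t' 0
  have a1 := t' 1
  have a2 := t' 2
  have e0 := e 0
  have e1 := e 1
  have e2 := e 2
  generalize pd 0 (homExt (component 0 Φ).1) (x : E3) = p00 at *
  generalize pd 1 (homExt (component 0 Φ).1) (x : E3) = p10 at *
  generalize pd 2 (homExt (component 0 Φ).1) (x : E3) = p20 at *
  generalize pd 0 (homExt (component 1 Φ).1) (x : E3) = p01 at *
  generalize pd 1 (homExt (component 1 Φ).1) (x : E3) = p11 at *
  generalize pd 2 (homExt (component 1 Φ).1) (x : E3) = p21 at *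
  generalize pd 0 (homExt (component 2 Φ).1) (x : E3) = p02 at *
  generalize pd 1 (homExt (component 2 Φ).1) (x : E3) = p12 at *
  generalize pd 2 (homExt (component 2 Φ).1) (x : E3) = p22 at *
  generalize (x : E3) 0 = x0 at *
  generalize (x : E3) 1 = x1 at *
  generalize (x : E3) 2 = x2 at *
  linear_combination (-(p00 + p11 + p22)) * hn + x0 * a0 + x1 * a1 + x2 * a2 + t

lemma curl_eq (Φ : TestField) : curl Φ = ∑ i, ang i (component i Φ) := by
  rw [curl, divg_eq, rot_rot]
  simp only [map_neg, ang_neg, Finset.sum_neg_distrib, neg_neg]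

lemma component_perpGrad (i : Fin 3) (f : TestFun) : component i (perpGrad f) = ang i f := rfl

lemma lap_eq (f : TestFun) : lap f = ∑ i, ang i (ang i f) := by
  rw [lap, divg_eq]; rfl

lemma rot_add (Φ Ψ : TestField) : rot (Φ + Ψ) = rot Φ + rot Ψ := by
  refine field_ext fun i => fun_ext fun x => ?_
  change cross (x : E3) (Φ.1 x + Ψ.1 x) i = cross (x : E3) (Φ.1 x) i + cross (x : E3) (Ψ.1 x) i
  simp only [cross_apply', PiLp.add_apply]; ring

lemma rot_smul (c : ℝ) (Φ : TestField) : rot (c • Φ) = c • rot Φ := by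
  refine field_ext fun i => fun_ext fun x => ?_
  change cross (x : E3) (c • Φ.1 x) i = c * cross (x : E3) (Φ.1 x) i
  simp only [cross_apply', PiLp.smul_apply, smul_eq_mul]; ring

/-- The quarter turn as a linear map. -/
def rotL : TestField →ₗ[ℝ] TestField where
  toFun := rot
  map_add' := rot_add
  map_smul' := rot_smul

/-- The rotated gradient as a linear map. -/
def perpGradL : TestFun →ₗ[ℝ] TestField where
  toFun := perpGrad
  map_add' f g := field_ext fun i => ang_add i f g
  map_smul' c f := field_ext fun i => ang_smul i c f

lemma grad_eq (f : TestFun) : grad f = -rot (perpGrad f) := by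
  rw [perpGrad, rot_rot, neg_neg]

/-- The gradient as a linear map. -/
def gradL : TestFun →ₗ[ℝ] TestField where
  toFun := grad
  map_add' f g := by
    rw [grad_eq, grad_eq, grad_eq]
    exact (-(rotL ∘ₗ perpGradL)).map_add f g
  map_smul' c f := by
    rw [grad_eq, grad_eq]
    exact (-(rotL ∘ₗ perpGradL)).map_smul c f

/-- The curl as a linear map. -/
def curlL : TestField →ₗ[ℝ] TestFun where
  toFun := curl
  map_add' Φ Ψ := by
    simp only [curl_eq, map_add, ang_add, Finset.sum_add_distrib]
  map_smul' c Φ := by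
    simp only [curl_eq, map_smul, ang_smul, Finset.smul_sum, RingHom.id_apply]

lemma divg_eq_curl (Φ : TestField) : divg Φ = curl (rot Φ) := by
  rw [divg_eq, curl_eq]

/-- The divergence as a linear map. -/
def divgL : TestField →ₗ[ℝ] TestFun where
  toFun := divg
  map_add' Φ Ψ := by
    simp only [divg_eq_curl]
    exact (curlL ∘ₗ rotL).map_add Φ Ψ
  map_smul' c Φ := by
    simp only [divg_eq_curl]
    exact (curlL ∘ₗ rotL).map_smul c Φ

/-- The Laplacian on functions as a linear map. -/
def lapL : TestFun →ₗ[ℝ] TestFun where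
  toFun := lap
  map_add' := (divgL ∘ₗ gradL).map_add
  map_smul' := (divgL ∘ₗ gradL).map_smul

/-- The Laplacian on fields as a linear map. -/
def vlapL : TestField →ₗ[ℝ] TestField where
  toFun := vlap
  map_add' := (gradL ∘ₗ divgL + perpGradL ∘ₗ curlL).map_add
  map_smul' := (gradL ∘ₗ divgL + perpGradL ∘ₗ curlL).map_smul

lemma curl_perpGrad (f : TestFun) : curl (perpGrad f) = lap f := by
  rw [curl_eq, lap_eq]; rfl

lemma pd_homExt_ang (j k : Fin 3) (f : TestFun) (x : S2) :
    pd k (homExt (ang j f).1) x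
      = (x : E3) (j + 1) * pd k (pd (j + 2) (homExt f.1)) x
        + (if j + 1 = k then 1 else 0) * pd (j + 2) (homExt f.1) x
        - ((x : E3) (j + 2) * pd k (pd (j + 1) (homExt f.1)) x
        + (if j + 2 = k then 1 else 0) * pd (j + 1) (homExt f.1) x) := by
  have hx := ne_zero_of_sphere x
  have hs := smoothOff_homExt f
  have hc := smoothOff_coord
  rw [pd_congr (fun y hy => homExt_ang j f hy) k hx]
  unfold angF
  rw [pd_sub ((hc _).mul (hs.pd _)) ((hc _).mul (hs.pd _)) k hx, pd_mul (hc _) (hs.pd _) k hx,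
    pd_mul (hc _) (hs.pd _) k hx, pd_coord, pd_coord]

lemma ang_ang_apply (i j : Fin 3) (f : TestFun) (x : S2) :
    (ang i (ang j f)).1 x = (x : E3) (i + 1) * ((x : E3) (j + 1) * pd (i + 2) (pd (j + 2) (homExt f.1)) x
        + (if j + 1 = i + 2 then 1 else 0) * pd (j + 2) (homExt f.1) x
        - ((x : E3) (j + 2) * pd (i + 2) (pd (j + 1) (homExt f.1)) x
        + (if j + 2 = i + 2 then 1 else 0) * pd (j + 1) (homExt f.1) x))
      - (x : E3) (i + 2) * ((x : E3) (j + 1) * pd (i + 1) (pd (j + 2) (homExt f.1)) x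
        + (if j + 1 = i + 1 then 1 else 0) * pd (j + 2) (homExt f.1) x
        - ((x : E3) (j + 2) * pd (i + 1) (pd (j + 1) (homExt f.1)) x
        + (if j + 2 = i + 1 then 1 else 0) * pd (j + 1) (homExt f.1) x)) := by
  have hx := ne_zero_of_sphere x
  have hs := smoothOff_homExt f
  have hc := smoothOff_coord
  rw [ang_apply, angF, pd_homExt_ang, pd_homExt_ang]

lemma ang_comm (i : Fin 3) (f : TestFun) :
    ang i (ang (i + 1) f) = ang (i + 1) (ang i f) - ang (i + 2) f := by
  refine fun_ext fun x => ?_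
  have hx := ne_zero_of_sphere x
  have hs := smoothOff_homExt f
  change _ = (ang (i + 1) (ang i f)).1 x - (ang (i + 2) f).1 x
  rw [ang_ang_apply, ang_ang_apply, ang_apply, angF]
  have c01 := pd_comm hs 0 1 hx
  have c02 := pd_comm hs 0 2 hx
  have c12 := pd_comm hs 1 2 hx
  fin_cases i <;> simp [c01, c02, c12] <;> ring

lemma lap_ang (i : Fin 3) (f : TestFun) : lap (ang i f) = ang i (lap f) := by
  have c0 : ∀ f, ang 0 (ang 1 f) = ang 1 (ang 0 f) - ang 2 f := ang_comm 0
  have c1 : ∀ f, ang 1 (ang 2 f) = ang 2 (ang 1 f) - ang 0 f := ang_comm 1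
  have c2 : ∀ f, ang 2 (ang 0 f) = ang 0 (ang 2 f) - ang 1 f := ang_comm 2
  have c2' : ∀ f, ang 0 (ang 2 f) = ang 2 (ang 0 f) + ang 1 f := fun f => by rw [c2]; abel
  simp only [lap_eq, Fin.sum_univ_three]
  fin_cases i <;> simp [ang_add, ang_sub, c0, c1, c2'] <;> abel

lemma divg_perpGrad (f : TestFun) : divg (perpGrad f) = 0 := by
  refine fun_ext fun x => ?_
  have hx := ne_zero_of_sphere x
  have hs := smoothOff_homExt f
  have hc := smoothOff_coord
  rw [divg_apply, Fin.sum_univ_three]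
  simp only [component_perpGrad, pd_homExt_ang]
  have c01 := pd_comm hs 0 1 hx
  have c02 := pd_comm hs 0 2 hx
  have c12 := pd_comm hs 1 2 hx
  simp [c01, c02, c12]

lemma curl_grad (f : TestFun) : curl (grad f) = 0 := by
  change -divg (perpGrad f) = 0
  rw [divg_perpGrad, neg_zero]

lemma vlap_grad (f : TestFun) : vlap (grad f) = grad (lap f) := by
  change gradL (divg (grad f)) + perpGradL (curl (grad f)) = _
  rw [curl_grad, map_zero, add_zero]; rfl

lemma vlap_perpGrad (f : TestFun) : vlap (perpGrad f) = perpGrad (lap f) := by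
  change gradL (divg (perpGrad f)) + perpGradL (curl (perpGrad f)) = _
  rw [divg_perpGrad, map_zero, zero_add, curl_perpGrad]; rfl

/-! ### The Laplacian of the ambient space -/

/-- The Laplacian of the ambient space. -/
def lapF (F : E3 → ℝ) (y : E3) : ℝ := ∑ i, pd i (pd i F) y

lemma homExt_divg (Φ : TestField) {y : E3} (hy : y ≠ 0) :
    homExt (divg Φ).1 y = ‖y‖ * ∑ i, pd i (homExt (component i Φ).1) y := by
  have hn := norm_pos_iff.2 hy
  rw [homExt_of_ne _ hy, divg_apply, Finset.mul_sum]
  refine Finset.sum_congr rfl fun i _ => ?_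
  have := (rayConst_homExt (component i Φ).1).pd_smul (smoothOff_homExt _) i
    (inv_pos.2 hn) hy
  rw [inv_inv] at this
  exact this

lemma homExt_component_grad (f : TestFun) (i : Fin 3) {y : E3} (hy : y ≠ 0) :
    homExt (component i (grad f)).1 y = ‖y‖ * pd i (homExt f.1) y := by
  have hn := norm_pos_iff.2 hy
  rw [homExt_of_ne _ hy, component_apply, grad_apply]
  have := (rayConst_homExt f.1).pd_smul (smoothOff_homExt _) i (inv_pos.2 hn) hy
  rw [inv_inv] at this
  exact this

lemma homExt_lap (f : TestFun) {y : E3} (hy : y ≠ 0) :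
    homExt (lap f).1 y = ‖y‖ ^ 2 * lapF (homExt f.1) y := by
  have hn := norm_ne_zero_iff.2 hy
  have hs := smoothOff_homExt f
  have he := (rayConst_homExt f.1).euler hs hy
  rw [lap, homExt_divg _ hy, lapF]
  have h : ∀ i, pd i (homExt (component i (grad f)).1) y
      = ‖y‖ * pd i (pd i (homExt f.1)) y + y i * ‖y‖⁻¹ * pd i (homExt f.1) y := fun i => by
    rw [pd_congr (fun y hy => homExt_component_grad f i hy) i hy,
      pd_mul smoothOff_norm (hs.pd i) i hy, pd_norm i hy]
  simp only [h, Fin.sum_univ_three]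
  field_simp
  linear_combination he

lemma lapF_zpow_norm_mul (k : ℤ) (f : TestFun) {y : E3} (hy : y ≠ 0) :
    lapF (fun y => ‖y‖ ^ k * homExt f.1 y) y
      = ‖y‖ ^ (k - 2) * (homExt (lap f).1 y + k * (k + 1) * homExt f.1 y) := by
  have hn := norm_ne_zero_iff.2 hy
  have hs := smoothOff_homExt f
  have he := (rayConst_homExt f.1).euler hs hy
  have hz := smoothOff_zpow_norm
  have hc := smoothOff_coord
  have hk : ∀ k : ℤ, SmoothOff (fun y : E3 => (k : ℝ) * ‖y‖ ^ (k - 2)) := fun k =>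
    contDiffOn_const.mul (hz _)
  have hkp : ∀ (k : ℤ) (i : Fin 3), pd i (fun y : E3 => (k : ℝ) * ‖y‖ ^ (k - 2)) y
      = k * ((k - 2) * ‖y‖ ^ (k - 4) * y i) := fun k i => by
    rw [pd_mul (contDiffOn_const (c := (k : ℝ))) (hz _) i hy, pd_const, pd_zpow_norm _ i hy,
      show k - 2 - 2 = k - 4 by ring]
    push_cast; ring
  have h : ∀ i, pd i (pd i (fun y => ‖y‖ ^ k * homExt f.1 y)) y
      = (k * ((k - 2) * ‖y‖ ^ (k - 4) * y i)) * y i * homExt f.1 y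
        + k * ‖y‖ ^ (k - 2) * homExt f.1 y
        + 2 * (k * ‖y‖ ^ (k - 2) * y i * pd i (homExt f.1) y)
        + ‖y‖ ^ k * pd i (pd i (homExt f.1)) y := fun i => by
    rw [pd_congr (G := fun y => ‖y‖ ^ k * pd i (homExt f.1) y
        + ((k : ℝ) * ‖y‖ ^ (k - 2)) * y i * homExt f.1 y) (fun y hy => by
          rw [pd_mul (hz k) hs i hy, pd_zpow_norm k i hy]) i hy,
      pd_add ((hz k).mul (hs.pd i)) (((hk k).mul (hc i)).mul hs) i hy,
      pd_mul (hz k) (hs.pd i) i hy, pd_mul ((hk k).mul (hc i)) hs i hy,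
      pd_mul (hk k) (hc i) i hy, hkp, pd_zpow_norm k i hy, pd_coord]
    simp; ring
  have hy2 := sum_sq_coord y
  have e1 : ‖y‖ ^ (k - 2) = ‖y‖ ^ (k - 4) * ‖y‖ ^ 2 := by
    rw [← zpow_natCast, ← zpow_add₀ hn]; congr 1; push_cast; ring
  have e2 : ‖y‖ ^ k = ‖y‖ ^ (k - 4) * ‖y‖ ^ 2 * ‖y‖ ^ 2 := by
    rw [← e1, ← zpow_natCast, ← zpow_add₀ hn]; congr 1; push_cast; ring
  rw [homExt_lap f hy]
  simp only [lapF, h, Fin.sum_univ_three, e1, e2]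
  linear_combination 2 * (k : ℝ) * ‖y‖ ^ (k - 4) * ‖y‖ ^ 2 * he
    + (k : ℝ) * (k - 2) * ‖y‖ ^ (k - 4) * homExt f.1 y * hy2

/-! ### Integration in polar coordinates and integration by parts -/

lemma finrank_E3 : Module.finrank ℝ E3 = 3 := by simp

instance : surf.IsOpenPosMeasure := by unfold surf; infer_instance

lemma integral_polar (h : ℝ → ℝ) (f : S2 → ℝ) :
    ∫ y : E3, h ‖y‖ * homExt f y = (∫ x, f x ∂surf) * ∫ r in Set.Ioi (0 : ℝ), r ^ 2 * h r := by
  calc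
    ∫ y : E3, h ‖y‖ * homExt f y
      = ∫ y : ({(0)}ᶜ : Set E3), h ‖y.1‖ * homExt f y.1 ∂((volume : Measure E3).comap (↑)) := by
      rw [integral_subtype_comap (measurableSet_singleton _).compl
        fun y : E3 => h ‖y‖ * homExt f y, restrict_compl_singleton]
    _ = ∫ z : S2 × Set.Ioi (0 : ℝ), f z.1 * h z.2
        ∂(volume : Measure E3).toSphere.prod (.volumeIoiPow (Module.finrank ℝ E3 - 1)) := by
      rw [← (volume : Measure E3).measurePreserving_homeomorphUnitSphereProd.integral_comp
        (Homeomorph.measurableEmbedding _)]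
      congr 1; funext y
      rw [homExt_of_ne f y.2, mul_comm, homeomorphUnitSphereProd_apply_snd_coe]
      congr 2
      apply Subtype.ext
      rw [homeomorphUnitSphereProd_apply_fst_coe]; rfl
    _ = (∫ x, f x ∂surf) * ∫ r : Set.Ioi (0 : ℝ), h r
          ∂.volumeIoiPow (Module.finrank ℝ E3 - 1) :=
      integral_prod_mul f fun r : Set.Ioi (0 : ℝ) => h r
    _ = _ := by
      congr 1
      rw [finrank_E3]
      simp only [Measure.volumeIoiPow, ENNReal.ofReal]
      rw [integral_withDensity_eq_integral_smul,
        integral_subtype_comap measurableSet_Ioi fun a => Real.toNNReal (a ^ (3 - 1)) • h a,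
        setIntegral_congr_fun measurableSet_Ioi fun x hx => ?_]
      · rw [NNReal.smul_def, Real.coe_toNNReal _ (pow_nonneg (le_of_lt hx) _)]; rfl
      · exact (measurable_subtype_coe.pow_const _).real_toNNReal

lemma integrable_mul_of_tsupport {F g : E3 → ℝ} (hF : ContinuousOn F {0}ᶜ) (hg : Continuous g)
    (hc : HasCompactSupport g) (h0 : (0 : E3) ∉ tsupport g) :
    Integrable (fun y => F y * g y) := by
  have hsub : tsupport g ⊆ {0}ᶜ := fun y hy h => h0 (by rwa [← Set.mem_singleton_iff.1 h])
  have h1 : IntegrableOn (fun y => F y * g y) (tsupport g) :=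
    ((hF.mono hsub).mul hg.continuousOn).integrableOn_compact hc
  refine (integrableOn_iff_integrable_of_support_subset ?_).1 h1
  intro y hy
  refine subset_tsupport g fun h => hy ?_
  simp [h]

lemma integral_pd_mul {F g : E3 → ℝ} (hF : SmoothOff F) (hg : ContDiff ℝ 1 g)
    (hc : HasCompactSupport g) (h0 : (0 : E3) ∉ tsupport g) (i : Fin 3) :
    ∫ y, pd i F y * g y = - ∫ y, F y * pd i g y := by
  have hg' : Continuous (pd i g) := (hg.continuous_fderiv (by simp)).clm_apply continuous_const
  have hc' : HasCompactSupport (pd i g) := by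
    refine (hc.fderiv (𝕜 := ℝ)).comp_left (g := fun T : E3 →L[ℝ] ℝ =>
      T (EuclideanSpace.single i (1 : ℝ))) (by simp)
  have hsub : tsupport (pd i g) ⊆ tsupport g := by
    refine (closure_mono ?_).trans (tsupport_fderiv_subset ℝ (f := g))
    intro y hy h
    exact hy (by simp [pd, h])
  have h := integral_mul_fderiv_eq_neg_fderiv_mul_of_integrable (μ := (volume : Measure E3))
    (f := F) (g := g) (v := EuclideanSpace.single i (1 : ℝ))
    (integrable_mul_of_tsupport (hF.pd i).continuousOn hg.continuous hc h0)
    (integrable_mul_of_tsupport hF.continuousOn hg' hc' fun h => h0 (hsub h))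
    (integrable_mul_of_tsupport hF.continuousOn hg.continuous hc h0)
    (fun x hx => hF.differentiableAt fun h => h0 (h ▸ hx))
    (fun x _ => (hg.differentiable (by simp)) x)
  change _ = - ∫ y, F y * fderiv ℝ g y _
  rw [h, neg_neg]; rfl

/-- A radial cutoff function supported near the unit sphere. -/
def radialCut : ContDiffBump (2 : ℝ) := ⟨1 / 4, 1 / 2, by norm_num, by norm_num⟩

lemma tsupport_radialCut :
    tsupport (fun y : E3 => radialCut (‖y‖ ^ 2)) ⊆ {y | 3 / 2 ≤ ‖y‖ ^ 2 ∧ ‖y‖ ^ 2 ≤ 5 / 2} := by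
  have hn : Continuous fun y : E3 => ‖y‖ ^ 2 := by fun_prop
  have hcl : IsClosed {y : E3 | 3 / 2 ≤ ‖y‖ ^ 2 ∧ ‖y‖ ^ 2 ≤ 5 / 2} :=
    (isClosed_le continuous_const hn).inter (isClosed_le hn continuous_const)
  refine closure_minimal ?_ hcl
  intro y hy
  have h : ‖y‖ ^ 2 ∈ Function.support radialCut := hy
  rw [ContDiffBump.support_eq, Metric.mem_ball, Real.dist_eq, abs_lt] at h
  change -(1 / 2) < _ ∧ _ < 1 / 2 at h
  constructor <;> linarith [h.1, h.2]

lemma contDiff_radialCut : ContDiff ℝ 1 (fun y : E3 => radialCut (‖y‖ ^ 2)) :=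
  (ContDiffBump.contDiff (f := radialCut) (n := 1)).comp (contDiff_norm_sq ℝ)

lemma pd_radialCut (i : Fin 3) (y : E3) :
    pd i (fun y : E3 => radialCut (‖y‖ ^ 2)) y = 2 * deriv radialCut (‖y‖ ^ 2) * y i := by
  have h1 : HasFDerivAt (fun y : E3 => ‖y‖ ^ 2) (2 • innerSL ℝ y) y :=
    (hasStrictFDerivAt_norm_sq y).hasFDerivAt
  have h2 : HasDerivAt radialCut (deriv radialCut (‖y‖ ^ 2)) (‖y‖ ^ 2) :=
    (((ContDiffBump.contDiff (f := radialCut) (n := 1)).differentiable (by simp)) _).hasDerivAt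
  have h3 := h2.comp_hasFDerivAt y h1
  unfold pd
  rw [show (fun y : E3 => radialCut (‖y‖ ^ 2)) = radialCut ∘ fun y : E3 => ‖y‖ ^ 2 from rfl,
    h3.fderiv]
  simp [EuclideanSpace.inner_single_right]
  ring

lemma integral_ang (i : Fin 3) (f : TestFun) : ∫ x, (ang i f).1 x ∂surf = 0 := by
  have hcd := contDiff_radialCut
  have hcoord : ∀ j : Fin 3, ContDiff ℝ 1 (fun y : E3 => y j) := fun j =>
    (EuclideanSpace.proj (𝕜 := ℝ) j).contDiff
  have hcs : HasCompactSupport (fun y : E3 => radialCut (‖y‖ ^ 2)) := by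
    refine (isCompact_closedBall (0 : E3) 2).of_isClosed_subset (isClosed_tsupport _)
      (tsupport_radialCut.trans ?_)
    rintro y ⟨_, h⟩
    rw [mem_closedBall_zero_iff]
    nlinarith [norm_nonneg y]
  have h0 : (0 : E3) ∉ tsupport (fun y : E3 => radialCut (‖y‖ ^ 2)) := fun h => by
    have := (tsupport_radialCut h).1
    norm_num at this
  have hF := smoothOff_homExt f
  have key : ∀ a b : Fin 3, a ≠ b →
      Integrable (fun y : E3 => pd b (homExt f.1) y * (y a * radialCut (‖y‖ ^ 2))) ∧
      ∫ y : E3, pd b (homExt f.1) y * (y a * radialCut (‖y‖ ^ 2))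
        = - ∫ y : E3, homExt f.1 y * (y a * (2 * deriv radialCut (‖y‖ ^ 2) * y b)) := by
    intro a b hab
    have hg : ContDiff ℝ 1 (fun y : E3 => y a * radialCut (‖y‖ ^ 2)) := (hcoord a).mul hcd
    have hgc : HasCompactSupport (fun y : E3 => y a * radialCut (‖y‖ ^ 2)) := hcs.mul_left
    have hg0 : (0 : E3) ∉ tsupport (fun y : E3 => y a * radialCut (‖y‖ ^ 2)) := fun h =>
      h0 ((tsupport_mul_subset_right (f := fun y : E3 => y a)) h)
    refine ⟨integrable_mul_of_tsupport (hF.pd b).continuousOn hg.continuous hgc hg0, ?_⟩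
    rw [integral_pd_mul hF hg hgc hg0 b]
    congr 2; funext y
    have hm := fderiv_mul ((hcoord a).differentiable (by simp) y)
      (hcd.differentiable (by simp) y)
    have : pd b (fun y : E3 => y a * radialCut (‖y‖ ^ 2)) y
        = y a * pd b (fun y : E3 => radialCut (‖y‖ ^ 2)) y
          + pd b (fun y : E3 => y a) y * radialCut (‖y‖ ^ 2) := by
      unfold pd
      rw [show (fun y : E3 => y a * radialCut (‖y‖ ^ 2))
        = (fun y : E3 => y a) * (fun y : E3 => radialCut (‖y‖ ^ 2)) from rfl, hm]
      simp [mul_comm]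
    rw [this, pd_radialCut, pd_coord, if_neg hab]
    ring
  have hne : i + 1 ≠ i + 2 := by fin_cases i <;> decide
  obtain ⟨I1, K1⟩ := key _ _ hne
  obtain ⟨I2, K2⟩ := key _ _ hne.symm
  have hz : ∫ y : E3, radialCut (‖y‖ ^ 2) * homExt (ang i f).1 y = 0 := by
    have : ∀ y : E3, radialCut (‖y‖ ^ 2) * homExt (ang i f).1 y
        = pd (i + 2) (homExt f.1) y * (y (i + 1) * radialCut (‖y‖ ^ 2))
          - pd (i + 1) (homExt f.1) y * (y (i + 2) * radialCut (‖y‖ ^ 2)) := fun y => by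
      by_cases hy : y = 0
      · subst hy
        simp [homExt]
      · rw [homExt_ang i f hy, angF]; ring
    simp only [this]
    rw [integral_sub I1 I2, K1, K2, sub_eq_zero]
    congr 2; funext y; ring
  rw [integral_polar (fun r => radialCut (r ^ 2)) (ang i f).1] at hz
  refine (mul_eq_zero.1 hz).resolve_right (ne_of_gt ?_)
  have hcont : Continuous (fun r : ℝ => r ^ 2 * radialCut (r ^ 2)) :=
    (continuous_pow 2).mul (radialCut.continuous.comp (continuous_pow 2))
  rw [setIntegral_pos_iff_support_of_nonneg_ae]
  · have hop : IsOpen (Function.support (fun r : ℝ => r ^ 2 * radialCut (r ^ 2)) ∩ Set.Ioi 0) :=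
      (hcont.isOpen_support).inter isOpen_Ioi
    refine hop.measure_pos _ ⟨Real.sqrt 2, ?_, Real.sqrt_pos.2 (by norm_num)⟩
    have h2 : Real.sqrt 2 ^ 2 = 2 := Real.sq_sqrt (by norm_num)
    simp only [Function.mem_support, h2]
    have : radialCut 2 = 1 := radialCut.one_of_mem_closedBall
      (Metric.mem_closedBall_self radialCut.rIn_pos.le)
    simp [this]
  · exact Eventually.of_forall fun r => mul_nonneg (sq_nonneg r) radialCut.nonneg
  · refine (hcont.integrable_of_hasCompactSupport ?_).integrableOn
    refine (isCompact_closedBall (0 : ℝ) 2).of_isClosed_subset (isClosed_tsupport _) ?_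
    refine closure_minimal ?_ Metric.isClosed_closedBall
    intro r hr
    have h : r ^ 2 ∈ Function.support radialCut := fun h => hr (by simp [h])
    rw [ContDiffBump.support_eq, Metric.mem_ball, Real.dist_eq, abs_lt] at h
    change -(1 / 2) < _ ∧ _ < 1 / 2 at h
    rw [mem_closedBall_zero_iff, Real.norm_eq_abs, abs_le]
    constructor <;> nlinarith [h.2]

/-! ### The `L²` inner products as bilinear forms -/

lemma integrable_continuous {f : S2 → ℝ} (hf : Continuous f) : Integrable f surf :=
  hf.integrable_of_hasCompactSupport (HasCompactSupport.of_compactSpace _)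

lemma continuous_testFun (f : TestFun) : Continuous f.1 := IsSmooth.continuous f.2

lemma integrable_tmul (f g : TestFun) : Integrable (fun x => f.1 x * g.1 x) surf :=
  integrable_continuous ((continuous_testFun f).mul (continuous_testFun g))

/-- The `L²` inner product of functions as a bilinear form. -/
def l2B : TestFun →ₗ[ℝ] TestFun →ₗ[ℝ] ℝ :=
  LinearMap.mk₂ ℝ l2
    (fun f g h => by
      simp only [l2]
      rw [← integral_add (integrable_tmul f h) (integrable_tmul g h)]
      congr 1; funext x; exact add_mul _ _ _)
    (fun c f g => by
      simp only [l2, smul_eq_mul]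
      rw [← integral_const_mul]
      congr 1; funext x; exact mul_assoc _ _ _)
    (fun f g h => by
      simp only [l2]
      rw [← integral_add (integrable_tmul f g) (integrable_tmul f h)]
      congr 1; funext x; exact mul_add _ _ _)
    (fun c f g => by
      simp only [l2, smul_eq_mul]
      rw [← integral_const_mul]
      congr 1; funext x; exact mul_left_comm _ _ _)

lemma l2_comm (f g : TestFun) : l2 f g = l2 g f := by
  simp only [l2, mul_comm]

lemma vl2_comm (Φ Ψ : TestField) : vl2 Φ Ψ = vl2 Ψ Φ := by
  simp only [vl2, real_inner_comm]

/-- The `L²` inner product of fields as a bilinear form. -/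
def vl2B : TestField →ₗ[ℝ] TestField →ₗ[ℝ] ℝ :=
  LinearMap.mk₂ ℝ vl2
    (fun Φ Ψ X => by
      rw [vl2_comm, vl2_comm Φ, vl2_comm Ψ]; exact (toFunctional X).map_add Φ Ψ)
    (fun c Φ X => by
      rw [vl2_comm, vl2_comm Φ]; exact (toFunctional X).map_smul c Φ)
    (fun X Φ Ψ => (toFunctional X).map_add Φ Ψ)
    (fun c X Φ => (toFunctional X).map_smul c Φ)

lemma vl2_eq (Φ Ψ : TestField) : vl2 Φ Ψ = ∑ i, l2 (component i Φ) (component i Ψ) := by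
  simp only [vl2, l2]
  rw [← integral_finsetSum _ fun i _ => integrable_tmul _ _]
  congr 1; funext x
  rw [inner_eq_three, Fin.sum_univ_three]; rfl

lemma l2_self_nonneg (f : TestFun) : 0 ≤ l2 f f :=
  integral_nonneg fun x => mul_self_nonneg (f.1 x)

lemma l2_self_eq_zero {f : TestFun} (h : l2 f f = 0) : f = 0 := by
  have h1 := (integral_eq_zero_iff_of_nonneg (μ := surf) (f := fun x => f.1 x * f.1 x)
    (fun x => mul_self_nonneg (f.1 x)) (integrable_tmul f f)).1 h
  have h2 := (((continuous_testFun f).mul (continuous_testFun f)).ae_eq_iff_eq surf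
    continuous_const).1 h1
  exact fun_ext fun x => mul_self_eq_zero.1 (congrFun h2 x)

lemma vl2_self_eq_zero {Φ : TestField} (h : vl2 Φ Φ = 0) : Φ = 0 := by
  rw [vl2_eq, Finset.sum_eq_zero_iff_of_nonneg fun i _ => l2_self_nonneg _] at h
  exact field_ext fun i => by rw [l2_self_eq_zero (h i (Finset.mem_univ i)), map_zero]

/-! ### Integration by parts on the sphere -/

lemma l2_ang (i : Fin 3) (f g : TestFun) : l2 (ang i f) g = - l2 f (ang i g) := by
  have h := integral_ang i (tmul f g)
  rw [ang_tmul] at h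
  have h2 : ∫ x, (tmul f (ang i g) + tmul (ang i f) g).1 x ∂surf
      = l2 f (ang i g) + l2 (ang i f) g :=
    integral_add (integrable_tmul f (ang i g)) (integrable_tmul (ang i f) g)
  linarith

lemma vl2_perpGrad (f : TestFun) (Φ : TestField) : vl2 (perpGrad f) Φ = - l2 f (curl Φ) := by
  have h : l2 f (curl Φ) = ∑ i, l2 f (ang i (component i Φ)) := by
    rw [curl_eq]; exact map_sum (l2B f) _ _
  rw [vl2_eq, h, ← Finset.sum_neg_distrib]
  exact Finset.sum_congr rfl fun i _ => l2_ang i _ _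

lemma vl2_rot (Φ Ψ : TestField) : vl2 (rot Φ) Ψ = - vl2 Φ (rot Ψ) := by
  simp only [vl2, ← integral_neg]
  congr 1; funext x
  rw [inner_eq_three, inner_eq_three]
  change cross (x : E3) (Φ.1 x) 0 * _ + cross (x : E3) (Φ.1 x) 1 * _
    + cross (x : E3) (Φ.1 x) 2 * _ = -(_ * cross (x : E3) (Ψ.1 x) 0
    + _ * cross (x : E3) (Ψ.1 x) 1 + _ * cross (x : E3) (Ψ.1 x) 2)
  simp only [cross_apply', Fin.isValue, Fin.reduceAdd]
  ring

lemma vl2_grad (f : TestFun) (Φ : TestField) : vl2 (grad f) Φ = - l2 f (divg Φ) := by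
  have h : vl2 (grad f) Φ = - vl2 (rot (perpGrad f)) Φ := by
    rw [grad_eq]
    have := (vl2B).map_neg (rot (perpGrad f))
    exact congrArg (fun T : TestField →ₗ[ℝ] ℝ => T Φ) this
  rw [h, vl2_rot, neg_neg, vl2_perpGrad, divg_eq_curl]

lemma l2_lap (f g : TestFun) : l2 (lap f) g = - vl2 (grad f) (grad g) := by
  rw [vl2_comm, vl2_grad, neg_neg, l2_comm]; rfl

lemma l2_lap_comm (f g : TestFun) : l2 (lap f) g = l2 f (lap g) := by
  rw [l2_lap, vl2_comm, ← l2_lap, l2_comm]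

lemma vl2_perpGrad_perpGrad (f g : TestFun) :
    vl2 (perpGrad f) (perpGrad g) = - l2 f (lap g) := by
  rw [vl2_perpGrad, curl_perpGrad]

lemma vl2_grad_grad (f g : TestFun) : vl2 (grad f) (grad g) = - l2 f (lap g) := by
  rw [vl2_grad]; rfl

lemma vl2_vlap (Φ Ψ : TestField) :
    vl2 (vlap Φ) Ψ = - l2 (divg Φ) (divg Ψ) - l2 (curl Φ) (curl Ψ) := by
  have h : vl2 (vlap Φ) Ψ = vl2 (grad (divg Φ)) Ψ + vl2 (perpGrad (curl Φ)) Ψ :=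
    LinearMap.map_add₂ vl2B _ _ _
  rw [h, vl2_grad, vl2_perpGrad]; ring

lemma vl2_vlap_comm (Φ Ψ : TestField) : vl2 (vlap Φ) Ψ = vl2 Φ (vlap Ψ) := by
  rw [vl2_vlap, vl2_comm Φ, vl2_vlap, l2_comm, l2_comm (curl Φ)]

lemma grad_eq_zero_of_lap_eq_zero {f : TestFun} (h : lap f = 0) : grad f = 0 := by
  apply vl2_self_eq_zero
  rw [vl2_grad_grad, h]
  simp [(l2B f).map_zero, show l2 f 0 = l2B f 0 from rfl]

lemma eq_tconst_of_grad_eq_zero {f : TestFun} (h : grad f = 0) : ∃ c, f = tconst c := by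
  have hpd : ∀ (i : Fin 3) (y : E3), y ≠ 0 → pd i (homExt f.1) y = 0 := fun i y hy => by
    have h1 := homExt_component_grad f i hy
    rw [h] at h1
    have h2 : homExt (component i (0 : TestField)).1 y = 0 := by
      rw [map_zero]; simp [homExt]
    rw [h2] at h1
    exact (mul_eq_zero.1 h1.symm).resolve_left (norm_ne_zero_iff.2 hy)
  have hconn : IsPreconnected ({0}ᶜ : Set E3) := by
    refine (isConnected_compl_singleton_of_one_lt_rank ?_ 0).isPreconnected
    rw [← Module.finrank_eq_rank, finrank_E3]; norm_num
  have hd : DifferentiableOn ℝ (homExt f.1) {0}ᶜ := (smoothOff_homExt f).differentiableOn (by simp)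
  obtain ⟨c, hc⟩ := isOpen_punctured.exists_is_const_of_fderiv_eq_zero hconn hd (fun y hy => by
    ext v
    rw [fderiv_eq_sum_pd]
    simp [hpd _ y hy])
  exact ⟨c, fun_ext fun x => by rw [← homExt_coe f.1 x, hc _ (ne_zero_of_sphere x)]; rfl⟩

/-! ### There are no harmonic fields -/

lemma homExt_zero_testFun (y : E3) : homExt (0 : TestFun).1 y = 0 := by simp [homExt]

lemma lap_component_eq_zero {Φ : TestField} (hd : divg Φ = 0) (hr : curl Φ = 0) (i : Fin 3) :
    lap (component i Φ) = 0 := by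
  have hs := fun i => smoothOff_homExt (component i Φ)
  set H : Fin 3 → E3 → ℝ := fun i y => ‖y‖ ^ (-1 : ℤ) * homExt (component i Φ).1 y with hH
  have hz := smoothOff_zpow_norm (-1)
  have hHs : ∀ i, SmoothOff (H i) := fun i => hz.mul (hs i)
  have hpH : ∀ i j y, y ≠ 0 → pd j (H i) y = ‖y‖ ^ (-3 : ℤ)
      * (‖y‖ ^ 2 * pd j (homExt (component i Φ).1) y - y j * homExt (component i Φ).1 y) := by
    intro i j y hy
    have hn := norm_ne_zero_iff.2 hy
    rw [pd_mul hz (hs i) j hy, pd_zpow_norm _ j hy]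
    have e : ‖y‖ ^ (-1 : ℤ) = ‖y‖ ^ (-3 : ℤ) * ‖y‖ ^ 2 := by
      rw [← zpow_natCast, ← zpow_add₀ hn]; norm_num
    rw [e]; push_cast; norm_num; ring
  have hdiv : ∀ y, y ≠ 0 → pd 0 (H 0) y + pd 1 (H 1) y + pd 2 (H 2) y = 0 := by
    intro y hy
    have hn := norm_ne_zero_iff.2 hy
    have h1 := homExt_divg Φ hy
    rw [hd, homExt_zero_testFun, Fin.sum_univ_three] at h1
    have h2 := (mul_eq_zero.1 h1.symm).resolve_left hn
    rw [hpH _ _ y hy, hpH _ _ y hy, hpH _ _ y hy]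
    linear_combination ‖y‖ ^ (-3 : ℤ) * (‖y‖ ^ 2 * h2 - tangent_homExt Φ hy)
  have hcurl : ∀ i j y, y ≠ 0 → pd j (H i) y = pd i (H j) y := by
    intro i j y hy
    have e := fun i => (rayConst_homExt (component i Φ).1).euler (hs i) hy
    have t := tangent_deriv_homExt Φ hy
    have hn := sum_sq_coord y
    have hK : angF 0 (homExt (component 0 Φ).1) y + angF 1 (homExt (component 1 Φ).1) y
        + angF 2 (homExt (component 2 Φ).1) y = 0 := by
      rw [← homExt_ang _ _ hy, ← homExt_ang _ _ hy, ← homExt_ang _ _ hy]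
      have h1 := curl_eq Φ
      rw [hr, Fin.sum_univ_three] at h1
      have h2 : homExt (ang 0 (component 0 Φ) + ang 1 (component 1 Φ)
        + ang 2 (component 2 Φ)).1 y = 0 := by rw [← h1, homExt_zero_testFun]
      rw [homExt_of_ne _ hy] at h2 ⊢
      rw [homExt_of_ne _ hy, homExt_of_ne _ hy]
      exact h2
    simp only [angF, Fin.isValue, zero_add, Fin.reduceAdd] at hK
    have main : ∀ i j : Fin 3, j = i + 1 → pd j (H i) y = pd i (H j) y := by
      rintro i j rfl
      rw [hpH _ _ y hy, hpH _ _ y hy]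
      congr 1
      rw [← hn]
      fin_cases i
      · simp only [Fin.zero_eta, Fin.isValue, zero_add]
        linear_combination (-y 2) * hK - y 0 * e 1 + y 1 * e 0 - y 1 * t 0 + y 0 * t 1
      · simp only [Fin.mk_one, Fin.isValue, Fin.reduceAdd]
        linear_combination (-y 0) * hK - y 1 * e 2 + y 2 * e 1 - y 2 * t 1 + y 1 * t 2
      · simp only [Fin.reduceFinMk, Fin.isValue, Fin.reduceAdd]
        linear_combination (-y 1) * hK - y 2 * e 0 + y 0 * e 2 - y 0 * t 2 + y 2 * t 0
    by_cases hij : i = j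
    · rw [hij]
    · by_cases h1 : j = i + 1
      · exact main i j h1
      · have h2 : i = j + 1 := by
          revert hij h1; revert i j; decide
        exact (main j i h2).symm
  refine fun_ext fun x => ?_
  have hx := ne_zero_of_sphere x
  have h1 := lapF_zpow_norm_mul (-1) (component i Φ) hx
  have h2 : lapF (H i) x = 0 := by
    have h3 : ∀ j, pd j (pd j (H i)) x = pd i (pd j (H j)) x := fun j => by
      rw [pd_congr (hcurl i j) j hx, pd_comm (hHs j) j i hx]
    rw [lapF, Fin.sum_univ_three, h3, h3, h3,
      ← pd_add ((hHs 0).pd 0) ((hHs 1).pd 1) i hx,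
      ← pd_add (((hHs 0).pd 0).add ((hHs 1).pd 1)) ((hHs 2).pd 2) i hx,
      pd_congr (G := fun _ => 0) hdiv i hx, pd_const]
  rw [h2, norm_coe_sphere, homExt_coe] at h1
  simpa using h1.symm

lemma eq_zero_of_divg_curl {Φ : TestField} (hd : divg Φ = 0) (hr : curl Φ = 0) : Φ = 0 := by
  have hg : ∀ i, grad (component i Φ) = 0 := fun i =>
    grad_eq_zero_of_lap_eq_zero (lap_component_eq_zero hd hr i)
  refine field_ext fun j => fun_ext fun x => ?_
  have h := tangent_deriv Φ x j
  simp only [← grad_apply, hg] at h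
  rw [map_zero, component_apply]
  simpa using h

/-! ### Spherical harmonics and polynomials -/

/-- The operator `Δ + ℓ (ℓ + 1)`. -/
def shiftLap (l : ℕ) : TestFun →ₗ[ℝ] TestFun :=
  lapL + ((l : ℝ) * (l + 1)) • (LinearMap.id : TestFun →ₗ[ℝ] TestFun)

lemma shiftLap_apply (l : ℕ) (f : TestFun) :
    shiftLap l f = lap f + ((l : ℝ) * (l + 1)) • f := rfl

/-- The eigenspace of the Laplacian with eigenvalue `-ℓ (ℓ + 1)`. -/
def harm (l : ℕ) : Submodule ℝ TestFun := LinearMap.ker (shiftLap l)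

lemma mem_harm {l : ℕ} {f : TestFun} : f ∈ harm l ↔ lap f = -((l : ℝ) * (l + 1)) • f := by
  have h : -((l : ℝ) * (l + 1)) • f = -(((l : ℝ) * (l + 1)) • f) := by module
  rw [harm, LinearMap.mem_ker, shiftLap_apply, h, ← add_eq_zero_iff_eq_neg]

lemma ang_mem_harm {l : ℕ} {f : TestFun} (hf : f ∈ harm l) (i : Fin 3) : ang i f ∈ harm l := by
  rw [mem_harm] at hf ⊢
  rw [lap_ang, hf, ang_smul]

lemma l2_eq_zero_of_harm {l m : ℕ} (hlm : l ≠ m) {f g : TestFun} (hf : f ∈ harm l)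
    (hg : g ∈ harm m) : l2 f g = 0 := by
  have h := l2_lap_comm f g
  rw [mem_harm] at hf hg
  have h1 : l2 (lap f) g = -((l : ℝ) * (l + 1)) * l2 f g := by
    rw [hf]; exact LinearMap.map_smul₂ l2B _ _ _
  have h2 : l2 f (lap g) = -((m : ℝ) * (m + 1)) * l2 f g := by
    rw [hg]; exact (l2B f).map_smul _ _
  rw [h1, h2] at h
  have h3 : ((l : ℝ) - m) * ((l + m + 1) * l2 f g) = 0 := by linear_combination -h
  have h4 : (l : ℝ) - m ≠ 0 := sub_ne_zero.2 (Nat.cast_injective.ne hlm)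
  have h5 : (l : ℝ) + m + 1 ≠ 0 := by positivity
  exact (mul_eq_zero.1 ((mul_eq_zero.1 h3).resolve_left h4)).resolve_left h5

lemma ang_tcoord_apply (i j : Fin 3) (x : S2) : (ang i (tcoord j)).1 x
    = (x : E3) (i + 1) * (if j = i + 2 then 1 else 0)
      - (x : E3) (i + 2) * (if j = i + 1 then 1 else 0) := by
  rw [ang_apply, angF, pd_tcoord, pd_tcoord]; ring

/-- The pointwise inner product of the gradients. -/
def gradDot (f g : TestFun) : TestFun := ∑ i, tmul (ang i f) (ang i g)

lemma val_sum {ι : Type*} (s : Finset ι) (f : ι → TestFun) (x : S2) :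
    (∑ i ∈ s, f i).1 x = ∑ i ∈ s, (f i).1 x := by
  rw [AddSubmonoidClass.coe_finsetSum, Finset.sum_apply]

lemma gradDot_apply (f g : TestFun) (x : S2) :
    (gradDot f g).1 x = ∑ i, (ang i f).1 x * (ang i g).1 x := val_sum _ _ _

lemma gradDot_tcoord (j k : Fin 3) : gradDot (tcoord j) (tcoord k)
    = tconst (if j = k then 1 else 0) - tmul (tcoord j) (tcoord k) := by
  refine fun_ext fun x => ?_
  have hx := sum_sq_coord (x : E3)
  rw [norm_coe_sphere] at hx
  change _ = (if j = k then (1 : ℝ) else 0) - (x : E3) j * (x : E3) k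
  simp only [gradDot_apply, ang_tcoord_apply, Fin.sum_univ_three]
  fin_cases j <;> fin_cases k <;> simp <;>
    first | ring1 | linear_combination hx

lemma gradDot_tmul (f g h : TestFun) :
    gradDot f (tmul g h) = tmul g (gradDot f h) + tmul (gradDot f g) h := by
  refine fun_ext fun x => ?_
  change _ = g.1 x * (gradDot f h).1 x + (gradDot f g).1 x * h.1 x
  have e : ∀ i, (ang i (tmul g h)).1 x = g.1 x * (ang i h).1 x + (ang i g).1 x * h.1 x := fun i => by
    rw [ang_tmul]; rfl
  simp only [gradDot_apply, e, Finset.mul_sum, Finset.sum_mul, ← Finset.sum_add_distrib]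
  exact Finset.sum_congr rfl fun i _ => by ring

lemma lap_tmul (f g : TestFun) :
    lap (tmul f g) = tmul f (lap g) + (2 : ℝ) • gradDot f g + tmul (lap f) g := by
  refine fun_ext fun x => ?_
  change _ = f.1 x * (lap g).1 x + 2 * (gradDot f g).1 x + (lap f).1 x * g.1 x
  have e : ∀ i, (ang i (ang i (tmul f g))).1 x = f.1 x * (ang i (ang i g)).1 x
      + 2 * ((ang i f).1 x * (ang i g).1 x) + (ang i (ang i f)).1 x * g.1 x := fun i => by
    rw [ang_tmul, ang_add, ang_tmul, ang_tmul]
    change f.1 x * _ + _ * _ + (_ * _ + _ * g.1 x) = _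
    ring
  simp only [lap_eq, gradDot_apply, val_sum, e, Finset.mul_sum, Finset.sum_mul,
    Finset.sum_add_distrib]

lemma lap_tcoord (j : Fin 3) : lap (tcoord j) = (-2 : ℝ) • tcoord j := by
  rw [lap_eq, Fin.sum_univ_three]
  have i0 : ang 0 (tcoord 1) = -tcoord 2 := ang_tcoord_one 0
  have i1 : ang 1 (tcoord 2) = -tcoord 0 := ang_tcoord_one 1
  have i2 : ang 2 (tcoord 0) = -tcoord 1 := ang_tcoord_one 2
  have j0 : ang 0 (tcoord 2) = tcoord 1 := ang_tcoord_two 0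
  have j1 : ang 1 (tcoord 0) = tcoord 2 := ang_tcoord_two 1
  have j2 : ang 2 (tcoord 1) = tcoord 0 := ang_tcoord_two 2
  have z : ∀ i, ang i (0 : TestFun) = 0 := fun i => (angL i).map_zero
  fin_cases j <;> simp [i0, i1, i2, j0, j1, j2, ang_tcoord_self, ang_neg, z] <;> module

lemma lap_tconst (c : ℝ) : lap (tconst c) = 0 := by
  rw [lap_eq]
  exact Finset.sum_eq_zero fun i _ => by rw [ang_tconst]; exact (angL i).map_zero

/-- Multiplication by a coordinate. -/
def mulCoord (j : Fin 3) : TestFun →ₗ[ℝ] TestFun where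
  toFun := tmul (tcoord j)
  map_add' _ _ := fun_ext fun _ => mul_add _ _ _
  map_smul' _ _ := fun_ext fun _ => mul_left_comm _ _ _

/-- The restrictions to the sphere of the polynomials of degree at most `n`. -/
def polys : ℕ → Submodule ℝ TestFun
  | 0 => Submodule.span ℝ {tconst 1}
  | n + 1 => polys n ⊔ ⨆ j, (polys n).map (mulCoord j)

lemma polys_le_succ (n : ℕ) : polys n ≤ polys (n + 1) := le_sup_left

lemma mulCoord_mem {n : ℕ} (j : Fin 3) {q : TestFun} (hq : q ∈ polys n) :
    mulCoord j q ∈ polys (n + 1) :=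
  Submodule.mem_sup_right (Submodule.mem_iSup_of_mem j (Submodule.mem_map_of_mem hq))

lemma polys_succ_induction {n : ℕ} {P : TestFun → Prop} (h0 : ∀ q ∈ polys n, P q)
    (h1 : ∀ (j : Fin 3), ∀ q ∈ polys n, P (mulCoord j q))
    (ha : ∀ p q, P p → P q → P (p + q)) {q : TestFun} (hq : q ∈ polys (n + 1)) : P q := by
  obtain ⟨a, ha', b, hb, rfl⟩ := Submodule.mem_sup.1 hq
  refine ha _ _ (h0 _ ha') ?_
  refine Submodule.iSup_induction _ (motive := P) hb ?_ ?_ ha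
  · rintro j _ ⟨q, hq, rfl⟩
    exact h1 j q hq
  · exact h0 _ (zero_mem _)

/-- The gradient pairing with a coordinate, corrected by the degree. -/
def gradCoord (n : ℕ) (j : Fin 3) : TestFun →ₗ[ℝ] TestFun where
  toFun q := gradDot (tcoord j) q + (n : ℝ) • mulCoord j q
  map_add' f g := fun_ext fun x => by
    change (gradDot _ _).1 x + n * (_ * (f.1 x + g.1 x))
      = (gradDot _ _).1 x + n * (_ * f.1 x) + ((gradDot _ _).1 x + n * (_ * g.1 x))
    simp only [gradDot_apply, Fin.sum_univ_three, ang_add]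
    change _ * ((ang 0 f).1 x + (ang 0 g).1 x) + _ * ((ang 1 f).1 x + (ang 1 g).1 x)
      + _ * ((ang 2 f).1 x + (ang 2 g).1 x) + _ = _
    ring
  map_smul' c f := fun_ext fun x => by
    change (gradDot _ _).1 x + n * (_ * (c * f.1 x))
      = c * ((gradDot _ _).1 x + n * (_ * f.1 x))
    simp only [gradDot_apply, Fin.sum_univ_three, ang_smul]
    change _ * (c * (ang 0 f).1 x) + _ * (c * (ang 1 f).1 x)
      + _ * (c * (ang 2 f).1 x) + _ = _
    ring

lemma gradCoord_mem (n : ℕ) (j : Fin 3) : ∀ q ∈ polys n, gradCoord n j q ∈ polys n := by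
  induction n with
  | zero =>
    intro q hq
    obtain ⟨c, rfl⟩ := Submodule.mem_span_singleton.1 hq
    rw [map_smul]
    have : gradCoord 0 j (tconst 1) = 0 := by
      change gradDot _ _ + ((0 : ℕ) : ℝ) • _ = _
      rw [Nat.cast_zero, zero_smul, add_zero]
      refine fun_ext fun x => ?_
      rw [gradDot_apply]
      refine Finset.sum_eq_zero fun i _ => ?_
      rw [ang_tconst]; exact mul_zero _
    rw [this, smul_zero]; exact zero_mem _
  | succ n ih =>
    intro q hq
    refine polys_succ_induction (P := fun q => gradCoord (n + 1) j q ∈ polys (n + 1)) ?_ ?_ ?_ hq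
    · intro q hq
      have : gradCoord (n + 1) j q = gradCoord n j q + mulCoord j q := by
        change gradDot _ _ + ((n + 1 : ℕ) : ℝ) • _ = gradDot _ _ + (n : ℝ) • _ + _
        push_cast; module
      rw [this]
      exact add_mem (polys_le_succ n (ih q hq)) (mulCoord_mem j hq)
    · intro k q hq
      have : gradCoord (n + 1) j (mulCoord k q)
          = mulCoord k (gradCoord n j q) + (if j = k then (1 : ℝ) else 0) • q := by
        refine fun_ext fun x => ?_
        have h := congrArg (fun f : TestFun => f.1 x) (gradDot_tmul (tcoord j) (tcoord k) q)
        rw [gradDot_tcoord] at h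
        change (gradDot (tcoord j) (tmul (tcoord k) q)).1 x
          + ((n + 1 : ℕ) : ℝ) * ((x : E3) j * ((x : E3) k * q.1 x))
          = (x : E3) k * ((gradDot (tcoord j) q).1 x + n * ((x : E3) j * q.1 x)) + _ * q.1 x
        change (gradDot (tcoord j) (tmul (tcoord k) q)).1 x
          = (x : E3) k * (gradDot (tcoord j) q).1 x
          + ((if j = k then (1 : ℝ) else 0) - (x : E3) j * (x : E3) k) * q.1 x at h
        rw [h]; push_cast; ring
      rw [this]
      exact add_mem (mulCoord_mem k (ih q hq)) (Submodule.smul_mem _ _ (polys_le_succ n hq))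
    · intro p q hp hq
      rw [map_add]; exact add_mem hp hq

/-- The polynomials of degree less than `n`. -/
def polysLT : ℕ → Submodule ℝ TestFun
  | 0 => ⊥
  | n + 1 => polys n

lemma polysLT_le (n : ℕ) : polysLT n ≤ polys n := by
  cases n with
  | zero => exact bot_le
  | succ n => exact polys_le_succ n

lemma mulCoord_mem_of_lt {n : ℕ} (j : Fin 3) {q : TestFun} (hq : q ∈ polysLT n) :
    mulCoord j q ∈ polys n := by
  cases n with
  | zero =>
    rw [(Submodule.mem_bot ℝ).1 hq, map_zero]; exact zero_mem _
  | succ n => exact mulCoord_mem j hq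

lemma lap_add_mem (n : ℕ) :
    ∀ q ∈ polys n, shiftLap n q ∈ polysLT n := by
  induction n with
  | zero =>
    intro q hq
    obtain ⟨c, rfl⟩ := Submodule.mem_span_singleton.1 hq
    rw [map_smul]
    have : shiftLap 0 (tconst 1) = 0 := by
      rw [shiftLap_apply, Nat.cast_zero, zero_mul, zero_smul, add_zero, lap_tconst]
    rw [this, smul_zero]; exact zero_mem _
  | succ n ih =>
    intro q hq
    refine polys_succ_induction (P := fun q => shiftLap (n + 1) q ∈ polys n) ?_ ?_ ?_ hq
    · intro q hq
      have : shiftLap (n + 1) q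
          = shiftLap n q + (2 * ((n : ℝ) + 1)) • q := by
        simp only [shiftLap_apply]
        push_cast; module
      rw [this]
      exact add_mem (polysLT_le n (ih q hq)) (Submodule.smul_mem _ _ hq)
    · intro k q hq
      have : shiftLap (n + 1) (mulCoord k q)
          = mulCoord k (shiftLap n q)
            + (2 : ℝ) • gradCoord n k q := by
        refine fun_ext fun x => ?_
        have h := congrArg (fun f : TestFun => f.1 x) (lap_tmul (tcoord k) q)
        rw [lap_tcoord] at h
        change (lap (tmul (tcoord k) q)).1 x = (x : E3) k * (lap q).1 x
          + 2 * (gradDot (tcoord k) q).1 x + (-2 * (x : E3) k) * q.1 x at h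
        change (lap (tmul (tcoord k) q)).1 x
          + (((n + 1 : ℕ) : ℝ) * (((n + 1 : ℕ) : ℝ) + 1)) * ((x : E3) k * q.1 x)
          = (x : E3) k * ((lap q).1 x + ((n : ℝ) * (n + 1)) * q.1 x)
          + 2 * ((gradDot (tcoord k) q).1 x + n * ((x : E3) k * q.1 x))
        rw [h]; push_cast; ring
      rw [this]
      exact add_mem (mulCoord_mem_of_lt k (ih q hq))
        (Submodule.smul_mem _ _ (gradCoord_mem n k q hq))
    · intro p q hp hq
      rw [map_add]; exact add_mem hp hq

lemma polys_le_iSup_harm (n : ℕ) : polys n ≤ ⨆ l, ⨆ (_ : l ≤ n), harm l := by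
  have step : ∀ n, polysLT n ≤ ⨆ l, ⨆ (_ : l < n), harm l → polys n ≤ ⨆ l, ⨆ (_ : l ≤ n), harm l := by
    intro n hn q hq
    have key : ∀ r ∈ ⨆ l, ⨆ (_ : l < n), harm l, ∃ q' ∈ ⨆ l, ⨆ (_ : l < n), harm l,
        shiftLap n q' = r := by
      intro r hr
      refine Submodule.iSup_induction _ (motive := fun r => ∃ q' ∈ ⨆ l, ⨆ (_ : l < n), harm l,
        shiftLap n q' = r) hr ?_ ⟨0, zero_mem _, map_zero _⟩ ?_
      · intro l r hr
        by_cases hl : l < n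
        · simp only [hl, iSup_pos] at hr
          have h1 := mem_harm.1 hr
          have hc : ((n : ℝ) * (n + 1)) - (l : ℝ) * (l + 1) ≠ 0 := by
            have : (l : ℝ) < n := by exact_mod_cast hl
            have h0 : (0 : ℝ) ≤ l := by positivity
            nlinarith
          refine ⟨(((n : ℝ) * (n + 1)) - (l : ℝ) * (l + 1))⁻¹ • r,
            Submodule.smul_mem _ _ (Submodule.mem_iSup_of_mem l
              (Submodule.mem_iSup_of_mem hl hr)), ?_⟩
          rw [map_smul]
          have : shiftLap n r
              = (((n : ℝ) * (n + 1)) - (l : ℝ) * (l + 1)) • r := by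
            rw [shiftLap_apply, h1]; module
          rw [this, smul_smul, inv_mul_cancel₀ hc, one_smul]
        · simp only [hl, not_false_eq_true, iSup_neg, Submodule.mem_bot] at hr
          exact ⟨0, zero_mem _, by rw [map_zero, hr]⟩
      · rintro _ _ ⟨a, ha, rfl⟩ ⟨b, hb, rfl⟩
        exact ⟨a + b, add_mem ha hb, map_add _ _ _⟩
    obtain ⟨q', hq', he⟩ := key _ (hn (lap_add_mem n q hq))
    have h1 : q - q' ∈ harm n := by
      rw [harm, LinearMap.mem_ker, map_sub, he, sub_self]
    have h2 : q = (q - q') + q' := by abel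
    rw [h2]
    refine add_mem (Submodule.mem_iSup_of_mem n (Submodule.mem_iSup_of_mem le_rfl h1)) ?_
    exact (iSup₂_le fun l hl => le_iSup₂_of_le l hl.le le_rfl :
      (⨆ l, ⨆ (_ : l < n), harm l) ≤ ⨆ l, ⨆ (_ : l ≤ n), harm l) hq'
  induction n with
  | zero => exact step 0 bot_le
  | succ n ih =>
    refine step (n + 1) (ih.trans ?_)
    exact iSup₂_le fun l hl => le_iSup₂_of_le l (Nat.lt_succ_of_le hl) le_rfl

/-! ### Density of the spherical harmonics -/

/-- A test function as a continuous function. -/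
def toC : TestFun →ₗ[ℝ] C(S2, ℝ) where
  toFun f := ⟨f.1, continuous_testFun f⟩
  map_add' _ _ := rfl
  map_smul' _ _ := rfl

/-- A test function as an element of `L²`. -/
def toH : TestFun →ₗ[ℝ] Lp ℝ 2 surf :=
  (ContinuousMap.toLp 2 surf ℝ).toLinearMap ∘ₗ toC

lemma inner_toH (f g : TestFun) : ⟪toH f, toH g⟫ = l2 f g := by
  have h := ContinuousMap.inner_toLp surf (toC f) (toC g)
  refine h.trans ?_
  simp only [l2]
  congr 1; funext x
  simp [toC, mul_comm]

/-- The algebra of the restrictions of polynomials to the sphere. -/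
def polyAlg : Subalgebra ℝ C(S2, ℝ) := Algebra.adjoin ℝ (Set.range fun j => toC (tcoord j))

lemma exists_polys_of_mem_polyAlg {g : C(S2, ℝ)} (hg : g ∈ polyAlg) :
    ∃ n, ∃ p ∈ polys n, toC p = g := by
  have mono : Monotone polys := monotone_nat_of_le_succ polys_le_succ
  have hg' : g ∈ Submodule.span ℝ
      ((Submonoid.closure (Set.range fun j => toC (tcoord j)) : Submonoid C(S2, ℝ)) : Set C(S2, ℝ)) := by
    rw [← Algebra.adjoin_eq_span]; exact hg
  refine Submodule.span_induction (p := fun g _ => ∃ n, ∃ p ∈ polys n, toC p = g) ?_ ?_ ?_ ?_ hg'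
  · intro g hg
    refine Submonoid.closure_induction_left
      (motive := fun g _ => ∃ n, ∃ p ∈ polys n, toC p = g) ?_ ?_ hg
    · exact ⟨0, tconst 1, Submodule.mem_span_singleton_self _, rfl⟩
    · rintro _ ⟨j, rfl⟩ _ _ ⟨n, p, hp, rfl⟩
      exact ⟨n + 1, mulCoord j p, mulCoord_mem j hp, rfl⟩
  · exact ⟨0, 0, zero_mem _, map_zero _⟩
  · rintro _ _ _ _ ⟨n, p, hp, rfl⟩ ⟨m, q, hq, rfl⟩
    exact ⟨max n m, p + q, add_mem (mono (le_max_left _ _) hp) (mono (le_max_right _ _) hq),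
      map_add _ _ _⟩
  · rintro c _ _ ⟨n, p, hp, rfl⟩
    exact ⟨n, c • p, Submodule.smul_mem _ _ hp, map_smul _ _ _⟩

lemma polyAlg_closure : polyAlg.topologicalClosure = ⊤ := by
  refine ContinuousMap.subalgebra_topologicalClosure_eq_top_of_separatesPoints _ ?_
  intro x y hxy
  have h : ∃ j, (x : E3) j ≠ (y : E3) j := by
    by_contra! h
    exact hxy (Subtype.ext (by ext j; exact h j))
  obtain ⟨j, hj⟩ := h
  exact ⟨_, ⟨toC (tcoord j), Algebra.subset_adjoin ⟨j, rfl⟩, rfl⟩, hj⟩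

lemma dense_harm {S : Submodule ℝ (Lp ℝ 2 surf)} (hS : IsClosed (S : Set (Lp ℝ 2 surf)))
    (h : ∀ l, ∀ f ∈ harm l, toH f ∈ S) : S = ⊤ := by
  have h1 : ∀ n, ∀ p ∈ polys n, toH p ∈ S := by
    intro n p hp
    have h2 : (⨆ l, ⨆ (_ : l ≤ n), harm l) ≤ S.comap toH :=
      iSup₂_le fun l _ f hf => h l f hf
    exact h2 (polys_le_iSup_harm n hp)
  have h3 : ∀ g : C(S2, ℝ), ContinuousMap.toLp 2 surf ℝ g ∈ S := by
    intro g
    have hcl : IsClosed {g : C(S2, ℝ) | ContinuousMap.toLp 2 surf ℝ g ∈ S} :=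
      hS.preimage (ContinuousMap.toLp 2 surf ℝ).continuous
    have hsub : (polyAlg : Set C(S2, ℝ)) ⊆ {g | ContinuousMap.toLp 2 surf ℝ g ∈ S} := by
      intro g hg
      obtain ⟨n, p, hp, rfl⟩ := exists_polys_of_mem_polyAlg hg
      exact h1 n p hp
    have : g ∈ polyAlg.topologicalClosure := by rw [polyAlg_closure]; trivial
    exact closure_minimal hsub hcl this
  rw [← Submodule.coe_eq_univ, Set.eq_univ_iff_forall]
  intro u
  have hd : DenseRange (ContinuousMap.toLp 2 surf ℝ : C(S2, ℝ) →L[ℝ] Lp ℝ 2 surf) :=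
    ContinuousMap.toLp_denseRange ℝ surf ℝ (by simp)
  exact hd.induction_on (p := fun u => u ∈ S) u hS h3

/-! ### The mean value inequality -/

/-- The radial profile of the averaging kernel. -/
def avgKer (y : E3) : ℝ := max 0 (1 - ‖y‖ ^ 2)

lemma continuous_avgKer : Continuous avgKer := by unfold avgKer; fun_prop

lemma avgKer_nonneg (y : E3) : 0 ≤ avgKer y := le_max_left _ _

lemma avgKer_le_one (y : E3) : avgKer y ≤ 1 := max_le zero_le_one (by nlinarith [sq_nonneg ‖y‖])

lemma avgKer_eq_zero {y : E3} (hy : 1 ≤ ‖y‖) : avgKer y = 0 :=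
  max_eq_left (by nlinarith)

lemma hasCompactSupport_avgKer : HasCompactSupport avgKer := by
  refine HasCompactSupport.intro (isCompact_closedBall (0 : E3) 1) fun y hy => ?_
  rw [mem_closedBall_zero_iff, not_le] at hy
  exact avgKer_eq_zero hy.le

lemma integrable_mul_avgKer {F : E3 → ℝ} (hF : Continuous F) :
    Integrable (fun y => F y * avgKer y) :=
  (hF.mul continuous_avgKer).integrable_of_hasCompactSupport hasCompactSupport_avgKer.mul_left

lemma integral_avgKer_pos : 0 < ∫ y, avgKer y := by
  refine continuous_avgKer.integral_pos_of_hasCompactSupport_nonneg_nonzero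
    hasCompactSupport_avgKer avgKer_nonneg (x := 0) ?_
  simp [avgKer]

lemma hasDerivAt_max_sq (t : ℝ) : HasDerivAt (fun t : ℝ => max 0 t ^ 2) (2 * max 0 t) t := by
  rcases lt_trichotomy t 0 with ht | rfl | ht
  · rw [max_eq_left ht.le, mul_zero]
    refine (hasDerivAt_const t (0 : ℝ)).congr_of_eventuallyEq ?_
    filter_upwards [gt_mem_nhds ht] with s hs
    rw [max_eq_left (le_of_lt hs)]; norm_num
  · rw [max_self, mul_zero, hasDerivAt_iff_isLittleO]
    simp only [max_self, smul_zero, sub_zero]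
    refine Asymptotics.IsBigO.trans_isLittleO (g := fun t : ℝ => t ^ 2) ?_
      (Asymptotics.isLittleO_pow_id one_lt_two)
    refine Asymptotics.IsBigO.of_bound 1 (Eventually.of_forall fun s => ?_)
    rw [one_mul]
    simp only [ne_eq, OfNat.ofNat_ne_zero, not_false_eq_true, zero_pow, sub_zero, norm_pow,
      Real.norm_eq_abs, sq_abs]
    rcases le_total s 0 with h | h
    · rw [max_eq_left h]; nlinarith [sq_nonneg s]
    · rw [max_eq_right h]
  · rw [max_eq_right ht.le]
    have h := (hasDerivAt_id t).pow 2
    simp only [id, Nat.cast_ofNat, Nat.add_one_sub_one, pow_one, mul_one] at h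
    refine h.congr_of_eventuallyEq ?_
    filter_upwards [lt_mem_nhds ht] with s hs
    simp [max_eq_right (le_of_lt hs)]

lemma hasFDerivAt_avgKer_sq (y : E3) :
    HasFDerivAt (fun y => avgKer y ^ 2) ((-4 * avgKer y) • innerSL ℝ y) y := by
  have h1 : HasFDerivAt (fun y : E3 => 1 - ‖y‖ ^ 2) (-(2 • innerSL ℝ y)) y :=
    ((hasStrictFDerivAt_norm_sq y).hasFDerivAt).const_sub 1
  have h2 := (hasDerivAt_max_sq (1 - ‖y‖ ^ 2)).comp_hasFDerivAt y h1
  refine h2.congr_fderiv ?_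
  ext v
  simp [avgKer]; ring

lemma integral_radial_deriv {G : E3 → ℝ} (hG : ContDiff ℝ 2 G)
    (hlap : ∀ y, ‖y‖ < 1 → lapF G y = 0) :
    ∫ y, fderiv ℝ G y y * avgKer y = 0 := by
  have hG1 : ∀ i, ContDiff ℝ 1 (pd i G) := fun i =>
    (hG.fderiv_right (m := 1) (by norm_num)).clm_apply contDiff_const
  have hpc : ∀ i j, Continuous (pd j (pd i G)) := fun i j =>
    ((hG1 i).continuous_fderiv (by simp)).clm_apply continuous_const
  have hc : ∀ i : Fin 3, Continuous fun y : E3 => y i := fun i =>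
    (EuclideanSpace.proj (𝕜 := ℝ) i).continuous
  have hcs : ∀ F : E3 → ℝ, Continuous F → Integrable (fun y => F y * avgKer y ^ 2) := by
    intro F hF
    have := integrable_mul_avgKer (hF.mul continuous_avgKer)
    refine this.congr (Eventually.of_forall fun y => ?_)
    simp only [Pi.mul_apply]; ring
  have hfd : ∀ (i : Fin 3) (y : E3), fderiv ℝ (fun y => avgKer y ^ 2) y
      (EuclideanSpace.single i (1 : ℝ)) = -4 * (y i * avgKer y) := by
    intro i y
    rw [(hasFDerivAt_avgKer_sq y).fderiv]
    simp [EuclideanSpace.inner_single_right]; ring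
  have hI : ∀ i, Integrable (fun y : E3 => pd i G y * y i * avgKer y) := fun i =>
    integrable_mul_avgKer ((hG1 i).continuous.mul (hc i))
  have key : ∀ i, ∫ y : E3, pd i G y * y i * avgKer y
      = (1 / 4) * ∫ y, pd i (pd i G) y * avgKer y ^ 2 := by
    intro i
    have hI' : Integrable (fun y => pd i G y * fderiv ℝ (fun y => avgKer y ^ 2) y
        (EuclideanSpace.single i (1 : ℝ))) := by
      refine ((hI i).const_mul (-4)).congr (Eventually.of_forall fun y => ?_)
      simp only [hfd]; ring
    have h := integral_mul_fderiv_eq_neg_fderiv_mul_of_integrable (μ := (volume : Measure E3))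
      (f := pd i G) (g := fun y => avgKer y ^ 2) (v := EuclideanSpace.single i (1 : ℝ))
      (hcs _ (hpc i i)) hI' (hcs _ (hG1 i).continuous)
      (fun x _ => (hG1 i).differentiable (by simp) x)
      (fun x _ => (hasFDerivAt_avgKer_sq x).differentiableAt)
    have h2 : ∫ y, pd i G y * fderiv ℝ (fun y => avgKer y ^ 2) y
        (EuclideanSpace.single i (1 : ℝ)) = -4 * ∫ y : E3, pd i G y * y i * avgKer y := by
      rw [← integral_const_mul]
      congr 1; funext y; rw [hfd]; ring
    rw [h2] at h
    change _ = (1 / 4) * ∫ y, fderiv ℝ (pd i G) y (EuclideanSpace.single i (1 : ℝ)) * avgKer y ^ 2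
    linarith
  have e1 : ∀ y, fderiv ℝ G y y * avgKer y = ∑ i, pd i G y * y i * avgKer y := fun y => by
    rw [fderiv_eq_sum_pd, Finset.sum_mul]
    exact Finset.sum_congr rfl fun i _ => by ring
  simp only [e1]
  rw [integral_finsetSum _ fun i _ => hI i]
  simp only [key]
  rw [← Finset.mul_sum, ← integral_finsetSum _ fun i _ => hcs _ (hpc i i)]
  have e2 : ∀ y, ∑ i, pd i (pd i G) y * avgKer y ^ 2 = 0 := fun y => by
    rw [← Finset.sum_mul]
    by_cases hy : ‖y‖ < 1
    · rw [show ∑ i, pd i (pd i G) y = lapF G y from rfl, hlap y hy, zero_mul]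
    · rw [avgKer_eq_zero (not_lt.1 hy)]; ring
  simp [e2]

lemma pd_comp_affine {G : E3 → ℝ} (hG : Differentiable ℝ G) (x : E3) (r : ℝ) (i : Fin 3) (y : E3) :
    pd i (fun y => G (x + r • y)) y = r * pd i G (x + r • y) := by
  have h1 : HasFDerivAt (fun y : E3 => x + r • y) (r • ContinuousLinearMap.id ℝ E3) y :=
    ((hasFDerivAt_id y).const_smul r).const_add x
  have h2 := (hG (x + r • y)).hasFDerivAt.comp y h1
  unfold pd
  rw [show (fun y => G (x + r • y)) = G ∘ fun y => x + r • y from rfl, h2.fderiv]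
  simp

lemma mean_value {W : E3 → ℝ} (hW : ContDiff ℝ 2 W) (hc : HasCompactSupport W) {x : E3} {R : ℝ}
    (hlap : ∀ y, dist y x < R → lapF W y = 0) {r : ℝ} (hr : 0 ≤ r) (hrR : r ≤ R) :
    ∫ y, W (x + r • y) * avgKer y = W x * ∫ y, avgKer y := by
  have hcd : Continuous (fderiv ℝ W) := hW.continuous_fderiv (by simp)
  obtain ⟨C, hC⟩ := (hc.fderiv (𝕜 := ℝ)).exists_bound_of_continuous hcd
  have hd : ∀ r : ℝ, HasDerivAt (fun r : ℝ => ∫ y, W (x + r • y) * avgKer y)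
      (∫ y, fderiv ℝ W (x + r • y) y * avgKer y) r := by
    intro r
    refine (hasDerivAt_integral_of_dominated_loc_of_deriv_le (𝕜 := ℝ) (s := Set.univ)
      (F := fun (r : ℝ) (y : E3) => W (x + r • y) * avgKer y)
      (F' := fun (r : ℝ) (y : E3) => fderiv ℝ W (x + r • y) y * avgKer y)
      (bound := fun y => C * avgKer y) univ_mem ?_ ?_ ?_ ?_ ?_ ?_).2
    · refine Eventually.of_forall fun s => ?_
      exact (integrable_mul_avgKer (hW.continuous.comp (by fun_prop))).aestronglyMeasurable
    · exact integrable_mul_avgKer (hW.continuous.comp (by fun_prop))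
    · refine (integrable_mul_avgKer (F := fun y => fderiv ℝ W (x + r • y) y) ?_).aestronglyMeasurable
      exact (hcd.comp (by fun_prop)).clm_apply continuous_id
    · refine Eventually.of_forall fun y s _ => ?_
      rw [norm_mul, Real.norm_of_nonneg (avgKer_nonneg y)]
      rcases lt_or_ge ‖y‖ 1 with hy | hy
      · refine mul_le_mul_of_nonneg_right ?_ (avgKer_nonneg y)
        refine ((fderiv ℝ W (x + s • y)).le_opNorm y).trans ?_
        have h0 := (norm_nonneg _).trans (hC (x + s • y))
        nlinarith [hC (x + s • y), norm_nonneg (fderiv ℝ W (x + s • y)), norm_nonneg y]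
      · simp [avgKer_eq_zero hy]
    · exact integrable_mul_avgKer (F := fun _ => C) continuous_const
    · refine Eventually.of_forall fun y s _ => ?_
      have h1 : HasDerivAt (fun s : ℝ => x + s • y) y s := by
        have h0 : HasDerivAt (fun s : ℝ => x + s • y) ((1 : ℝ) • y) s :=
          ((hasDerivAt_id s).smul_const y).const_add x
        rwa [one_smul] at h0
      have h2 := (hW.differentiable (by simp) (x + s • y)).hasFDerivAt.comp_hasDerivAt s h1
      exact h2.mul_const _
  have hz : ∀ s ∈ Set.Ioo 0 r, ∫ y, fderiv ℝ W (x + s • y) y * avgKer y = 0 := by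
    intro s hs
    have hG : ContDiff ℝ 2 (fun y => W (x + s • y)) := hW.comp (by fun_prop)
    have hdW := hW.differentiable (by simp)
    have hdp : ∀ i, Differentiable ℝ (pd i W) := fun i =>
      ((hW.fderiv_right (m := 1) (by norm_num)).clm_apply contDiff_const).differentiable (by simp)
    have h := integral_radial_deriv hG (fun y hy => by
      have e : ∀ i, pd i (pd i (fun y => W (x + s • y))) y = s * (s * pd i (pd i W) (x + s • y)) := by
        intro i
        have e1 : pd i (fun y => W (x + s • y)) = fun y => s * pd i W (x + s • y) :=
          funext fun z => pd_comp_affine hdW x s i z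
        have e2 := pd_comp_affine (G := fun z => s * pd i W z) ((hdp i).const_mul s) x s i y
        rw [e1, e2]
        congr 1
        change fderiv ℝ (fun z => s * pd i W z) _ _ = s * fderiv ℝ (pd i W) _ _
        rw [((hdp i (x + s • y)).hasFDerivAt.const_mul s).fderiv]
        rfl
      have e3 := hlap (x + s • y) (by
        rw [dist_eq_norm, add_sub_cancel_left, norm_smul, Real.norm_of_nonneg hs.1.le]
        nlinarith [hs.1, hs.2, norm_nonneg y])
      rw [lapF] at e3 ⊢
      simp only [e]
      rw [← Finset.mul_sum, ← Finset.mul_sum, e3, mul_zero, mul_zero])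
    have e4 : ∀ y, fderiv ℝ (fun y => W (x + s • y)) y y = s * fderiv ℝ W (x + s • y) y := by
      intro y
      simp only [fderiv_eq_sum_pd _ y, fderiv_eq_sum_pd _ (x + s • y),
        pd_comp_affine hdW, Finset.mul_sum]
      exact Finset.sum_congr rfl fun i _ => by ring
    simp only [e4, mul_assoc] at h
    rw [integral_const_mul] at h
    exact (mul_eq_zero.1 h).resolve_left hs.1.ne'
  have hconst := constant_of_has_deriv_right_zero (a := 0) (b := r)
    (f := fun r : ℝ => ∫ y, W (x + r • y) * avgKer y)
    (fun s _ => (hd s).continuousAt.continuousWithinAt) (fun s hs => by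
      rcases eq_or_lt_of_le hs.1 with h0 | h0
      · have : ∫ y, fderiv ℝ W (x + s • y) y * avgKer y = 0 := by
          rw [← h0]
          simp only [zero_smul, add_zero]
          have hodd : ∀ y, fderiv ℝ W x (-y) * avgKer (-y) = -(fderiv ℝ W x y * avgKer y) := by
            intro y; simp [avgKer]
          have h1 := integral_neg_eq_self (fun y => fderiv ℝ W x y * avgKer y) volume
          simp only [hodd] at h1
          rw [integral_neg] at h1
          linarith
        exact this ▸ (hd s).hasDerivWithinAt
      · exact hz s ⟨h0, hs.2⟩ ▸ (hd s).hasDerivWithinAt) r ⟨hr, le_rfl⟩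
  simp only [zero_smul, add_zero] at hconst
  rw [hconst, integral_const_mul]

/-! ### Pointwise and trace inequalities for spherical harmonics -/

lemma SmoothOff.sum {ι : Type*} {s : Finset ι} {F : ι → E3 → ℝ} (hF : ∀ i ∈ s, SmoothOff (F i)) :
    SmoothOff (fun y => ∑ i ∈ s, F i y) := ContDiffOn.sum hF

lemma pd_sum {ι : Type*} {s : Finset ι} {F : ι → E3 → ℝ} (hF : ∀ i ∈ s, SmoothOff (F i))
    (j : Fin 3) {y : E3} (hy : y ≠ 0) :
    pd j (fun y => ∑ i ∈ s, F i y) y = ∑ i ∈ s, pd j (F i) y := by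
  have h := HasFDerivAt.fun_sum fun i hi => ((hF i hi).differentiableAt hy).hasFDerivAt
  unfold pd
  rw [h.fderiv]
  simp

lemma lapF_sum {ι : Type*} {s : Finset ι} {F : ι → E3 → ℝ} (hF : ∀ i ∈ s, SmoothOff (F i))
    {y : E3} (hy : y ≠ 0) : lapF (fun y => ∑ i ∈ s, F i y) y = ∑ i ∈ s, lapF (F i) y := by
  unfold lapF
  rw [Finset.sum_comm]
  refine Finset.sum_congr rfl fun j _ => ?_
  rw [pd_congr (fun y hy => pd_sum hF j hy) j hy, pd_sum (fun i hi => (hF i hi).pd j) j hy]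

/-- The harmonic extension of a finite sum of spherical harmonics. -/
def harmExt (p : ℕ → TestFun) (N : ℕ) (y : E3) : ℝ :=
  ∑ l ∈ Finset.range N, ‖y‖ ^ (l : ℤ) * homExt (p l).1 y

lemma smoothOff_harmExt (p : ℕ → TestFun) (N : ℕ) : SmoothOff (harmExt p N) :=
  SmoothOff.sum fun l _ => (smoothOff_zpow_norm l).mul (smoothOff_homExt (p l))

lemma lapF_harmExt {p : ℕ → TestFun} (hp : ∀ l, p l ∈ harm l) (N : ℕ) {y : E3} (hy : y ≠ 0) :
    lapF (harmExt p N) y = 0 := by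
  unfold harmExt
  rw [lapF_sum (F := fun (l : ℕ) y => ‖y‖ ^ (l : ℤ) * homExt (p l).1 y)
    (fun l _ => (smoothOff_zpow_norm l).mul (smoothOff_homExt (p l))) hy]
  refine Finset.sum_eq_zero fun l _ => ?_
  rw [lapF_zpow_norm_mul l (p l) hy, mem_harm.1 (hp l), show homExt (-((l : ℝ) * (l + 1)) • p l).1 y
    = -((l : ℝ) * (l + 1)) * homExt (p l).1 y from congrFun (homExt_smul _ (p l).1) y]
  push_cast; ring

lemma harmExt_coe (p : ℕ → TestFun) (N : ℕ) (x : S2) :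
    harmExt p N x = (∑ l ∈ Finset.range N, p l).1 x := by
  rw [val_sum]
  exact Finset.sum_congr rfl fun l _ => by rw [norm_coe_sphere, one_zpow, one_mul, homExt_coe]

lemma lapF_congr {F G : E3 → ℝ} {y : E3} (h : F =ᶠ[𝓝 y] G) : lapF F y = lapF G y := by
  refine Finset.sum_congr rfl fun i _ => ?_
  have h1 : pd i F =ᶠ[𝓝 y] pd i G := by
    filter_upwards [h.eventuallyEq_nhds] with z hz
    simp only [pd, hz.fderiv_eq]
  simp only [pd] at h1 ⊢
  rw [h1.fderiv_eq]

lemma ball_inequality {U : E3 → ℝ} (hU : SmoothOff U) (hlap : ∀ y, y ≠ 0 → lapF U y = 0) (x : S2)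
    {r : ℝ} (hr : 0 < r) (hr2 : r ≤ 1 / 2) :
    (∫ y, avgKer y) * U x ^ 2 ≤ (r ^ 3)⁻¹ * ∫ z in Metric.ball (x : E3) r, U z ^ 2 := by
  let b : ContDiffBump (x : E3) := ⟨3 / 4, 7 / 8, by norm_num, by norm_num⟩
  set W : E3 → ℝ := fun y => b y * U y with hWdef
  have h0 : (0 : E3) ∉ tsupport b := by
    rw [b.tsupport_eq, Metric.mem_closedBall, dist_zero_left, norm_coe_sphere]
    change ¬ (1 : ℝ) ≤ 7 / 8
    norm_num
  have hW : ContDiff ℝ 2 W := by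
    rw [contDiff_iff_contDiffAt]
    intro y
    by_cases hy : y = 0
    · subst hy
      refine (contDiffAt_const (c := (0 : ℝ))).congr_of_eventuallyEq ?_
      filter_upwards [(isClosed_tsupport b).isOpen_compl.mem_nhds h0] with z hz
      simp [hWdef, image_eq_zero_of_notMem_tsupport hz]
    · exact (b.contDiffAt (n := 2)).mul ((hU.contDiffAt hy).of_le (by exact_mod_cast le_top))
  have hc : HasCompactSupport W := b.hasCompactSupport.mul_right
  have hWU : ∀ y, dist y (x : E3) < 3 / 4 → W y = U y := fun y hy => by
    simp only [hWdef]
    rw [b.one_of_mem_closedBall (Metric.mem_closedBall.2 hy.le), one_mul]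
  have hWlap : ∀ y, dist y (x : E3) < 1 / 2 → lapF W y = 0 := by
    intro y hy
    have hy0 : y ≠ 0 := by
      rintro rfl
      rw [dist_zero_left, norm_coe_sphere] at hy
      norm_num at hy
    rw [← hlap y hy0]
    refine lapF_congr ?_
    filter_upwards [Metric.ball_mem_nhds y (show (0 : ℝ) < 1 / 4 by norm_num)] with z hz
    exact hWU z (by
      have := dist_triangle z y (x : E3)
      rw [Metric.mem_ball] at hz
      linarith)
  have hmv := mean_value hW hc hWlap hr.le hr2
  have hWx : W x = U x := hWU x (by rw [dist_self]; norm_num)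
  have hWc : Continuous fun y : E3 => W (x + r • y) := hW.continuous.comp (by fun_prop)
  have h1 : 0 ≤ ∫ y, (W (x + r • y) - W x) ^ 2 * avgKer y :=
    integral_nonneg fun y => mul_nonneg (sq_nonneg _) (avgKer_nonneg y)
  have h2 : ∫ y, (W (x + r • y) - W x) ^ 2 * avgKer y
      = (∫ y, W (x + r • y) ^ 2 * avgKer y) - W x ^ 2 * ∫ y, avgKer y := by
    have e : ∀ y, (W (x + r • y) - W x) ^ 2 * avgKer y = W (x + r • y) ^ 2 * avgKer y
        - (2 * W x * (W (x + r • y) * avgKer y) - W x ^ 2 * avgKer y) := fun y => by ring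
    simp only [e]
    rw [integral_sub, integral_sub, integral_const_mul, integral_const_mul, hmv]
    · ring
    · exact (integrable_mul_avgKer hWc).const_mul _
    · exact integrable_mul_avgKer (F := fun _ => W x ^ 2) continuous_const
    · exact integrable_mul_avgKer (hWc.pow 2)
    · exact ((integrable_mul_avgKer hWc).const_mul _).sub
        (integrable_mul_avgKer (F := fun _ => W x ^ 2) continuous_const)
  have hWI : Integrable (fun z => W z ^ 2) := by
    refine (hW.continuous.pow 2).integrable_of_hasCompactSupport ?_
    simp only [sq]; exact hc.mul_left
  set g : E3 → ℝ := (Metric.ball (x : E3) r).indicator fun z => W z ^ 2 with hg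
  have hgI : Integrable g := hWI.indicator Metric.isOpen_ball.measurableSet
  have h3 : ∫ y, W (x + r • y) ^ 2 * avgKer y ≤ ∫ y, g (x + r • y) := by
    refine integral_mono (integrable_mul_avgKer (hWc.pow 2)) ?_ fun y => ?_
    · exact (hgI.comp_add_left (x : E3)).comp_smul hr.ne'
    · change W (x + r • y) ^ 2 * avgKer y ≤ g (x + r • y)
      by_cases hy : ‖y‖ < 1
      · have : (x : E3) + r • y ∈ Metric.ball (x : E3) r := by
          rw [Metric.mem_ball, dist_eq_norm, add_sub_cancel_left, norm_smul,
            Real.norm_of_nonneg hr.le]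
          nlinarith
        rw [hg, Set.indicator_of_mem this]
        nlinarith [avgKer_le_one y, sq_nonneg (W (x + r • y))]
      · rw [avgKer_eq_zero (not_lt.1 hy), mul_zero]
        exact Set.indicator_nonneg (fun z _ => sq_nonneg _) _
  have h4 : ∫ y, g (x + r • y) = (r ^ 3)⁻¹ * ∫ z in Metric.ball (x : E3) r, U z ^ 2 := by
    have := Measure.integral_comp_smul (volume : Measure E3) (fun z => g (x + z)) r
    rw [this, integral_add_left_eq_self g (x : E3), finrank_E3, abs_of_pos (by positivity),
      smul_eq_mul, hg, integral_indicator Metric.isOpen_ball.measurableSet]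
    congr 1
    refine setIntegral_congr_fun Metric.isOpen_ball.measurableSet fun z hz => ?_
    rw [hWU z ((Metric.mem_ball.1 hz).trans (by linarith))]
  rw [h2, hWx] at h1
  linarith [mul_comm (∫ y, avgKer y) (U x ^ 2)]

/-- The closed spherical shell of half-width `r` around the unit sphere. -/
def shell (r : ℝ) : Set E3 := {y | 1 - r ≤ ‖y‖ ∧ ‖y‖ ≤ 1 + r}

lemma isClosed_shell (r : ℝ) : IsClosed (shell r) :=
  (isClosed_le continuous_const continuous_norm).inter
    (isClosed_le continuous_norm continuous_const)

lemma isCompact_shell (r : ℝ) : IsCompact (shell r) :=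
  (isCompact_closedBall (0 : E3) (1 + r)).of_isClosed_subset (isClosed_shell r)
    fun _ hy => mem_closedBall_zero_iff.2 hy.2

lemma ball_subset_shell (x : S2) (r : ℝ) : Metric.ball (x : E3) r ⊆ shell r := by
  intro y hy
  rw [Metric.mem_ball, dist_eq_norm] at hy
  have h1 := abs_norm_sub_norm_le y (x : E3)
  rw [norm_coe_sphere, abs_le] at h1
  exact ⟨by linarith [h1.1], by linarith [h1.2]⟩

lemma integrableOn_shell {F : E3 → ℝ} (hF : ContinuousOn F {0}ᶜ) {r : ℝ} (hr : r < 1) :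
    IntegrableOn F (shell r) :=
  (hF.mono fun y hy h => by
    have h' : y = 0 := h
    have h1 := hy.1
    rw [h', norm_zero] at h1
    linarith).integrableOn_compact (isCompact_shell r)

lemma sum_l2_harm {p : ℕ → TestFun} (hp : ∀ l, p l ∈ harm l) (N : ℕ) :
    l2 (∑ l ∈ Finset.range N, p l) (∑ l ∈ Finset.range N, p l)
      = ∑ l ∈ Finset.range N, l2 (p l) (p l) := by
  change l2B _ _ = _
  simp only [map_sum, LinearMap.sum_apply]
  refine Finset.sum_congr rfl fun l hl => ?_
  rw [Finset.sum_eq_single l]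
  · rfl
  · intro m _ hm
    exact l2_eq_zero_of_harm hm (hp m) (hp l)
  · exact fun h => absurd hl h

lemma setIntegral_shell_mul (k : ℕ) (f g : TestFun) {r : ℝ} (hr1 : r < 1) :
    ∫ y in shell r, ‖y‖ ^ k * (homExt f.1 y * homExt g.1 y)
      = l2 f g * ∫ t in Set.Icc (1 - r) (1 + r), t ^ (k + 2) := by
  have h := integral_polar ((Set.Icc (1 - r) (1 + r)).indicator fun t => t ^ k) (tmul f g).1
  have e1 : ∀ y : E3, (Set.Icc (1 - r) (1 + r)).indicator (fun t => t ^ k) ‖y‖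
      * homExt (tmul f g).1 y
      = (shell r).indicator (fun y => ‖y‖ ^ k * (homExt f.1 y * homExt g.1 y)) y := by
    intro y
    rw [homExt_tmul]
    by_cases hy : y ∈ shell r
    · rw [Set.indicator_of_mem hy, Set.indicator_of_mem (show ‖y‖ ∈ Set.Icc (1 - r) (1 + r) from hy)]
    · rw [Set.indicator_of_notMem hy,
        Set.indicator_of_notMem (show ‖y‖ ∉ Set.Icc (1 - r) (1 + r) from hy), zero_mul]
  simp only [e1] at h
  rw [integral_indicator (isClosed_shell r).measurableSet] at h
  rw [h]
  congr 1
  have e2 : ∀ t : ℝ, t ^ 2 * (Set.Icc (1 - r) (1 + r)).indicator (fun t => t ^ k) t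
      = (Set.Icc (1 - r) (1 + r)).indicator (fun t => t ^ (k + 2)) t := by
    intro t
    by_cases ht : t ∈ Set.Icc (1 - r) (1 + r)
    · rw [Set.indicator_of_mem ht, Set.indicator_of_mem ht]; ring
    · rw [Set.indicator_of_notMem ht, Set.indicator_of_notMem ht, mul_zero]
  simp only [e2]
  rw [setIntegral_indicator measurableSet_Icc, Set.inter_eq_self_of_subset_right]
  exact fun t ht => lt_of_lt_of_le (by linarith) ht.1

lemma shell_inequality {p : ℕ → TestFun} (hp : ∀ l, p l ∈ harm l) {N : ℕ} (hN : 0 < N) :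
    ∫ y in shell (1 / (2 * N)), harmExt p N y ^ 2
      ≤ 3 / N * l2 (∑ l ∈ Finset.range N, p l) (∑ l ∈ Finset.range N, p l) := by
  have hN' : (1 : ℝ) ≤ N := by exact_mod_cast hN
  set r : ℝ := 1 / (2 * N) with hr
  have hr0 : 0 < r := by positivity
  have hr1 : r < 1 := by rw [hr, div_lt_one (by positivity)]; linarith
  have hterm : ∀ l m : ℕ, IntegrableOn
      (fun y => ‖y‖ ^ (l + m) * (homExt (p l).1 y * homExt (p m).1 y)) (shell r) := fun l m =>
    integrableOn_shell ((continuous_norm.pow _).continuousOn.mul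
      ((smoothOff_homExt (p l)).continuousOn.mul (smoothOff_homExt (p m)).continuousOn)) hr1
  have e : ∀ y, harmExt p N y ^ 2 = ∑ l ∈ Finset.range N, ∑ m ∈ Finset.range N,
      ‖y‖ ^ (l + m) * (homExt (p l).1 y * homExt (p m).1 y) := by
    intro y
    rw [sq, harmExt, Finset.sum_mul_sum]
    refine Finset.sum_congr rfl fun l _ => Finset.sum_congr rfl fun m _ => ?_
    rw [zpow_natCast, zpow_natCast, pow_add]; ring
  simp only [e]
  rw [integral_finsetSum _ fun l _ => integrable_finsetSum _ fun m _ => hterm l m,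
    sum_l2_harm hp, Finset.mul_sum]
  refine Finset.sum_le_sum fun l hl => ?_
  rw [integral_finsetSum _ fun m _ => hterm l m, Finset.sum_eq_single l]
  · rw [setIntegral_shell_mul _ _ _ hr1, mul_comm]
    refine mul_le_mul_of_nonneg_right ?_ (l2_self_nonneg _)
    have hb : ∀ t ∈ Set.Icc (1 - r) (1 + r), t ^ (l + l + 2) ≤ 3 := by
      intro t ht
      have ht0 : 0 ≤ t := by linarith [ht.1]
      have hl' := Finset.mem_range.1 hl
      calc t ^ (l + l + 2) ≤ (1 + r) ^ (l + l + 2) := pow_le_pow_left₀ ht0 ht.2 _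
        _ ≤ (1 + r) ^ (2 * N) := pow_le_pow_right₀ (by linarith) (by omega)
        _ ≤ (Real.exp r) ^ (2 * N) := by
            refine pow_le_pow_left₀ (by linarith) ?_ _
            linarith [Real.add_one_le_exp r]
        _ = Real.exp 1 := by
            rw [← Real.exp_nat_mul]
            congr 1
            rw [hr]; push_cast; field_simp
        _ ≤ 3 := by linarith [Real.exp_one_lt_d9]
    have h1 : ∫ t in Set.Icc (1 - r) (1 + r), t ^ (l + l + 2)
        ≤ ∫ t in Set.Icc (1 - r) (1 + r), (3 : ℝ) := by
      refine setIntegral_mono_on ?_ ?_ measurableSet_Icc hb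
      · exact ((continuous_pow _).continuousOn).integrableOn_compact isCompact_Icc
      · exact continuousOn_const.integrableOn_compact isCompact_Icc
    refine h1.trans (le_of_eq ?_)
    rw [setIntegral_const, Real.volume_real_Icc_of_le (by linarith), hr, smul_eq_mul]
    field_simp; norm_num
  · intro m _ hm
    rw [setIntegral_shell_mul _ _ _ hr1, l2_eq_zero_of_harm (Ne.symm hm) (hp l) (hp m), zero_mul]
  · exact fun h => absurd hl h

lemma sup_inequality : ∃ C : ℝ, 0 < C ∧ ∀ (p : ℕ → TestFun), (∀ l, p l ∈ harm l) →
    ∀ N : ℕ, 0 < N → ∀ x : S2, (∑ l ∈ Finset.range N, p l).1 x ^ 2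
      ≤ C * N ^ 2 * l2 (∑ l ∈ Finset.range N, p l) (∑ l ∈ Finset.range N, p l) := by
  have hc := integral_avgKer_pos
  refine ⟨24 / ∫ y, avgKer y, by positivity, fun p hp N hN x => ?_⟩
  have hN' : (1 : ℝ) ≤ N := by exact_mod_cast hN
  have h1 := ball_inequality (smoothOff_harmExt p N) (fun y hy => lapF_harmExt hp N hy) x
    (r := 1 / (2 * N)) (by positivity) (by
      rw [div_le_div_iff₀ (by positivity) (by norm_num)]; linarith)
  have h2 : ∫ z in Metric.ball (x : E3) (1 / (2 * N)), harmExt p N z ^ 2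
      ≤ ∫ y in shell (1 / (2 * N)), harmExt p N y ^ 2 := by
    refine setIntegral_mono_set ?_ (Eventually.of_forall fun z => sq_nonneg _)
      (LE.le.eventuallyLE (ball_subset_shell x _))
    refine integrableOn_shell ((smoothOff_harmExt p N).continuousOn.pow 2) ?_
    rw [div_lt_one (by positivity)]; linarith
  have h3 := h2.trans (shell_inequality hp hN)
  rw [harmExt_coe] at h1
  set S := l2 (∑ l ∈ Finset.range N, p l) (∑ l ∈ Finset.range N, p l)
  have h4 := h1.trans (mul_le_mul_of_nonneg_left h3 (by positivity))
  have e : ((1 / (2 * (N : ℝ))) ^ 3)⁻¹ * (3 / N * S) = 24 * (N ^ 2 * S) := by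
    field_simp; ring
  rw [e] at h4
  rw [div_mul_eq_mul_div, div_mul_eq_mul_div, le_div_iff₀ hc]
  linarith

lemma trace_inequality {γ : ℝ → S2} (hγ : Continuous γ) {a b C : ℝ} (hC : 0 ≤ C)
    (hocc : ∀ (y : E3) (r : ℝ), 0 < r →
      volume {t ∈ Set.Icc a b | dist (γ t : E3) y < r} ≤ ENNReal.ofReal (C * r)) :
    ∃ C' : ℝ, 0 < C' ∧ ∀ (p : ℕ → TestFun), (∀ l, p l ∈ harm l) → ∀ N : ℕ, 0 < N →
      ∫ t in Set.Icc a b, (∑ l ∈ Finset.range N, p l).1 (γ t) ^ 2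
        ≤ C' * N * l2 (∑ l ∈ Finset.range N, p l) (∑ l ∈ Finset.range N, p l) := by
  have hc := integral_avgKer_pos
  set c := ∫ y, avgKer y with hcdef
  refine ⟨(12 * C + 1) / c, by positivity, fun p hp N hN => ?_⟩
  have hN' : (1 : ℝ) ≤ N := by exact_mod_cast hN
  set r : ℝ := 1 / (2 * N) with hr
  have hr0 : 0 < r := by positivity
  have hr1 : r < 1 := by rw [hr, div_lt_one (by positivity)]; linarith
  have hr2 : r ≤ 1 / 2 := by rw [hr, div_le_div_iff₀ (by positivity) (by norm_num)]; linarith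
  set f := ∑ l ∈ Finset.range N, p l with hf
  set S := l2 f f with hS
  have hS0 : 0 ≤ S := l2_self_nonneg f
  have hUc := (smoothOff_harmExt p N).continuousOn.pow 2
  have hUI : IntegrableOn (fun y => harmExt p N y ^ 2) (shell r) := integrableOn_shell hUc hr1
  set ν := (volume : Measure E3).restrict (shell r) with hν
  set h : E3 → ℝ≥0∞ := fun y => ENNReal.ofReal (harmExt p N y ^ 2) with hh
  have hhm : AEMeasurable h ν := hUI.aemeasurable.ennreal_ofReal
  set D : Set (ℝ × E3) := {z | dist (γ z.1 : E3) z.2 < r} with hD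
  have hDm : MeasurableSet D := (isOpen_lt (by fun_prop) continuous_const).measurableSet
  have hpt : ∀ t, ENNReal.ofReal (c * f.1 (γ t) ^ 2) ≤ ENNReal.ofReal ((r ^ 3)⁻¹)
      * ∫⁻ y, D.indicator (fun z => h z.2) (t, y) ∂ν := by
    intro t
    have h1 := ball_inequality (smoothOff_harmExt p N) (fun y hy => lapF_harmExt hp N hy) (γ t)
      hr0 hr2
    rw [harmExt_coe, ← hf, ← hcdef] at h1
    have h2 : ∫⁻ y, D.indicator (fun z => h z.2) (t, y) ∂ν
        = ENNReal.ofReal (∫ z in Metric.ball (γ t : E3) r, harmExt p N z ^ 2) := by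
      have e : ∀ y, D.indicator (fun z => h z.2) (t, y) = (Metric.ball (γ t : E3) r).indicator h y := by
        intro y
        by_cases hy : (t, y) ∈ D
        · rw [Set.indicator_of_mem hy, Set.indicator_of_mem]
          rw [Metric.mem_ball, dist_comm]; exact hy
        · rw [Set.indicator_of_notMem hy, Set.indicator_of_notMem]
          rw [Metric.mem_ball, dist_comm]; exact hy
      simp only [e]
      rw [lintegral_indicator Metric.isOpen_ball.measurableSet, hν,
        Measure.restrict_restrict Metric.isOpen_ball.measurableSet,
        Set.inter_eq_self_of_subset_left (ball_subset_shell _ _),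
        ofReal_integral_eq_lintegral_ofReal (hUI.mono_set (ball_subset_shell _ _))
        (Eventually.of_forall fun z => sq_nonneg _)]
    rw [h2, ← ENNReal.ofReal_mul (by positivity)]
    exact ENNReal.ofReal_le_ofReal h1
  have hfI : IntegrableOn (fun t => c * f.1 (γ t) ^ 2) (Set.Icc a b) :=
    (continuous_const.mul (((continuous_testFun f).comp hγ).pow 2)).continuousOn.integrableOn_compact
      isCompact_Icc
  have hsh := shell_inequality hp hN
  have h3 : ENNReal.ofReal (∫ t in Set.Icc a b, c * f.1 (γ t) ^ 2)
      ≤ ENNReal.ofReal ((r ^ 3)⁻¹ * (C * r * (3 / N * S))) := by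
    rw [ofReal_integral_eq_lintegral_ofReal hfI
      (Eventually.of_forall fun t => mul_nonneg hc.le (sq_nonneg _))]
    calc ∫⁻ t in Set.Icc a b, ENNReal.ofReal (c * f.1 (γ t) ^ 2)
        ≤ ∫⁻ t in Set.Icc a b, ENNReal.ofReal ((r ^ 3)⁻¹)
          * ∫⁻ y, D.indicator (fun z => h z.2) (t, y) ∂ν := lintegral_mono hpt
      _ = ENNReal.ofReal ((r ^ 3)⁻¹) * ∫⁻ t in Set.Icc a b,
          ∫⁻ y, D.indicator (fun z => h z.2) (t, y) ∂ν :=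
        lintegral_const_mul' _ _ ENNReal.ofReal_ne_top
      _ = ENNReal.ofReal ((r ^ 3)⁻¹) * ∫⁻ y, (∫⁻ t in Set.Icc a b,
          D.indicator (fun z => h z.2) (t, y)) ∂ν := by
        rw [lintegral_lintegral_swap]
        exact (AEMeasurable.comp_snd hhm).indicator hDm
      _ ≤ ENNReal.ofReal ((r ^ 3)⁻¹) * ∫⁻ y, ENNReal.ofReal (C * r) * h y ∂ν := by
        gcongr with y
        have e : ∀ t, D.indicator (fun z => h z.2) (t, y)
            = {t | dist (γ t : E3) y < r}.indicator (fun _ => h y) t := fun t => rfl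
        have hm : MeasurableSet {t | dist (γ t : E3) y < r} :=
          (isOpen_lt (by fun_prop) continuous_const).measurableSet
        simp only [e]
        rw [lintegral_indicator hm, setLIntegral_const, Measure.restrict_apply hm, mul_comm]
        gcongr
        rw [Set.inter_comm]
        exact hocc y r hr0
      _ = ENNReal.ofReal ((r ^ 3)⁻¹) * (ENNReal.ofReal (C * r)
          * ENNReal.ofReal (∫ y in shell r, harmExt p N y ^ 2)) := by
        rw [lintegral_const_mul' _ _ ENNReal.ofReal_ne_top,
          ofReal_integral_eq_lintegral_ofReal hUI (Eventually.of_forall fun z => sq_nonneg _)]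
      _ ≤ ENNReal.ofReal ((r ^ 3)⁻¹) * (ENNReal.ofReal (C * r)
          * ENNReal.ofReal (3 / N * S)) := by gcongr
      _ = _ := by
        rw [← ENNReal.ofReal_mul (by positivity), ← ENNReal.ofReal_mul (by positivity)]
  have h4 := (ENNReal.ofReal_le_ofReal_iff (by positivity)).1 h3
  rw [integral_const_mul] at h4
  have e : (r ^ 3)⁻¹ * (C * r * (3 / N * S)) = 12 * C * (N * S) := by
    rw [hr]; field_simp; ring
  rw [e] at h4
  rw [div_mul_eq_mul_div, div_mul_eq_mul_div, le_div_iff₀ hc]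
  nlinarith [mul_nonneg (zero_le_one.trans hN') hS0]

/-! ### An orthonormal basis of spherical harmonics -/

lemma l2_smul_left (c : ℝ) (f g : TestFun) : l2 (c • f) g = c * l2 f g :=
  LinearMap.map_smul₂ l2B c f g

lemma l2_smul_right (c : ℝ) (f g : TestFun) : l2 f (c • g) = c * l2 f g :=
  (l2B f).map_smul c g

lemma l2_add_left (f g h : TestFun) : l2 (f + g) h = l2 f h + l2 g h :=
  LinearMap.map_add₂ l2B f g h

lemma l2_sub_left (f g h : TestFun) : l2 (f - g) h = l2 f h - l2 g h :=
  LinearMap.map_sub₂ l2B f g h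

lemma l2_sum_left {ι : Type*} (s : Finset ι) (f : ι → TestFun) (g : TestFun) :
    l2 (∑ i ∈ s, f i) g = ∑ i ∈ s, l2 (f i) g :=
  LinearMap.map_sum₂ l2B s f g

lemma l2_sum_right {ι : Type*} (s : Finset ι) (f : ι → TestFun) (g : TestFun) :
    l2 g (∑ i ∈ s, f i) = ∑ i ∈ s, l2 g (f i) :=
  map_sum (l2B g) f s

/-- A finite combination of spherical harmonics, grouped by degree. -/
lemma exists_grouped {ι : Type*} [DecidableEq ι] (s : Finset ι) (deg : ι → ℕ) (f : ι → TestFun)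
    (hf : ∀ i ∈ s, f i ∈ harm (deg i)) {N : ℕ} (hN : ∀ i ∈ s, deg i < N) :
    ∃ p : ℕ → TestFun, (∀ l, p l ∈ harm l) ∧ ∑ l ∈ Finset.range N, p l = ∑ i ∈ s, f i := by
  refine ⟨fun l => ∑ i ∈ s with deg i = l, f i, fun l => ?_, ?_⟩
  · refine Submodule.sum_mem _ fun i hi => ?_
    obtain ⟨h1, h2⟩ := Finset.mem_filter.1 hi
    exact h2 ▸ hf i h1
  · exact Finset.sum_fiberwise_of_maps_to (fun i hi => Finset.mem_range.2 (hN i hi)) f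

lemma card_le_of_orthonormal : ∃ C : ℝ, 0 < C ∧ ∀ {ι : Type} [DecidableEq ι] (s : Finset ι)
    (deg : ι → ℕ) (f : ι → TestFun) (_ : ∀ i ∈ s, f i ∈ harm (deg i))
    (_ : ∀ i ∈ s, ∀ j ∈ s, l2 (f i) (f j) = if i = j then 1 else 0) (N : ℕ) (_ : 0 < N)
    (_ : ∀ i ∈ s, deg i < N), (s.card : ℝ) ≤ C * N ^ 2 := by
  obtain ⟨C, hC, h⟩ := sup_inequality
  refine ⟨C * (surf.real Set.univ + 1), by positivity, fun s deg f hf ho N hN hd => ?_⟩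
  have key : ∀ x : S2, ∑ i ∈ s, (f i).1 x ^ 2 ≤ C * N ^ 2 := by
    intro x
    set g : TestFun := ∑ i ∈ s, (f i).1 x • f i with hg
    obtain ⟨p, hp, he⟩ := exists_grouped s deg (fun i => (f i).1 x • f i)
      (fun i hi => Submodule.smul_mem _ _ (hf i hi)) hd
    have h1 := h p hp N hN x
    rw [he, ← hg] at h1
    have h2 : g.1 x = ∑ i ∈ s, (f i).1 x ^ 2 := by
      rw [hg, val_sum]
      exact Finset.sum_congr rfl fun i _ => (sq _).symm
    have h3 : l2 g g = ∑ i ∈ s, (f i).1 x ^ 2 := by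
      rw [hg, l2_sum_left]
      refine Finset.sum_congr rfl fun i hi => ?_
      rw [l2_sum_right, Finset.sum_eq_single i]
      · rw [l2_smul_left, l2_smul_right, ho i hi i hi, if_pos rfl]; ring
      · intro j hj hij
        rw [l2_smul_left, l2_smul_right, ho i hi j hj, if_neg hij.symm]; ring
      · exact fun h => absurd hi h
    rw [h2, h3] at h1
    set S := ∑ i ∈ s, (f i).1 x ^ 2
    have hS : 0 ≤ S := Finset.sum_nonneg fun i _ => sq_nonneg _
    rcases hS.eq_or_lt with h0 | h0
    · rw [← h0]; positivity
    · nlinarith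
  have hI : ∫ x, ∑ i ∈ s, (f i).1 x ^ 2 ∂surf = s.card := by
    have e : ∀ x, ∑ i ∈ s, (f i).1 x ^ 2 = ∑ i ∈ s, (f i).1 x * (f i).1 x := fun x =>
      Finset.sum_congr rfl fun i _ => sq _
    simp only [e]
    rw [integral_finsetSum _ fun i _ => integrable_tmul _ _, Finset.cast_card]
    refine Finset.sum_congr rfl fun i hi => ?_
    exact (ho i hi i hi).trans (if_pos rfl)
  rw [← hI]
  have hcont : Continuous fun x : S2 => ∑ i ∈ s, (f i).1 x ^ 2 :=
    continuous_finsetSum _ fun i _ => (continuous_testFun (f i)).pow 2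
  refine (integral_mono (integrable_continuous hcont) (integrable_const (C * (N : ℝ) ^ 2)) key).trans ?_
  rw [integral_const, smul_eq_mul]
  have : 0 ≤ C * (N : ℝ) ^ 2 := by positivity
  nlinarith

/-- The spherical harmonics of a given degree as a subspace of `L²`. -/
def harmH (l : ℕ) : Submodule ℝ (Lp ℝ 2 surf) := (harm l).map toH

instance (l : ℕ) : FiniteDimensional ℝ (harmH l) := by
  obtain ⟨C, hC, h⟩ := card_le_of_orthonormal
  obtain ⟨n, hn⟩ := exists_nat_ge (C * ((l + 1 : ℕ) : ℝ) ^ 2)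
  have hr : Module.rank ℝ (harmH l) ≤ n := by
    refine rank_le fun s hs => ?_
    set W : Submodule ℝ (harmH l) := Submodule.span ℝ (s : Set (harmH l)) with hW
    have hcard : Module.finrank ℝ W = s.card := by
      have := finrank_span_eq_card hs
      rw [Subtype.range_coe_subtype, Fintype.card_coe] at this
      exact this
    have hWf : FiniteDimensional ℝ W := FiniteDimensional.span_finset ℝ s
    set b := stdOrthonormalBasis ℝ W with hb
    have hex : ∀ i, ∃ f ∈ harm l, toH f = ((b i : harmH l) : Lp ℝ 2 surf) := fun i =>
      (b i : harmH l).2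
    choose f hf hfb using hex
    have := h (Finset.univ : Finset (Fin (Module.finrank ℝ W))) (fun _ => l) f (fun i _ => hf i)
      (fun i _ j _ => by
        rw [← inner_toH, hfb, hfb]
        exact orthonormal_iff_ite.1 b.orthonormal i j) (l + 1) (Nat.succ_pos l)
      (fun _ _ => Nat.lt_succ_self l)
    rw [Finset.card_univ, Fintype.card_fin, hcard] at this
    exact_mod_cast this.trans hn
  exact Module.rank_lt_aleph0_iff.1 (hr.trans_lt (Cardinal.natCast_lt_aleph0))

/-- The index set of the basis of spherical harmonics: degree and order. -/
abbrev Idx : Type := Σ l : ℕ, Fin (Module.finrank ℝ (harmH l))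

lemma exists_sh (i : Idx) : ∃ f ∈ harm i.1, toH f
    = ((stdOrthonormalBasis ℝ (harmH i.1) i.2 : harmH i.1) : Lp ℝ 2 surf) :=
  (stdOrthonormalBasis ℝ (harmH i.1) i.2 : harmH i.1).2

/-- The orthonormal spherical harmonics. -/
def sh (i : Idx) : TestFun := (exists_sh i).choose

lemma sh_mem (i : Idx) : sh i ∈ harm i.1 := (exists_sh i).choose_spec.1

lemma toH_sh (i : Idx) : toH (sh i)
    = ((stdOrthonormalBasis ℝ (harmH i.1) i.2 : harmH i.1) : Lp ℝ 2 surf) :=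
  (exists_sh i).choose_spec.2

lemma l2_sh (i j : Idx) : l2 (sh i) (sh j) = if i = j then 1 else 0 := by
  obtain ⟨l, i⟩ := i
  obtain ⟨m, j⟩ := j
  by_cases hlm : l = m
  · subst hlm
    rw [← inner_toH, toH_sh, toH_sh]
    refine (orthonormal_iff_ite.1 (stdOrthonormalBasis ℝ (harmH l)).orthonormal i j).trans ?_
    simp
  · rw [l2_eq_zero_of_harm hlm (sh_mem ⟨l, i⟩) (sh_mem ⟨m, j⟩), if_neg]
    intro h
    exact hlm (congrArg Sigma.fst h)

lemma orthonormal_sh : Orthonormal ℝ fun i => toH (sh i) :=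
  orthonormal_iff_ite.2 fun i j => by rw [inner_toH, l2_sh]

/-- The Hilbert basis of spherical harmonics. -/
def shBasis : HilbertBasis Idx ℝ (Lp ℝ 2 surf) :=
  HilbertBasis.mk orthonormal_sh (by
    refine (dense_harm (Submodule.isClosed_topologicalClosure _) fun l f hf => ?_).ge
    have h1 : (⟨toH f, ⟨f, hf, rfl⟩⟩ : harmH l)
        = ∑ j, ⟪stdOrthonormalBasis ℝ (harmH l) j, (⟨toH f, ⟨f, hf, rfl⟩⟩ : harmH l)⟫
          • stdOrthonormalBasis ℝ (harmH l) j :=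
      ((stdOrthonormalBasis ℝ (harmH l)).sum_repr' _).symm
    have h2 := congrArg (fun u : harmH l => (u : Lp ℝ 2 surf)) h1
    simp only [AddSubmonoidClass.coe_finsetSum, Submodule.coe_smul] at h2
    rw [h2]
    refine Submodule.le_topologicalClosure _ (Submodule.sum_mem _ fun j _ =>
      Submodule.smul_mem _ _ (Submodule.subset_span ⟨⟨l, j⟩, toH_sh ⟨l, j⟩⟩)))

lemma shBasis_apply (i : Idx) : shBasis i = toH (sh i) := by
  rw [shBasis, HilbertBasis.coe_mk]

lemma hasSum_l2 (f g : TestFun) : HasSum (fun i => l2 f (sh i) * l2 g (sh i)) (l2 f g) := by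
  have h := shBasis.hasSum_inner_mul_inner (toH f) (toH g)
  have e : (fun i => ⟪toH f, shBasis i⟫ * ⟪shBasis i, toH g⟫)
      = fun i => l2 f (sh i) * l2 g (sh i) := by
    funext i
    rw [shBasis_apply, inner_toH, inner_toH, l2_comm g]
  rw [e, inner_toH] at h
  exact h

lemma eq_of_coeff {f g : TestFun} (h : ∀ i, l2 f (sh i) = l2 g (sh i)) : f = g := by
  have h1 := hasSum_l2 (f - g) (f - g)
  have h2 : ∀ i, l2 (f - g) (sh i) = 0 := fun i => by rw [l2_sub_left, h, sub_self]
  simp only [h2, mul_zero] at h1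
  exact sub_eq_zero.1 (l2_self_eq_zero (h1.unique hasSum_zero))

lemma coeff_lap (f : TestFun) (i : Idx) :
    l2 (lap f) (sh i) = -((i.1 : ℝ) * (i.1 + 1)) * l2 f (sh i) := by
  rw [l2_lap_comm, mem_harm.1 (sh_mem i), l2_smul_right]

lemma sum_coeff_sq_le (s : Finset Idx) (f : TestFun) : ∑ i ∈ s, l2 f (sh i) ^ 2 ≤ l2 f f := by
  have h := hasSum_l2 f f
  simp only [← sq] at h
  exact sum_le_hasSum s (fun i _ => sq_nonneg _) h

/-- The projection to the spherical harmonics of a given degree. -/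
def projL (l : ℕ) : TestFun →ₗ[ℝ] TestFun where
  toFun f := ∑ j, l2 f (sh ⟨l, j⟩) • sh ⟨l, j⟩
  map_add' f g := by
    simp only [l2_add_left, add_smul, Finset.sum_add_distrib]
  map_smul' c f := by
    simp only [l2_smul_left, mul_smul, Finset.smul_sum, RingHom.id_apply]

lemma projL_apply (l : ℕ) (f : TestFun) :
    projL l f = ∑ j, l2 f (sh ⟨l, j⟩) • sh ⟨l, j⟩ := rfl

lemma projL_mem (l : ℕ) (f : TestFun) : projL l f ∈ harm l := by
  rw [projL_apply]
  exact Submodule.sum_mem _ fun j _ => Submodule.smul_mem _ _ (sh_mem ⟨l, j⟩)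

lemma coeff_projL (l : ℕ) (f : TestFun) (i : Idx) :
    l2 (projL l f) (sh i) = if i.1 = l then l2 f (sh i) else 0 := by
  rw [projL_apply, l2_sum_left]
  obtain ⟨m, k⟩ := i
  by_cases h : m = l
  · subst h
    rw [if_pos rfl, Finset.sum_eq_single k]
    · rw [l2_smul_left, l2_sh, if_pos rfl, mul_one]
    · intro j _ hj
      rw [l2_smul_left, l2_sh, if_neg, mul_zero]
      simpa [Sigma.mk.inj_iff] using hj
    · exact fun h => absurd (Finset.mem_univ _) h
  · rw [if_neg h]
    refine Finset.sum_eq_zero fun j _ => ?_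
    rw [l2_smul_left, l2_sh, if_neg, mul_zero]
    intro h'
    exact h (congrArg Sigma.fst h').symm

lemma l2_projL_self (l : ℕ) (f : TestFun) :
    l2 (projL l f) (projL l f) = ∑ j, l2 f (sh ⟨l, j⟩) ^ 2 := by
  have h : l2 (projL l f) (projL l f) = l2 (∑ j, l2 f (sh ⟨l, j⟩) • sh ⟨l, j⟩) (projL l f) := rfl
  rw [h, l2_sum_left]
  refine Finset.sum_congr rfl fun j _ => ?_
  rw [l2_smul_left, l2_comm (sh ⟨l, j⟩) (projL l f), coeff_projL, if_pos rfl, sq]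

lemma coeff_iterate_lap (k : ℕ) (f : TestFun) (i : Idx) :
    l2 ((lap^[k]) f) (sh i) = (-((i.1 : ℝ) * (i.1 + 1))) ^ k * l2 f (sh i) := by
  induction k with
  | zero => simp
  | succ k ih => rw [Function.iterate_succ_apply', coeff_lap, ih, pow_succ]; ring

/-! ### Rapidly decreasing sums of spherical harmonics -/

/-- A sequence of spherical harmonics whose norms decrease faster than any power. -/
structure Rapid (a : ℕ → TestFun) : Prop where
  mem : ∀ l, a l ∈ harm l
  decay : ∀ k : ℕ, ∃ C : ℝ, ∀ l : ℕ, ((l : ℝ) + 1) ^ k * l2 (a l) (a l) ≤ C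

lemma Rapid.ang {a : ℕ → TestFun} (ha : Rapid a) (i : Fin 3) :
    Rapid (fun l => SphereEuler.ang i (a l)) where
  mem l := ang_mem_harm (ha.mem l) i
  decay k := by
    obtain ⟨C, hC⟩ := ha.decay (k + 2)
    refine ⟨C, fun l => le_trans ?_ (hC l)⟩
    have h1 : l2 (SphereEuler.ang i (a l)) (SphereEuler.ang i (a l)) ≤ ((l : ℝ) * (l + 1)) * l2 (a l) (a l) := by
      have h2 : l2 (a l) (lap (a l)) = -((l : ℝ) * (l + 1)) * l2 (a l) (a l) := by
        rw [mem_harm.1 (ha.mem l), l2_smul_right]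
      have h3 : vl2 (perpGrad (a l)) (perpGrad (a l))
          = ∑ j, l2 (SphereEuler.ang j (a l)) (SphereEuler.ang j (a l)) := vl2_eq _ _
      rw [vl2_perpGrad_perpGrad, h2] at h3
      have h4 := Finset.single_le_sum (f := fun j => l2 (SphereEuler.ang j (a l)) (SphereEuler.ang j (a l)))
        (fun j _ => l2_self_nonneg _) (Finset.mem_univ i)
      linarith
    have hl : (0 : ℝ) ≤ l := by positivity
    have h5 : ((l : ℝ) * (l + 1)) * l2 (a l) (a l) ≤ ((l : ℝ) + 1) ^ 2 * l2 (a l) (a l) :=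
      mul_le_mul_of_nonneg_right (by nlinarith) (l2_self_nonneg _)
    rw [pow_add, mul_assoc]
    exact mul_le_mul_of_nonneg_left (h1.trans h5) (by positivity)

lemma rapid_projL (f : TestFun) : Rapid (fun l => projL l f) where
  mem l := projL_mem l f
  decay k := by
    refine ⟨l2 f f + l2 ((lap^[k]) f) ((lap^[k]) f), fun l => ?_⟩
    rw [l2_projL_self]
    have hle : ∀ g : TestFun, ∑ j, l2 g (sh ⟨l, j⟩) ^ 2 ≤ l2 g g := fun g => by
      have := sum_coeff_sq_le (Finset.univ.map ⟨fun j => (⟨l, j⟩ : Idx), fun a b h => by simpa using h⟩) g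
      rwa [Finset.sum_map] at this
    rcases Nat.eq_zero_or_pos l with rfl | hl
    · have := hle f
      have h2 := l2_self_nonneg ((lap^[k]) f)
      simp only [Nat.cast_zero, zero_add, one_pow, one_mul]
      linarith
    · have h1 := hle ((lap^[k]) f)
      simp only [coeff_iterate_lap, mul_pow] at h1
      rw [← Finset.mul_sum] at h1
      have hl' : (1 : ℝ) ≤ l := by exact_mod_cast hl
      have h2 : ((l : ℝ) + 1) ^ k ≤ ((-((l : ℝ) * (l + 1))) ^ k) ^ 2 := by
        rw [← pow_mul, mul_comm k 2, pow_mul, neg_sq]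
        refine pow_le_pow_left₀ (by positivity) ?_ _
        nlinarith [mul_pos (zero_lt_one.trans_le hl') (zero_lt_one.trans_le hl')]
      have h3 := mul_le_mul_of_nonneg_right h2
        (Finset.sum_nonneg (s := Finset.univ) fun (j : Fin (Module.finrank ℝ (harmH l))) _ =>
          sq_nonneg (l2 f (sh ⟨l, j⟩)))
      have h4 := l2_self_nonneg f
      linarith

lemma summable_inv_succ_sq : Summable fun l : ℕ => (((l : ℝ) + 1) ^ 2)⁻¹ := by
  have h := (summable_nat_add_iff (f := fun n : ℕ => ((n : ℝ) ^ 2)⁻¹) 1).2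
    (Real.summable_nat_pow_inv.2 one_lt_two)
  simpa using h

lemma Rapid.exists_bound {a : ℕ → TestFun} (ha : Rapid a) :
    ∃ u : ℕ → ℝ, Summable u ∧ ∀ l x, |(a l).1 x| ≤ u l := by
  obtain ⟨C, hC, h⟩ := sup_inequality
  obtain ⟨D, hD⟩ := ha.decay 6
  refine ⟨fun l => Real.sqrt (C * D) * (((l : ℝ) + 1) ^ 2)⁻¹, summable_inv_succ_sq.mul_left _,
    fun l x => ?_⟩
  have hl : (0 : ℝ) < (l : ℝ) + 1 := by positivity
  have h1 := h (Pi.single l (a l)) (fun m => by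
    by_cases hm : m = l
    · subst hm; rw [Pi.single_eq_same]; exact ha.mem m
    · rw [Pi.single_eq_of_ne hm]; exact zero_mem _) (l + 1) (Nat.succ_pos l) x
  have h2 : ∑ m ∈ Finset.range (l + 1), (Pi.single l (a l) : ℕ → TestFun) m = a l := by
    rw [Finset.sum_eq_single l]
    · rw [Pi.single_eq_same]
    · exact fun m _ hm => Pi.single_eq_of_ne hm _
    · exact fun h => absurd (Finset.mem_range.2 (Nat.lt_succ_self l)) h
  rw [h2] at h1
  push_cast at h1
  have h3 : (a l).1 x ^ 2 * ((l : ℝ) + 1) ^ 4 ≤ C * D := by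
    have h4 := mul_le_mul_of_nonneg_right h1 (by positivity : (0 : ℝ) ≤ ((l : ℝ) + 1) ^ 4)
    have h5 := mul_le_mul_of_nonneg_left (hD l) hC.le
    nlinarith
  change |(a l).1 x| ≤ Real.sqrt (C * D) * (((l : ℝ) + 1) ^ 2)⁻¹
  rw [← div_eq_mul_inv, le_div_iff₀ (by positivity)]
  refine Real.le_sqrt_of_sq_le ?_
  rw [mul_pow, sq_abs]
  refine le_trans (le_of_eq ?_) h3
  ring

/-- The pointwise sum of a sequence of test functions. -/
def seriesSum (a : ℕ → TestFun) (x : S2) : ℝ := ∑' l, (a l).1 x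

lemma pd_eq_ang (f : TestFun) (j : Fin 3) {y : E3} (hy : y ≠ 0) :
    pd j (homExt f.1) y = (‖y‖ ^ 2)⁻¹ * (homExt (ang (j + 1) f).1 y * y (j + 2)
      - homExt (ang (j + 2) f).1 y * y (j + 1)) := by
  have hn : ‖y‖ ^ 2 ≠ 0 := pow_ne_zero _ (norm_ne_zero_iff.2 hy)
  have he := (rayConst_homExt f.1).euler (smoothOff_homExt f) hy
  rw [homExt_ang _ _ hy, homExt_ang _ _ hy, eq_inv_mul_iff_mul_eq₀ hn, ← sum_sq_coord]
  unfold angF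
  fin_cases j <;> simp
  · linear_combination y 0 * he
  · linear_combination y 1 * he
  · linear_combination y 2 * he

lemma abs_homExt_le {f : TestFun} {u : ℝ} (h : ∀ x, |f.1 x| ≤ u) {y : E3} (hy : y ≠ 0) :
    |homExt f.1 y| ≤ u := by
  rw [homExt_of_ne _ hy]; exact h _

lemma abs_pd_le {f : TestFun} {u : ℝ} (h : ∀ i x, |(ang i f).1 x| ≤ u) (j : Fin 3) {y : E3}
    (hy : y ≠ 0) : |pd j (homExt f.1) y| ≤ 2 * ‖y‖⁻¹ * u := by
  have hn : 0 < ‖y‖ := norm_pos_iff.2 hy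
  have hc : ∀ k, |y k| ≤ ‖y‖ := fun k => by
    simpa using PiLp.norm_apply_le y k
  rw [pd_eq_ang f j hy, abs_mul, abs_of_pos (by positivity)]
  have h1 : |homExt (ang (j + 1) f).1 y * y (j + 2) - homExt (ang (j + 2) f).1 y * y (j + 1)|
      ≤ u * ‖y‖ + u * ‖y‖ := by
    refine (abs_sub _ _).trans (add_le_add ?_ ?_) <;> rw [abs_mul] <;>
      exact mul_le_mul (abs_homExt_le (h _) hy) (hc _) (abs_nonneg _)
        ((abs_nonneg _).trans (abs_homExt_le (h 0) hy))
  refine (mul_le_mul_of_nonneg_left h1 (by positivity)).trans (le_of_eq ?_)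
  field_simp; ring

lemma Rapid.hasFDerivAt {a : ℕ → TestFun} (ha : Rapid a) {y : E3} (hy : y ≠ 0) :
    HasFDerivAt (homExt (seriesSum a))
      (∑ j : Fin 3, ((‖y‖ ^ 2)⁻¹ * (homExt (seriesSum fun l => SphereEuler.ang (j + 1) (a l)) y * y (j + 2)
      - homExt (seriesSum fun l => SphereEuler.ang (j + 2) (a l)) y * y (j + 1))) •
        (EuclideanSpace.proj (𝕜 := ℝ) j : E3 →L[ℝ] ℝ)) y := by
  obtain ⟨u, hu, hub⟩ := ha.exists_bound
  have hex : ∀ i : Fin 3, ∃ v : ℕ → ℝ, Summable v ∧ ∀ l x, |(SphereEuler.ang i (a l)).1 x| ≤ v l := fun i =>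
    (ha.ang i).exists_bound
  choose v hv hvb using hex
  have hn : 0 < ‖y‖ := norm_pos_iff.2 hy
  set w : ℕ → ℝ := fun l => 3 * (2 * (‖y‖ / 2)⁻¹ * ∑ i, v i l) with hw
  have hv0 : ∀ i l, 0 ≤ v i l := fun i l => (abs_nonneg _).trans (hvb i l (radial y hy))
  have hws : Summable w :=
    ((summable_sum fun i _ => hv i).mul_left _).mul_left _
  set s : Set E3 := Metric.ball y (‖y‖ / 2)
  have hs : ∀ z ∈ s, z ≠ 0 ∧ ‖y‖ / 2 ≤ ‖z‖ := by
    intro z hz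
    rw [Metric.mem_ball, dist_eq_norm, norm_sub_rev] at hz
    have h1 := norm_sub_norm_le y z
    have h2 : ‖y‖ / 2 ≤ ‖z‖ := by linarith
    exact ⟨norm_pos_iff.1 (by linarith), h2⟩
  have hd : ∀ l z, z ∈ s → HasFDerivAt (homExt (a l).1) (fderiv ℝ (homExt (a l).1) z) z :=
    fun l z hz => ((smoothOff_homExt (a l)).differentiableAt (hs z hz).1).hasFDerivAt
  have hb : ∀ l z, z ∈ s → ‖fderiv ℝ (homExt (a l).1) z‖ ≤ w l := by
    intro l z hz
    obtain ⟨hz0, hz1⟩ := hs z hz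
    have hzn : 0 < ‖z‖ := norm_pos_iff.2 hz0
    have hsum0 : 0 ≤ ∑ i, v i l := Finset.sum_nonneg fun i _ => hv0 i l
    refine ContinuousLinearMap.opNorm_le_bound _ (by positivity) fun x => ?_
    rw [fderiv_eq_sum_pd]
    have h1 : ∀ j : Fin 3, |x j * pd j (homExt (a l).1) z|
        ≤ ‖x‖ * (2 * (‖y‖ / 2)⁻¹ * ∑ i, v i l) := by
      intro j
      rw [abs_mul]
      refine mul_le_mul (by simpa using PiLp.norm_apply_le x j) ?_ (abs_nonneg _) (norm_nonneg _)
      refine (abs_pd_le (u := ∑ i, v i l) (fun i x => (hvb i l x).trans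
        (Finset.single_le_sum (f := fun i => v i l) (fun i _ => hv0 i l) (Finset.mem_univ i)))
        j hz0).trans ?_
      refine mul_le_mul_of_nonneg_right ?_ hsum0
      refine mul_le_mul_of_nonneg_left ?_ zero_le_two
      exact inv_anti₀ (by positivity) hz1
    rw [Real.norm_eq_abs]
    refine (Finset.abs_sum_le_sum_abs _ _).trans ((Finset.sum_le_sum fun j _ => h1 j).trans ?_)
    rw [Finset.sum_const, Finset.card_univ, Fintype.card_fin, hw]
    simp only [nsmul_eq_mul]
    push_cast
    exact le_of_eq (by ring)
  have hsumm : ∀ (b : ℕ → TestFun), Rapid b → ∀ z, z ≠ 0 → Summable fun l => homExt (b l).1 z := by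
    intro b hb z hz
    obtain ⟨u, hu, hub⟩ := hb.exists_bound
    refine Summable.of_norm_bounded hu fun l => ?_
    rw [Real.norm_eq_abs]
    exact abs_homExt_le (hub l) hz
  have hy' : y ∈ s := Metric.mem_ball_self (by positivity)
  have main := hasFDerivAt_tsum_of_isPreconnected hws Metric.isOpen_ball
    (convex_ball y (‖y‖ / 2)).isPreconnected hd hb hy' (hsumm a ha y hy) hy'
  have heq : ∀ b : ℕ → TestFun, ∀ z, z ≠ 0 → ∑' l, homExt (b l).1 z = homExt (seriesSum b) z := by
    intro b z hz
    simp only [homExt_of_ne _ hz, seriesSum]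
  have main2 : HasFDerivAt (homExt (seriesSum a)) (∑' l, fderiv ℝ (homExt (a l).1) y) y := by
    refine main.congr_of_eventuallyEq ?_
    filter_upwards [isOpen_punctured.mem_nhds hy] with z hz
    exact (heq a z hz).symm
  refine main2.congr_fderiv ?_
  have hfs : Summable fun l => fderiv ℝ (homExt (a l).1) y :=
    Summable.of_norm_bounded hws fun l => hb l y hy'
  ext x
  have h1 := (ContinuousLinearMap.apply ℝ ℝ x).hasSum hfs.hasSum
  simp only [ContinuousLinearMap.apply_apply] at h1
  refine h1.unique ?_
  have e1 : ∀ (φ : Fin 3 → ℝ), (∑ j, φ j • (EuclideanSpace.proj (𝕜 := ℝ) j : E3 →L[ℝ] ℝ)) x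
      = ∑ j, x j * φ j := fun φ => by
    rw [sum_apply]
    exact Finset.sum_congr rfl fun j _ => mul_comm _ _
  rw [e1]
  simp only [fderiv_eq_sum_pd]
  refine hasSum_sum fun j _ => ?_
  simp only [pd_eq_ang _ j hy]
  rw [← heq _ y hy, ← heq _ y hy]
  refine HasSum.mul_left _ (HasSum.mul_left _ (HasSum.sub ?_ ?_))
  · exact (hsumm _ (ha.ang (j + 1)) y hy).hasSum.mul_right _
  · exact (hsumm _ (ha.ang (j + 2)) y hy).hasSum.mul_right _

lemma Rapid.contDiffOn (n : ℕ) : ∀ {a : ℕ → TestFun}, Rapid a →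
    ContDiffOn ℝ n (homExt (seriesSum a)) {0}ᶜ := by
  induction n with
  | zero =>
    intro a ha
    rw [Nat.cast_zero, contDiffOn_zero]
    exact fun y hy => (ha.hasFDerivAt hy).continuousAt.continuousWithinAt
  | succ n ih =>
    intro a ha
    push_cast
    rw [contDiffOn_succ_iff_fderiv_of_isOpen isOpen_punctured]
    refine ⟨fun y hy => (ha.hasFDerivAt hy).differentiableAt.differentiableWithinAt, by simp, ?_⟩
    have h : ContDiffOn ℝ n (fun y : E3 =>
      ∑ j : Fin 3, ((‖y‖ ^ 2)⁻¹ * (homExt (seriesSum fun l => SphereEuler.ang (j + 1) (a l)) y * y (j + 2)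
      - homExt (seriesSum fun l => SphereEuler.ang (j + 2) (a l)) y * y (j + 1))) •
        (EuclideanSpace.proj (𝕜 := ℝ) j : E3 →L[ℝ] ℝ)) {0}ᶜ := by
      have hc : ∀ k : Fin 3, ContDiffOn ℝ n (fun y : E3 => y k) {0}ᶜ := fun k =>
        (smoothOff_coord k).of_le (by exact_mod_cast le_top)
      refine ContDiffOn.sum fun j _ => ?_
      have h1 : ContDiffOn ℝ n (fun y : E3 => (‖y‖ ^ 2)⁻¹) {0}ᶜ :=
        ((contDiff_norm_sq ℝ).contDiffOn).inv fun y hy => pow_ne_zero _ (norm_ne_zero_iff.2 hy)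
      exact (h1.mul (((ih (ha.ang _)).mul (hc _)).sub ((ih (ha.ang _)).mul (hc _)))).smul
        contDiffOn_const
    exact h.congr fun y hy => (ha.hasFDerivAt hy).fderiv

/-- The sum of a rapidly decreasing sequence of spherical harmonics as a test function. -/
def Rapid.toTestFun {a : ℕ → TestFun} (ha : Rapid a) : TestFun :=
  ⟨seriesSum a, contDiffOn_infty.2 fun n => Rapid.contDiffOn n ha⟩

lemma Rapid.summable {a : ℕ → TestFun} (ha : Rapid a) (x : S2) : Summable fun l => (a l).1 x := by
  obtain ⟨u, hu, hub⟩ := ha.exists_bound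
  exact Summable.of_norm_bounded hu fun l => hub l x

lemma Rapid.hasSum_l2 {a : ℕ → TestFun} (ha : Rapid a) (g : TestFun) :
    HasSum (fun l => l2 (a l) g) (l2 ha.toTestFun g) := by
  obtain ⟨u, hu, hub⟩ := ha.exists_bound
  have hI : Integrable (fun x => |g.1 x|) surf :=
    integrable_continuous (continuous_testFun g).abs
  have hb : ∀ l, ∫ x, ‖(a l).1 x * g.1 x‖ ∂surf ≤ u l * ∫ x, |g.1 x| ∂surf := fun l => by
    rw [← integral_const_mul]
    refine integral_mono (integrable_tmul (a l) g).norm (hI.const_mul _) fun x => ?_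
    simp only [norm_mul, Real.norm_eq_abs]
    exact mul_le_mul_of_nonneg_right (hub l x) (abs_nonneg _)
  have h := hasSum_integral_of_summable_integral_norm (μ := surf)
    (F := fun l x => (a l).1 x * g.1 x) (fun l => integrable_tmul (a l) g)
    (Summable.of_nonneg_of_le (fun l => integral_nonneg fun x => norm_nonneg _) hb
      (hu.mul_right _))
  have e : l2 ha.toTestFun g = ∫ x, ∑' l, (a l).1 x * g.1 x ∂surf :=
    integral_congr_ae (Eventually.of_forall fun x => (tsum_mul_right).symm)
  rw [e]
  exact h

lemma rapid_projL_toTestFun (f : TestFun) : (rapid_projL f).toTestFun = f := by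
  refine eq_of_coeff fun i => ?_
  refine ((rapid_projL f).hasSum_l2 (sh i)).unique ?_
  simp only [coeff_projL]
  have h := hasSum_ite_eq i.1 (l2 f (sh i))
  simpa only [eq_comm] using h

/-! ### The inverse Laplacian and the Hodge decomposition -/

/-- The eigenvalue of `-Δ` of a basis element. -/
def eigval (i : Idx) : ℝ := (i.1 : ℝ) * (i.1 + 1)

lemma harm_zero_eq_tconst {f : TestFun} (hf : f ∈ harm 0) : ∃ c, f = tconst c := by
  refine eq_tconst_of_grad_eq_zero (grad_eq_zero_of_lap_eq_zero ?_)
  rw [mem_harm.1 hf, Nat.cast_zero, zero_mul]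
  module

lemma l2_tconst (f : TestFun) (c : ℝ) : l2 f (tconst c) = c * ∫ x, f.1 x ∂surf := by
  rw [← integral_const_mul]
  exact integral_congr_ae (Eventually.of_forall fun x => mul_comm _ _)

lemma coeff_eq_zero_of_integral {f : TestFun} (hf : ∫ x, f.1 x ∂surf = 0) {i : Idx}
    (hi : i.1 = 0) : l2 f (sh i) = 0 := by
  obtain ⟨c, hc⟩ := harm_zero_eq_tconst (hi ▸ sh_mem i)
  rw [hc, l2_tconst, hf, mul_zero]

lemma tconst_mem_harm (c : ℝ) : tconst c ∈ harm 0 := by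
  rw [mem_harm, lap_tconst, Nat.cast_zero, zero_mul]
  module

lemma integral_eq_zero_of_coeff {f : TestFun} (h : ∀ i : Idx, i.1 = 0 → l2 f (sh i) = 0) :
    ∫ x, f.1 x ∂surf = 0 := by
  have h1 := hasSum_l2 f (tconst 1)
  rw [l2_tconst, one_mul] at h1
  refine h1.unique ?_
  convert hasSum_zero using 2 with i
  by_cases hi : i.1 = 0
  · rw [h i hi, zero_mul]
  · rw [l2_eq_zero_of_harm (Ne.symm hi) (tconst_mem_harm 1) (sh_mem i), mul_zero]

lemma rapid_lapInv (f : TestFun) : Rapid fun l => (-(((l : ℝ) * (l + 1)))⁻¹) • projL l f where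
  mem l := Submodule.smul_mem _ _ (projL_mem l f)
  decay k := by
    obtain ⟨C, hC⟩ := (rapid_projL f).decay k
    refine ⟨C, fun l => le_trans ?_ (hC l)⟩
    refine mul_le_mul_of_nonneg_left ?_ (by positivity)
    rw [l2_smul_left, l2_smul_right, ← mul_assoc]
    refine mul_le_of_le_one_left (l2_self_nonneg _) ?_
    have h1 : (0 : ℝ) ≤ ((l : ℝ) * (l + 1))⁻¹ ∧ ((l : ℝ) * (l + 1))⁻¹ ≤ 1 := by
      refine ⟨by positivity, ?_⟩
      rcases Nat.eq_zero_or_pos l with rfl | hl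
      · simp
      · have : (1 : ℝ) ≤ l := by exact_mod_cast hl
        exact inv_le_one_of_one_le₀ (by nlinarith)
    nlinarith

/-- The inverse of the Laplacian on functions of mean zero. -/
def lapInvFun (f : TestFun) : TestFun := (rapid_lapInv f).toTestFun

lemma coeff_lapInvFun (f : TestFun) (i : Idx) :
    l2 (lapInvFun f) (sh i) = -(eigval i)⁻¹ * l2 f (sh i) := by
  refine ((rapid_lapInv f).hasSum_l2 (sh i)).unique ?_
  simp only [l2_smul_left, coeff_projL]
  convert hasSum_ite_eq i.1 (-(eigval i)⁻¹ * l2 f (sh i)) using 2 with l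
  by_cases h : i.1 = l
  · subst h; simp [eigval]
  · rw [if_neg h, if_neg (Ne.symm h), mul_zero]

/-- The inverse of the Laplacian as a linear map. -/
def lapInv : TestFun →ₗ[ℝ] TestFun where
  toFun := lapInvFun
  map_add' f g := eq_of_coeff fun i => by
    simp only [l2_add_left, coeff_lapInvFun]; ring
  map_smul' c f := eq_of_coeff fun i => by
    simp only [l2_smul_left, coeff_lapInvFun, RingHom.id_apply]; ring

lemma coeff_lapInv (f : TestFun) (i : Idx) :
    l2 (lapInv f) (sh i) = -(eigval i)⁻¹ * l2 f (sh i) := coeff_lapInvFun f i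

lemma eigval_pos {i : Idx} (hi : i.1 ≠ 0) : 0 < eigval i := by
  have : (0 : ℝ) < i.1 := by exact_mod_cast Nat.pos_of_ne_zero hi
  unfold eigval; positivity

lemma lap_lapInv {f : TestFun} (hf : ∫ x, f.1 x ∂surf = 0) : lap (lapInv f) = f := by
  refine eq_of_coeff fun i => ?_
  rw [coeff_lap, coeff_lapInv]
  by_cases hi : i.1 = 0
  · rw [coeff_eq_zero_of_integral hf hi]; ring
  · have := (eigval_pos hi).ne'
    change -eigval i * (-(eigval i)⁻¹ * l2 f (sh i)) = _
    field_simp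

lemma integral_lapInv (f : TestFun) : ∫ x, (lapInv f).1 x ∂surf = 0 :=
  integral_eq_zero_of_coeff fun i hi => by rw [coeff_lapInv, eigval, hi]; simp

lemma integral_curl (Φ : TestField) : ∫ x, (curl Φ).1 x ∂surf = 0 := by
  have h := vl2_perpGrad (tconst 1) Φ
  have h0 : perpGrad (tconst 1) = 0 := field_ext fun i => by
    rw [component_perpGrad, ang_tconst, map_zero]
  rw [h0, show vl2 0 Φ = vl2B 0 Φ from rfl, map_zero, l2_comm, l2_tconst, one_mul] at h
  simpa using h

lemma integral_divg (Φ : TestField) : ∫ x, (divg Φ).1 x ∂surf = 0 := by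
  rw [divg_eq_curl, integral_curl]

/-- The Hodge decomposition of a smooth tangent field. -/
lemma hodge (Φ : TestField) :
    Φ = grad (lapInv (divg Φ)) + perpGrad (lapInv (curl Φ)) := by
  rw [← sub_eq_zero]
  refine eq_zero_of_divg_curl ?_ ?_
  · change divgL (Φ - (gradL _ + perpGradL _)) = 0
    rw [map_sub, map_add]
    change divg Φ - (lap (lapInv (divg Φ)) + divg (perpGrad _)) = 0
    rw [divg_perpGrad, lap_lapInv (integral_divg Φ)]
    module
  · change curlL (Φ - (gradL _ + perpGradL _)) = 0
    rw [map_sub, map_add]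
    change curl Φ - (curl (grad _) + curl (perpGrad _)) = 0
    rw [curl_grad, curl_perpGrad, lap_lapInv (integral_curl Φ)]
    module

lemma VFunctional.ext_of_hodge {u v : VFunctional} (h1 : ∀ f, u (grad f) = v (grad f))
    (h2 : ∀ f, u (perpGrad f) = v (perpGrad f)) : u = v := by
  ext Φ
  rw [hodge Φ, map_add, map_add, h1, h2]

lemma vl2_hodge (Φ Ψ : TestField) :
    vl2 Φ Ψ = -l2 (lapInv (divg Φ)) (divg Ψ) - l2 (lapInv (curl Φ)) (curl Ψ) := by
  have h : vl2 Φ Ψ = vl2 (grad (lapInv (divg Φ)) + perpGrad (lapInv (curl Φ))) Ψ := by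
    rw [← hodge]
  rw [h]
  have h2 := LinearMap.map_add₂ vl2B (grad (lapInv (divg Φ))) (perpGrad (lapInv (curl Φ))) Ψ
  refine h2.trans ?_
  change vl2 _ _ + vl2 _ _ = _
  rw [vl2_grad, vl2_perpGrad, sub_eq_add_neg]

/-- The inverse of the vector Laplacian. -/
def vlapInv : TestField →ₗ[ℝ] TestField :=
  gradL ∘ₗ lapInv ∘ₗ lapInv ∘ₗ divgL + perpGradL ∘ₗ lapInv ∘ₗ lapInv ∘ₗ curlL

lemma vlap_vlapInv (Φ : TestField) : vlap (vlapInv Φ) = Φ := by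
  have h : vlap (vlapInv Φ) = vlap (grad (lapInv (lapInv (divg Φ))))
      + vlap (perpGrad (lapInv (lapInv (curl Φ)))) := vlapL.map_add _ _
  rw [h, vlap_grad, vlap_perpGrad, lap_lapInv (integral_lapInv _),
    lap_lapInv (integral_lapInv _), ← hodge]

lemma vlap_injective {Φ Ψ : TestField} (h : vlap Φ = vlap Ψ) : Φ = Ψ := by
  have h0 : vlap (Φ - Ψ) = 0 := by
    have := vlapL.map_sub Φ Ψ
    exact this.trans (sub_eq_zero.2 h)
  have h1 := vl2_vlap (Φ - Ψ) (Φ - Ψ)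
  rw [h0, show vl2 0 (Φ - Ψ) = vl2B 0 (Φ - Ψ) from rfl, map_zero, LinearMap.zero_apply] at h1
  have h2 := l2_self_nonneg (divg (Φ - Ψ))
  have h3 := l2_self_nonneg (curl (Φ - Ψ))
  exact sub_eq_zero.1 (eq_zero_of_divg_curl (l2_self_eq_zero (by linarith))
    (l2_self_eq_zero (by linarith)))

/-! ### An orthonormal basis of tangent fields -/

/-- The indices of the nonconstant spherical harmonics. -/
abbrev Idx' : Type := {i : Idx // i.1 ≠ 0}

/-- The index set of the basis of tangent fields: gradients and rotated gradients. -/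
abbrev VIdx : Type := Idx' ⊕ Idx'

/-- The degree of a basis field. -/
def vdeg : VIdx → ℕ := Sum.elim (fun i => i.1.1) (fun i => i.1.1)

/-- The orthonormal eigenfields. -/
def vsh : VIdx → TestField :=
  Sum.elim (fun i => (Real.sqrt (eigval i.1))⁻¹ • grad (sh i.1))
    (fun i => (Real.sqrt (eigval i.1))⁻¹ • perpGrad (sh i.1))

lemma vl2_smul_right (c : ℝ) (Φ Ψ : TestField) : vl2 Φ (c • Ψ) = c * vl2 Φ Ψ :=
  (vl2B Φ).map_smul c Ψ

lemma vl2_smul_left (c : ℝ) (Φ Ψ : TestField) : vl2 (c • Φ) Ψ = c * vl2 Φ Ψ :=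
  LinearMap.map_smul₂ vl2B c Φ Ψ

lemma vcoeff_inl (Φ : TestField) (i : Idx') :
    vl2 Φ (vsh (.inl i)) = -((Real.sqrt (eigval i.1))⁻¹ * l2 (divg Φ) (sh i.1)) := by
  change vl2 Φ (_ • grad _) = _
  rw [vl2_smul_right, vl2_comm, vl2_grad, l2_comm]; ring

lemma vcoeff_inr (Φ : TestField) (i : Idx') :
    vl2 Φ (vsh (.inr i)) = -((Real.sqrt (eigval i.1))⁻¹ * l2 (curl Φ) (sh i.1)) := by
  change vl2 Φ (_ • perpGrad _) = _
  rw [vl2_smul_right, vl2_comm, vl2_perpGrad, l2_comm]; ring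

lemma hasSum_l2_lapInv (f g : TestFun) :
    HasSum (fun i : Idx' => (-((Real.sqrt (eigval i.1))⁻¹ * l2 f (sh i.1)))
      * (-((Real.sqrt (eigval i.1))⁻¹ * l2 g (sh i.1)))) (-l2 (lapInv f) g) := by
  have h := (hasSum_l2 (lapInv f) g).neg
  have h0 : Function.support (fun i => -(l2 (lapInv f) (sh i) * l2 g (sh i))) ⊆ {i | i.1 ≠ 0} := by
    intro i hi h0
    refine hi ?_
    simp [coeff_lapInv, eigval, h0]
  rw [← hasSum_subtype_iff_of_support_subset h0] at h
  have h' : HasSum (fun i : Idx' => -(l2 (lapInv f) (sh i.1) * l2 g (sh i.1)))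
    (-l2 (lapInv f) g) := h
  convert h' using 2 with i
  have hp := eigval_pos i.2
  rw [coeff_lapInv]
  have hs : (Real.sqrt (eigval i.1))⁻¹ * (Real.sqrt (eigval i.1))⁻¹ = (eigval i.1)⁻¹ := by
    rw [← mul_inv, Real.mul_self_sqrt hp.le]
  rw [← hs]; ring

lemma hasSum_vl2 (Φ Ψ : TestField) :
    HasSum (fun i => vl2 Φ (vsh i) * vl2 Ψ (vsh i)) (vl2 Φ Ψ) := by
  rw [vl2_hodge, sub_eq_add_neg]
  refine HasSum.sum ?_ ?_
  · convert hasSum_l2_lapInv (divg Φ) (divg Ψ) using 2 with i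
    simp only [Function.comp_apply, vcoeff_inl]
  · convert hasSum_l2_lapInv (curl Φ) (curl Ψ) using 2 with i
    simp only [Function.comp_apply, vcoeff_inr]

lemma vsh_inl (i : Idx') : vsh (.inl i) = (Real.sqrt (eigval i.1))⁻¹ • grad (sh i.1) := rfl

lemma vsh_inr (i : Idx') : vsh (.inr i) = (Real.sqrt (eigval i.1))⁻¹ • perpGrad (sh i.1) := rfl

lemma divg_vsh_inl (i : Idx') : divg (vsh (.inl i)) = (-Real.sqrt (eigval i.1)) • sh i.1 := by
  have hp := eigval_pos i.2
  rw [vsh_inl]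
  refine (divgL.map_smul _ _).trans ?_
  change _ • lap _ = _
  rw [mem_harm.1 (sh_mem i.1), smul_smul]
  congr 1
  change (Real.sqrt (eigval i.1))⁻¹ * -eigval i.1 = _
  have := Real.mul_self_sqrt hp.le
  have h2 := (Real.sqrt_pos.2 hp).ne'
  field_simp
  linarith

lemma curl_vsh_inr (i : Idx') : curl (vsh (.inr i)) = (-Real.sqrt (eigval i.1)) • sh i.1 := by
  have hp := eigval_pos i.2
  rw [vsh_inr]
  refine (curlL.map_smul _ _).trans ?_
  change _ • curl (perpGrad _) = _
  rw [curl_perpGrad, mem_harm.1 (sh_mem i.1), smul_smul]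
  congr 1
  change (Real.sqrt (eigval i.1))⁻¹ * -eigval i.1 = _
  have := Real.mul_self_sqrt hp.le
  have h2 := (Real.sqrt_pos.2 hp).ne'
  field_simp
  linarith

lemma curl_vsh_inl (i : Idx') : curl (vsh (.inl i)) = 0 := by
  rw [vsh_inl]
  refine (curlL.map_smul _ _).trans ?_
  change _ • curl (grad _) = _
  rw [curl_grad, smul_zero]

lemma divg_vsh_inr (i : Idx') : divg (vsh (.inr i)) = 0 := by
  rw [vsh_inr]
  refine (divgL.map_smul _ _).trans ?_
  change _ • divg (perpGrad _) = _
  rw [divg_perpGrad, smul_zero]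

lemma l2_zero_left (f : TestFun) : l2 0 f = 0 := by
  rw [show l2 0 f = l2B 0 f from rfl, map_zero, LinearMap.zero_apply]

lemma vl2_vsh (i j : VIdx) : vl2 (vsh i) (vsh j) = if i = j then 1 else 0 := by
  have key : ∀ i j : Idx', -((Real.sqrt (eigval j.1))⁻¹ *
      (-Real.sqrt (eigval i.1) * if i.1 = j.1 then 1 else 0)) = if i = j then 1 else 0 := by
    intro i j
    by_cases h : i = j
    · subst h
      have h2 := (Real.sqrt_pos.2 (eigval_pos i.2)).ne'
      rw [if_pos rfl, if_pos rfl]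
      field_simp
    · rw [if_neg h, if_neg (fun h' => h (Subtype.ext h'))]; ring
  rcases i with i | i <;> rcases j with j | j
  · rw [vcoeff_inl, divg_vsh_inl, l2_smul_left, l2_sh, key]; simp
  · rw [vcoeff_inr, curl_vsh_inl, l2_zero_left]; simp
  · rw [vcoeff_inl, divg_vsh_inr, l2_zero_left]; simp
  · rw [vcoeff_inr, curl_vsh_inr, l2_smul_left, l2_sh, key]; simp

lemma vlap_vsh (i : VIdx) : vlap (vsh i) = -((vdeg i : ℝ) * (vdeg i + 1)) • vsh i := by
  rcases i with i | i
  · rw [vsh_inl]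
    refine (vlapL.map_smul _ _).trans ?_
    change _ • vlap (grad _) = _
    rw [vlap_grad, mem_harm.1 (sh_mem i.1)]
    change _ • gradL _ = _
    rw [map_smul, smul_comm]; rfl
  · rw [vsh_inr]
    refine (vlapL.map_smul _ _).trans ?_
    change _ • vlap (perpGrad _) = _
    rw [vlap_perpGrad, mem_harm.1 (sh_mem i.1)]
    change _ • perpGradL _ = _
    rw [map_smul, smul_comm]; rfl

lemma finite_deg (l : ℕ) : {i : Idx | i.1 = l}.Finite := by
  refine (Set.finite_range fun j : Fin (Module.finrank ℝ (harmH l)) => (⟨l, j⟩ : Idx)).subset ?_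
  rintro ⟨m, j⟩ rfl
  exact ⟨j, rfl⟩

lemma finite_vdeg (l : ℕ) : {i : VIdx | vdeg i = l}.Finite := by
  have h : {i : Idx' | i.1.1 = l}.Finite :=
    (finite_deg l).preimage Subtype.val_injective.injOn
  refine ((h.image Sum.inl).union (h.image Sum.inr)).subset ?_
  rintro (i | i) hi
  · exact Or.inl ⟨i, hi, rfl⟩
  · exact Or.inr ⟨i, hi, rfl⟩

/-! ### Sobolev norms through spectral coefficients -/

/-- The weight `1 + ℓ (ℓ + 1)` of degree `ℓ`. -/
def wt (l : ℕ) : ℝ := 1 + (l : ℝ) * (l + 1)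

lemma one_le_wt (l : ℕ) : 1 ≤ wt l := by
  have : (0 : ℝ) ≤ (l : ℝ) * (l + 1) := by positivity
  unfold wt; linarith

lemma wt_pos (l : ℕ) : 0 < wt l := zero_lt_one.trans_le (one_le_wt l)

lemma wt_rpow_pos (l : ℕ) (s : ℝ) : 0 < wt l ^ s := Real.rpow_pos_of_pos (wt_pos l) s

lemma wt_rpow_neg_mul (l : ℕ) (s : ℝ) : wt l ^ (-s) * wt l ^ s = 1 := by
  rw [← Real.rpow_add (wt_pos l), neg_add_cancel, Real.rpow_zero]

open Classical in
lemma hasSum_off_finset {ι : Type*} {a : ι → ℝ} (ha : Summable a) (F : Finset ι) :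
    HasSum (fun i => if i ∈ F then 0 else a i) (∑' i, a i - ∑ i ∈ F, a i) := by
  have h1 : HasSum (fun i => if i ∈ F then a i else 0) (∑ i ∈ F, a i) := by
    have h0 : HasSum (fun i => if i ∈ F then a i else 0) (∑ i ∈ F, if i ∈ F then a i else 0) :=
      hasSum_sum_of_ne_finset_zero fun i hi => if_neg hi
    rwa [Finset.sum_congr rfl fun i hi => if_pos hi] at h0
  have h2 := ha.hasSum.sub h1
  have e : (fun i => a i - if i ∈ F then a i else 0) = fun i => if i ∈ F then 0 else a i := by
    funext i; split_ifs <;> simp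
  rwa [e] at h2

lemma tendsto_off_finset {ι : Type*} {a : ι → ℝ} (ha : Summable a) :
    Tendsto (fun F : Finset ι => ∑' i, a i - ∑ i ∈ F, a i) atTop (𝓝 0) := by
  have := (tendsto_const_nhds (x := ∑' i, a i)).sub ha.hasSum
  rwa [sub_self] at this

lemma tsum_mul_sq_le {ι : Type*} {a b : ι → ℝ} {c : ℝ} (ha : Summable fun i => a i ^ 2)
    (hb : Summable fun i => b i ^ 2) (hc : HasSum (fun i => a i * b i) c) :
    c ^ 2 ≤ (∑' i, a i ^ 2) * ∑' i, b i ^ 2 := by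
  refine le_of_tendsto (hc.pow 2) (Eventually.of_forall fun F => ?_)
  refine (Finset.sum_mul_sq_le_sq_mul_sq F a b).trans ?_
  exact mul_le_mul (ha.sum_le_tsum F fun i _ => sq_nonneg _)
    (hb.sum_le_tsum F fun i _ => sq_nonneg _) (Finset.sum_nonneg fun i _ => sq_nonneg _)
    (tsum_nonneg fun i => sq_nonneg _)

lemma summable_mul_of_weighted {ι : Type*} (d : ι → ℕ) {s : ℝ} {x y : ι → ℝ}
    (hx : Summable fun i => wt (d i) ^ (-s) * x i ^ 2)
    (hy : Summable fun i => wt (d i) ^ s * y i ^ 2) : Summable fun i => x i * y i := by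
  refine Summable.of_norm_bounded (hx.add hy) fun i => ?_
  have h1 := wt_rpow_neg_mul (d i) s
  have h2 := wt_rpow_pos (d i) s
  have h3 := wt_rpow_pos (d i) (-s)
  rw [Real.norm_eq_abs, abs_le]
  set p := wt (d i) ^ s
  set q := wt (d i) ^ (-s)
  have key : ∀ x y : ℝ, x * y ≤ q * x ^ 2 + p * y ^ 2 := fun x y => by
    have h4 : 0 ≤ q * (x - p * y / 2) ^ 2 := by positivity
    have h5 : 0 ≤ p * y ^ 2 := by positivity
    have h6 : q * (x - p * y / 2) ^ 2 = q * x ^ 2 - (q * p) * x * y + (q * p) * p * y ^ 2 / 4 := by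
      ring
    rw [h6, h1] at h4
    linarith
  have k2 := key (-x i) (y i)
  rw [neg_sq] at k2
  exact ⟨by linarith, key (x i) (y i)⟩

/-- A space with a symmetric operator and an orthonormal basis of eigenvectors with the
eigenvalues `-ℓ (ℓ + 1)`. -/
structure SpecSys (V : Type) [AddCommGroup V] [Module ℝ V] (ι : Type) where
  B : V →ₗ[ℝ] V →ₗ[ℝ] ℝ
  A : V →ₗ[ℝ] V
  e : ι → V
  deg : ι → ℕ
  hasSum : ∀ f g, HasSum (fun i => B f (e i) * B g (e i)) (B f g)
  self : ∀ i, B (e i) (e i) = 1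
  ortho : ∀ i j, i ≠ j → B (e i) (e j) = 0
  eigen : ∀ i, A (e i) = -((deg i : ℝ) * (deg i + 1)) • e i
  symm : ∀ f g, B (A f) g = B f (A g)
  finite : ∀ l, {i | deg i = l}.Finite

namespace SpecSys

variable {V ι : Type} [AddCommGroup V] [Module ℝ V] (S : SpecSys V ι)

/-- The squared norm of the projection to an eigenspace. -/
def level (l : ℕ) (f : V) : ℝ :=
  sSup {a | ∃ h : V, S.A h = -((l : ℝ) * (l + 1)) • h ∧ S.B h h ≤ 1 ∧ a = S.B f h ^ 2}

/-- The Sobolev norm of order `s`. -/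
def norm (s : ℝ) (f : V) : ℝ :=
  Real.sqrt (∑' l : ℕ, (1 + (l : ℝ) * (l + 1)) ^ s * S.level l f)

lemma coeff_A (f : V) (i : ι) :
    S.B (S.A f) (S.e i) = -((S.deg i : ℝ) * (S.deg i + 1)) * S.B f (S.e i) := by
  rw [S.symm, S.eigen, map_smul, smul_eq_mul]

lemma coeff_eq_zero {l : ℕ} {h : V} (hh : S.A h = -((l : ℝ) * (l + 1)) • h) {i : ι}
    (hi : S.deg i ≠ l) : S.B h (S.e i) = 0 := by
  have h1 := S.coeff_A h i
  rw [hh, LinearMap.map_smul₂, smul_eq_mul] at h1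
  have h2 : ((S.deg i : ℝ) - l) * ((S.deg i + l + 1) * S.B h (S.e i)) = 0 := by
    linear_combination h1
  have h3 : (S.deg i : ℝ) - l ≠ 0 := sub_ne_zero.2 (by exact_mod_cast hi)
  have h4 : (S.deg i : ℝ) + l + 1 ≠ 0 := by positivity
  exact (mul_eq_zero.1 ((mul_eq_zero.1 h2).resolve_left h3)).resolve_left h4

open Classical in
lemma coeff_sum (F : Finset ι) (t : ι → ℝ) (j : ι) :
    S.B (∑ i ∈ F, t i • S.e i) (S.e j) = if j ∈ F then t j else 0 := by
  rw [LinearMap.map_sum₂]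
  simp only [LinearMap.map_smul₂, smul_eq_mul]
  split_ifs with h
  · rw [Finset.sum_eq_single_of_mem j h fun i _ hij => by rw [S.ortho _ _ hij, mul_zero],
      S.self, mul_one]
  · refine Finset.sum_eq_zero fun i hi => ?_
    rw [S.ortho i j (fun e => h (e ▸ hi)), mul_zero]

lemma level_eq (l : ℕ) (f : V) :
    S.level l f = ∑ i ∈ (S.finite l).toFinset, S.B f (S.e i) ^ 2 := by
  set F := (S.finite l).toFinset with hF
  have hmem : ∀ i, i ∈ F ↔ S.deg i = l := fun i => by simp [hF]
  set Q := ∑ i ∈ F, S.B f (S.e i) ^ 2 with hQ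
  have hQ0 : 0 ≤ Q := Finset.sum_nonneg fun i _ => sq_nonneg _
  refine IsGreatest.csSup_eq ⟨?_, ?_⟩
  · set g := ∑ i ∈ F, S.B f (S.e i) • S.e i with hg
    have hgf : S.B f g = Q := by
      rw [hg, map_sum, hQ]
      exact Finset.sum_congr rfl fun i _ => by rw [map_smul, smul_eq_mul, sq]
    have hgg : S.B g g = Q := by
      nth_rw 2 [hg]
      rw [map_sum, hQ]
      refine Finset.sum_congr rfl fun i hi => ?_
      rw [map_smul, smul_eq_mul, hg, S.coeff_sum, if_pos hi, sq]
    have hA : S.A g = -((l : ℝ) * (l + 1)) • g := by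
      rw [hg, map_sum, Finset.smul_sum]
      refine Finset.sum_congr rfl fun i hi => ?_
      rw [map_smul, S.eigen, (hmem i).1 hi, smul_comm]
    refine ⟨(Real.sqrt Q)⁻¹ • g, ?_, ?_, ?_⟩
    · rw [map_smul, hA, smul_comm]
    · rw [map_smul, LinearMap.map_smul₂, hgg, smul_eq_mul, smul_eq_mul, ← mul_assoc, ← mul_inv,
        Real.mul_self_sqrt hQ0]
      exact inv_mul_le_one
    · rw [map_smul, hgf, smul_eq_mul, mul_pow, inv_pow, Real.sq_sqrt hQ0]
      rcases eq_or_ne Q 0 with h | h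
      · rw [h]; simp
      · field_simp
  · rintro a ⟨h, hA, hh, rfl⟩
    have h1 := (S.hasSum f h).unique (hasSum_sum_of_ne_finset_zero (s := F) fun i hi => by
      rw [S.coeff_eq_zero hA fun e => hi ((hmem i).2 e), mul_zero])
    have h2 := sum_le_hasSum F (fun i _ => mul_self_nonneg _) (S.hasSum h h)
    simp only [← sq] at h2
    rw [h1]
    refine (Finset.sum_mul_sq_le_sq_mul_sq F _ _).trans ?_
    exact mul_le_of_le_one_right hQ0 (h2.trans hh)

lemma coeff_iterate (k : ℕ) (f : V) (i : ι) :
    S.B (((1 - S.A : Module.End ℝ V) ^ k) f) (S.e i) = wt (S.deg i) ^ k * S.B f (S.e i) := by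
  induction k with
  | zero => simp
  | succ k ih =>
    rw [pow_succ', Module.End.mul_apply, LinearMap.sub_apply, Module.End.one_apply,
      LinearMap.map_sub₂, S.coeff_A, ih, wt]
    ring

lemma summable_weighted (s : ℝ) (f : V) :
    Summable fun i => wt (S.deg i) ^ s * S.B f (S.e i) ^ 2 := by
  obtain ⟨k, hk⟩ := exists_nat_ge s
  have h := (S.hasSum (((1 - S.A : Module.End ℝ V) ^ k) f) (((1 - S.A : Module.End ℝ V) ^ k) f)).summable
  refine Summable.of_nonneg_of_le (fun i => mul_nonneg (wt_rpow_pos _ s).le (sq_nonneg _))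
    (fun i => ?_) h
  rw [S.coeff_iterate, ← sq, mul_pow]
  refine mul_le_mul_of_nonneg_right ?_ (sq_nonneg _)
  have h1 := one_le_wt (S.deg i)
  rw [← pow_mul, ← Real.rpow_natCast]
  refine Real.rpow_le_rpow_of_exponent_le h1 (hk.trans ?_)
  exact_mod_cast Nat.le_mul_of_pos_right k two_pos

lemma norm_eq (s : ℝ) (f : V) :
    S.norm s f = Real.sqrt (∑' i, wt (S.deg i) ^ s * S.B f (S.e i) ^ 2) := by
  rw [norm]
  congr 1
  rw [← ((S.summable_weighted s f).hasSum.tsum_fiberwise S.deg).tsum_eq]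
  refine tsum_congr fun l => ?_
  rw [S.level_eq]
  rw [Finset.mul_sum]
  have h2 : ∑ i ∈ (S.finite l).toFinset, (1 + (l : ℝ) * (l + 1)) ^ s * S.B f (S.e i) ^ 2
      = ∑ i ∈ (S.finite l).toFinset, wt (S.deg i) ^ s * S.B f (S.e i) ^ 2 := by
    refine Finset.sum_congr rfl fun i hi => ?_
    have hi' : S.deg i = l := by simpa using hi
    rw [hi']; rfl
  rw [h2, ← Finset.tsum_subtype' (S.finite l).toFinset
    fun i => wt (S.deg i) ^ s * S.B f (S.e i) ^ 2, Set.Finite.coe_toFinset]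
  rfl

variable {S}

lemma sum_le_of_bound {T : V →ₗ[ℝ] ℝ} {s C : ℝ} (hT : ∀ f, |T f| ≤ C * S.norm (-s) f)
    (F : Finset ι) : ∑ i ∈ F, wt (S.deg i) ^ s * T (S.e i) ^ 2 ≤ C ^ 2 := by
  classical
  set Q := ∑ i ∈ F, wt (S.deg i) ^ s * T (S.e i) ^ 2 with hQ
  have hQ0 : 0 ≤ Q := Finset.sum_nonneg fun i _ => mul_nonneg (wt_rpow_pos _ s).le (sq_nonneg _)
  have h := hT (∑ i ∈ F, (wt (S.deg i) ^ s * T (S.e i)) • S.e i)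
  have h1 : T (∑ i ∈ F, (wt (S.deg i) ^ s * T (S.e i)) • S.e i) = Q := by
    rw [map_sum]
    exact Finset.sum_congr rfl fun i _ => by rw [map_smul, smul_eq_mul]; ring
  have h2 : S.norm (-s) (∑ i ∈ F, (wt (S.deg i) ^ s * T (S.e i)) • S.e i) = Real.sqrt Q := by
    rw [S.norm_eq]
    congr 1
    rw [tsum_eq_sum (s := F) fun i hi => by rw [S.coeff_sum, if_neg hi]; ring]
    refine Finset.sum_congr rfl fun i hi => ?_
    rw [S.coeff_sum, if_pos hi]
    linear_combination (wt (S.deg i) ^ s * T (S.e i) ^ 2) * wt_rpow_neg_mul (S.deg i) s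
  rw [h1, h2, abs_of_nonneg hQ0] at h
  have h3 := Real.mul_self_sqrt hQ0
  rcases (Real.sqrt_nonneg Q).eq_or_lt with h4 | h4
  · rw [← h4] at h3; nlinarith [sq_nonneg C]
  · have h5 : Real.sqrt Q ≤ C := by
      by_contra hc
      push Not at hc
      nlinarith
    nlinarith

lemma summable_of_bound {T : V →ₗ[ℝ] ℝ} {s C : ℝ} (hT : ∀ f, |T f| ≤ C * S.norm (-s) f) :
    Summable fun i => wt (S.deg i) ^ s * T (S.e i) ^ 2 :=
  summable_of_sum_le (fun _ => mul_nonneg (wt_rpow_pos _ s).le (sq_nonneg _)) (sum_le_of_bound hT)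

lemma tsum_le_of_bound {T : V →ₗ[ℝ] ℝ} {s C : ℝ} (hT : ∀ f, |T f| ≤ C * S.norm (-s) f) :
    ∑' i, wt (S.deg i) ^ s * T (S.e i) ^ 2 ≤ C ^ 2 :=
  (summable_of_bound hT).tsum_le_of_sum_le (sum_le_of_bound hT)

lemma hasSum_of_bound {T : V →ₗ[ℝ] ℝ} {s C : ℝ} (hT : ∀ f, |T f| ≤ C * S.norm (-s) f) (f : V) :
    HasSum (fun i => T (S.e i) * S.B f (S.e i)) (T f) := by
  classical
  have h1 : ∀ F : Finset ι, ‖∑ i ∈ F, T (S.e i) * S.B f (S.e i) - T f‖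
      ≤ C * Real.sqrt (∑' i, wt (S.deg i) ^ (-s) * S.B f (S.e i) ^ 2
        - ∑ i ∈ F, wt (S.deg i) ^ (-s) * S.B f (S.e i) ^ 2) := by
    intro F
    have h2 := hT (f - ∑ i ∈ F, S.B f (S.e i) • S.e i)
    have h3 : T (f - ∑ i ∈ F, S.B f (S.e i) • S.e i)
        = T f - ∑ i ∈ F, T (S.e i) * S.B f (S.e i) := by
      rw [map_sub, map_sum]
      congr 1
      exact Finset.sum_congr rfl fun i _ => by rw [map_smul, smul_eq_mul, mul_comm]
    rw [h3, S.norm_eq, abs_sub_comm] at h2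
    have h4 : ∑' i, wt (S.deg i) ^ (-s) * S.B (f - ∑ i ∈ F, S.B f (S.e i) • S.e i) (S.e i) ^ 2
        = ∑' i, wt (S.deg i) ^ (-s) * S.B f (S.e i) ^ 2
        - ∑ i ∈ F, wt (S.deg i) ^ (-s) * S.B f (S.e i) ^ 2 := by
      rw [← (hasSum_off_finset (S.summable_weighted (-s) f) F).tsum_eq]
      congr 1; funext i
      rw [LinearMap.map_sub₂, S.coeff_sum]
      split_ifs <;> simp
    rw [h4] at h2
    exact h2
  rw [HasSum, tendsto_iff_norm_sub_tendsto_zero]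
  refine squeeze_zero (fun F => _root_.norm_nonneg _) h1 ?_
  have h5 := (Real.continuous_sqrt.tendsto 0).comp
    (tendsto_off_finset (S.summable_weighted (-s) f))
  rw [Real.sqrt_zero] at h5
  simpa using h5.const_mul C

lemma abs_le_of_hasSum {T : V →ₗ[ℝ] ℝ} {s : ℝ}
    (h1 : Summable fun i => wt (S.deg i) ^ s * T (S.e i) ^ 2)
    (h2 : ∀ f, HasSum (fun i => T (S.e i) * S.B f (S.e i)) (T f)) (f : V) :
    |T f| ≤ Real.sqrt (∑' i, wt (S.deg i) ^ s * T (S.e i) ^ 2) * S.norm (-s) f := by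
  rw [S.norm_eq, ← Real.sqrt_mul (tsum_nonneg fun i =>
    mul_nonneg (wt_rpow_pos _ s).le (sq_nonneg _))]
  refine Real.abs_le_sqrt ?_
  have hw : ∀ (i : ι) (r : ℝ), (wt (S.deg i) ^ (r / 2)) ^ 2 = wt (S.deg i) ^ r := fun _ r => by
    rw [← Real.rpow_natCast, ← Real.rpow_mul (wt_pos _).le]
    congr 1; push_cast; ring
  have ha : ∀ i, wt (S.deg i) ^ s * T (S.e i) ^ 2 = (wt (S.deg i) ^ (s / 2) * T (S.e i)) ^ 2 :=
    fun i => by rw [mul_pow, hw]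
  have hb : ∀ i, wt (S.deg i) ^ (-s) * S.B f (S.e i) ^ 2
      = (wt (S.deg i) ^ (-s / 2) * S.B f (S.e i)) ^ 2 := fun i => by rw [mul_pow, hw]
  have h3 := S.summable_weighted (-s) f
  simp only [ha, hb] at h1 h3 ⊢
  refine tsum_mul_sq_le h1 h3 ?_
  convert h2 f using 2 with i
  have h4 := wt_rpow_neg_mul (S.deg i) (s / 2)
  rw [← neg_div] at h4
  linear_combination (T (S.e i) * S.B f (S.e i)) * h4

end SpecSys

/-- The spectral system of functions. -/
def scalarSys : SpecSys TestFun Idx where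
  B := l2B
  A := lapL
  e := sh
  deg := Sigma.fst
  hasSum := hasSum_l2
  self i := (l2_sh i i).trans (if_pos rfl)
  ortho i j h := (l2_sh i j).trans (if_neg h)
  eigen i := mem_harm.1 (sh_mem i)
  symm := l2_lap_comm
  finite := finite_deg

/-- The spectral system of tangent fields. -/
def fieldSys : SpecSys TestField VIdx where
  B := vl2B
  A := vlapL
  e := vsh
  deg := vdeg
  hasSum := hasSum_vl2
  self i := (vl2_vsh i i).trans (if_pos rfl)
  ortho i j h := (vl2_vsh i j).trans (if_neg h)
  eigen i := vlap_vsh i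
  symm := vl2_vlap_comm
  finite := finite_vdeg

/-- A dyadic summability criterion: growth `N ^ α` of the partial sums. -/
lemma summable_weight_mul {ι : Type*} (deg : ι → ℕ) (a : ι → ℝ) (ha : ∀ i, 0 ≤ a i) {C : ℝ}
    {α : ℕ} (h : ∀ (F : Finset ι) (N : ℕ), 0 < N → (∀ i ∈ F, deg i < N) →
      ∑ i ∈ F, a i ≤ C * N ^ α) {s : ℝ} (hs : α < 2 * s) :
    Summable fun i => wt (deg i) ^ (-s) * a i := by
  classical
  have hs0 : 0 < s := by
    have : (0 : ℝ) ≤ α := by positivity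
    linarith
  set k : ι → ℕ := fun i => Nat.log 2 (deg i + 1) with hk
  set q : ℝ := 2 ^ ((α : ℝ) - 2 * s) with hq
  have hq0 : 0 < q := Real.rpow_pos_of_pos two_pos _
  have hq1 : q < 1 := Real.rpow_lt_one_of_one_lt_of_neg one_lt_two (by linarith)
  have hC : 0 ≤ C := by
    have := h ∅ 1 one_pos (by simp)
    simpa using this
  have hgeo : Summable fun n : ℕ => 2 ^ s * C * 2 ^ α * q ^ n :=
    (summable_geometric_of_lt_one hq0.le hq1).mul_left _
  refine summable_of_sum_le (c := ∑' n : ℕ, 2 ^ s * C * 2 ^ α * q ^ n)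
    (fun i => mul_nonneg (wt_rpow_pos _ _).le (ha i)) fun F => ?_
  have hfib : ∀ n, ∑ i ∈ F with k i = n, wt (deg i) ^ (-s) * a i ≤ 2 ^ s * C * 2 ^ α * q ^ n := by
    intro n
    have h1 : ∀ i ∈ F.filter (fun i => k i = n), wt (deg i) ^ (-s) * a i
        ≤ 2 ^ s * (2 ^ (-2 * s)) ^ n * a i := by
      intro i hi
      refine mul_le_mul_of_nonneg_right ?_ (ha i)
      have hi' : Nat.log 2 (deg i + 1) = n := (Finset.mem_filter.1 hi).2
      have h2 : (2 : ℕ) ^ n ≤ deg i + 1 := by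
        rw [← hi']; exact Nat.pow_log_le_self 2 (Nat.succ_ne_zero _)
      have h2' : (2 : ℝ) ^ n ≤ deg i + 1 := by exact_mod_cast h2
      have h3 : ((2 : ℝ) ^ n) ^ 2 / 2 ≤ wt (deg i) := by
        have h4 := pow_le_pow_left₀ (by positivity) h2' 2
        have h5 : (0 : ℝ) ≤ deg i := by positivity
        unfold wt; nlinarith
      have h6 := Real.rpow_le_rpow_of_nonpos (by positivity) h3 (neg_nonpos.2 hs0.le)
      refine h6.trans (le_of_eq ?_)
      rw [Real.div_rpow (by positivity) zero_le_two, ← pow_mul, ← Real.rpow_natCast,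
        ← Real.rpow_mul zero_le_two, ← Real.rpow_natCast, ← Real.rpow_mul zero_le_two,
        ← Real.rpow_sub two_pos, ← Real.rpow_add two_pos]
      congr 1; push_cast; ring
    refine (Finset.sum_le_sum h1).trans ?_
    rw [← Finset.mul_sum]
    have h7 := h (F.filter fun i => k i = n) (2 ^ (n + 1)) (by positivity) (fun i hi => by
      have hi' : Nat.log 2 (deg i + 1) = n := (Finset.mem_filter.1 hi).2
      have := Nat.lt_pow_succ_log_self one_lt_two (deg i + 1)
      rw [hi', Nat.succ_eq_add_one] at this
      omega)
    refine (mul_le_mul_of_nonneg_left h7 (by positivity)).trans (le_of_eq ?_)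
    have h8 : (2 ^ (-2 * s) : ℝ) * 2 ^ α = q := by
      rw [hq, ← Real.rpow_natCast, ← Real.rpow_add two_pos]; congr 1; ring
    rw [← h8, mul_pow]
    push_cast
    ring
  rw [← Finset.sum_fiberwise_of_maps_to (t := F.image k) (g := k)
    fun i hi => Finset.mem_image_of_mem k hi]
  refine (Finset.sum_le_sum fun n _ => hfib n).trans ?_
  exact hgeo.sum_le_tsum _ fun n _ => by positivity

/-! ### Distributional fields through their coefficients -/

lemma mem_Sob_iff {T : Functional} {s : ℝ} : T ∈ Sob s ↔
    (Summable fun i : Idx => wt i.1 ^ s * T (sh i) ^ 2) ∧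
      ∀ f, HasSum (fun i => T (sh i) * l2 f (sh i)) (T f) :=
  ⟨fun ⟨_, hC⟩ => ⟨SpecSys.summable_of_bound (S := scalarSys) hC,
    SpecSys.hasSum_of_bound (S := scalarSys) hC⟩,
   fun h => ⟨_, SpecSys.abs_le_of_hasSum (S := scalarSys) h.1 h.2⟩⟩

lemma mem_VSob_iff {w : VFunctional} {s : ℝ} : w ∈ VSob s ↔
    (Summable fun i : VIdx => wt (vdeg i) ^ s * w (vsh i) ^ 2) ∧
      ∀ Φ, HasSum (fun i => w (vsh i) * vl2 Φ (vsh i)) (w Φ) :=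
  ⟨fun ⟨_, hC⟩ => ⟨SpecSys.summable_of_bound (S := fieldSys) hC,
    SpecSys.hasSum_of_bound (S := fieldSys) hC⟩,
   fun h => ⟨_, SpecSys.abs_le_of_hasSum (S := fieldSys) h.1 h.2⟩⟩

lemma vnorm_eq {w : VFunctional} {s : ℝ} (hw : w ∈ VSob s) :
    vnorm s w = ENNReal.ofReal (Real.sqrt (∑' i : VIdx, wt (vdeg i) ^ s * w (vsh i) ^ 2)) := by
  obtain ⟨h1, h2⟩ := mem_VSob_iff.1 hw
  refine le_antisymm ?_ ?_
  · refine iInf₂_le_of_le (Real.toNNReal (Real.sqrt (∑' i : VIdx, wt (vdeg i) ^ s * w (vsh i) ^ 2)))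
      (fun Φ => ?_) le_rfl
    rw [Real.coe_toNNReal _ (Real.sqrt_nonneg _)]
    exact SpecSys.abs_le_of_hasSum (S := fieldSys) h1 h2 Φ
  · refine le_iInf₂ fun C hC => ?_
    rw [← ENNReal.ofReal_coe_nnreal]
    exact ENNReal.ofReal_le_ofReal (Real.sqrt_le_iff.2
      ⟨C.2, SpecSys.tsum_le_of_bound (S := fieldSys) hC⟩)

lemma toFunctional_apply (Φ Ψ : TestField) : toFunctional Φ Ψ = vl2 Φ Ψ := rfl

lemma toFunctional_mem (Φ : TestField) (s : ℝ) : toFunctional Φ ∈ VSob s :=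
  mem_VSob_iff.2 ⟨fieldSys.summable_weighted s Φ, fun Ψ => by
    simpa only [toFunctional_apply, mul_comm] using hasSum_vl2 Φ Ψ⟩

open Classical in
lemma tendsto_approaching {w : VFunctional} {s : ℝ} (hw : w ∈ VSob s) :
    Tendsto (fun F : Finset VIdx => ∑ i ∈ F, w (vsh i) • vsh i) atTop (approaching s w) := by
  rw [approaching, tendsto_comap_iff]
  obtain ⟨h1, h2⟩ := mem_VSob_iff.1 hw
  have h3 : ∀ F : Finset VIdx, vnorm s (toFunctional (∑ i ∈ F, w (vsh i) • vsh i) - w)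
      = ENNReal.ofReal (Real.sqrt (∑' i : VIdx, wt (vdeg i) ^ s * w (vsh i) ^ 2
        - ∑ i ∈ F, wt (vdeg i) ^ s * w (vsh i) ^ 2)) := by
    intro F
    rw [vnorm_eq (Submodule.sub_mem _ (toFunctional_mem _ s) hw)]
    congr 2
    rw [← (hasSum_off_finset h1 F).tsum_eq]
    congr 1; funext i
    rw [LinearMap.sub_apply, toFunctional_apply]
    have h4 : vl2 (∑ i ∈ F, w (vsh i) • vsh i) (vsh i) = if i ∈ F then w (vsh i) else 0 := by
      convert fieldSys.coeff_sum F (fun i => w (vsh i)) i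
      rfl
    rw [h4]
    split_ifs <;> simp
  have h5 := ENNReal.tendsto_ofReal
    ((Real.continuous_sqrt.tendsto 0).comp (tendsto_off_finset h1))
  rw [Real.sqrt_zero, ENNReal.ofReal_zero] at h5
  exact h5.congr fun F => (h3 F).symm

lemma approaching_neBot {w : VFunctional} {s : ℝ} (hw : w ∈ VSob s) : (approaching s w).NeBot :=
  (tendsto_approaching hw).neBot

lemma summable_pairing {v w : VFunctional} {s : ℝ} (hv : v ∈ VSob (-s)) (hw : w ∈ VSob s) :
    Summable fun i => v (vsh i) * w (vsh i) :=
  summable_mul_of_weighted vdeg (mem_VSob_iff.1 hv).1 (mem_VSob_iff.1 hw).1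

lemma abs_pairing_le {v w : VFunctional} {s : ℝ} (hv : v ∈ VSob (-s)) (hw : w ∈ VSob s) :
    ENNReal.ofReal |∑' i, v (vsh i) * w (vsh i)|
      ≤ ENNReal.ofReal (Real.sqrt (∑' i : VIdx, wt (vdeg i) ^ (-s) * v (vsh i) ^ 2))
        * vnorm s w := by
  rw [vnorm_eq hw, ← ENNReal.ofReal_mul (Real.sqrt_nonneg _)]
  refine ENNReal.ofReal_le_ofReal ?_
  rw [← Real.sqrt_mul (tsum_nonneg fun i => mul_nonneg (wt_rpow_pos _ _).le (sq_nonneg _))]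
  refine Real.abs_le_sqrt ?_
  have hr : ∀ (i : VIdx) (r : ℝ), (wt (vdeg i) ^ (r / 2)) ^ 2 = wt (vdeg i) ^ r := fun i r => by
    rw [← Real.rpow_natCast, ← Real.rpow_mul (wt_pos _).le]
    congr 1; push_cast; ring
  have ha : ∀ i : VIdx, wt (vdeg i) ^ (-s) * v (vsh i) ^ 2
      = (wt (vdeg i) ^ (-s / 2) * v (vsh i)) ^ 2 := fun i => by rw [mul_pow, hr]
  have hb : ∀ i : VIdx, wt (vdeg i) ^ s * w (vsh i) ^ 2
      = (wt (vdeg i) ^ (s / 2) * w (vsh i)) ^ 2 := fun i => by rw [mul_pow, hr]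
  have h1 := (mem_VSob_iff.1 hv).1
  have h2 := (mem_VSob_iff.1 hw).1
  simp only [ha, hb] at h1 h2 ⊢
  refine tsum_mul_sq_le h1 h2 ?_
  convert (summable_pairing hv hw).hasSum using 2 with i
  have h4 := wt_rpow_neg_mul (vdeg i) (s / 2)
  rw [← neg_div] at h4
  linear_combination (v (vsh i) * w (vsh i)) * h4

lemma tendsto_dualPairing {v w : VFunctional} {s : ℝ} (hv : v ∈ VSob (-s)) (hw : w ∈ VSob s) :
    Tendsto v (approaching s w) (𝓝 (∑' i, v (vsh i) * w (vsh i))) := by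
  rw [tendsto_iff_edist_tendsto_0]
  have h1 : Tendsto (fun Φ => vnorm s (toFunctional Φ - w)) (approaching s w) (𝓝 0) :=
    tendsto_comap
  have h2 := ENNReal.Tendsto.const_mul
    (a := ENNReal.ofReal (Real.sqrt (∑' i : VIdx, wt (vdeg i) ^ (-s) * v (vsh i) ^ 2))) h1
    (Or.inr ENNReal.ofReal_ne_top)
  rw [mul_zero] at h2
  refine tendsto_of_tendsto_of_tendsto_of_le_of_le tendsto_const_nhds h2 (fun _ => zero_le)
    fun Φ => ?_
  have h3 := abs_pairing_le hv (Submodule.sub_mem _ (toFunctional_mem Φ s) hw)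
  refine le_trans (le_of_eq ?_) h3
  rw [edist_dist, Real.dist_eq]
  congr 2
  have h4 := ((mem_VSob_iff.1 hv).2 Φ).sub (summable_pairing hv hw).hasSum
  rw [← h4.tsum_eq]
  congr 1; funext i
  rw [LinearMap.sub_apply, toFunctional_apply, mul_sub]

lemma dualPairing_eq {v w : VFunctional} {s : ℝ} (hv : v ∈ VSob (-s)) (hw : w ∈ VSob s) :
    dualPairing s v w = ∑' i, v (vsh i) * w (vsh i) :=
  haveI := approaching_neBot hw
  (tendsto_dualPairing hv hw).limUnder_eq

/-! ### The projection and the inverse Laplacian on distributions -/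

lemma lapInv_lap {f : TestFun} (hf : ∫ x, f.1 x ∂surf = 0) : lapInv (lap f) = f := by
  refine eq_of_coeff fun i => ?_
  rw [coeff_lapInv, coeff_lap]
  by_cases hi : i.1 = 0
  · rw [coeff_eq_zero_of_integral hf hi]; ring
  · have := (eigval_pos hi).ne'
    change -(eigval i)⁻¹ * (-eigval i * l2 f (sh i)) = _
    field_simp

lemma perpGrad_lapInv_lap (f : TestFun) : perpGrad (lapInv (lap f)) = perpGrad f := by
  have h := hodge (perpGrad f)
  rw [divg_perpGrad, curl_perpGrad, map_zero] at h
  rw [h.trans (congrArg₂ (· + ·) gradL.map_zero rfl), zero_add]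

/-- The divergence-free part of a smooth field. -/
def lerayField : TestField →ₗ[ℝ] TestField := perpGradL ∘ₗ lapInv ∘ₗ curlL

lemma lerayField_grad (f : TestFun) : lerayField (grad f) = 0 := by
  change perpGradL (lapInv (curl (grad f))) = 0
  rw [curl_grad, map_zero, map_zero]

lemma lerayField_perpGrad (f : TestFun) : lerayField (perpGrad f) = perpGrad f := by
  change perpGrad (lapInv (curl (perpGrad f))) = _
  rw [curl_perpGrad, perpGrad_lapInv_lap]

lemma leray_eq (w : VFunctional) : leray w = w ∘ₗ lerayField := by
  have hex : IsLeray w (w ∘ₗ lerayField) := by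
    refine ⟨fun f => ?_, fun f => ?_⟩
    · rw [LinearMap.comp_apply, lerayField_grad, map_zero]
    · rw [LinearMap.comp_apply, lerayField_perpGrad]
  have h : ∃ u, IsLeray w u := ⟨_, hex⟩
  rw [leray, dif_pos h]
  obtain ⟨h1, h2⟩ := h.choose_spec
  exact VFunctional.ext_of_hodge (fun f => (h1 f).trans (hex.1 f).symm)
    fun f => (h2 f).trans (hex.2 f).symm

lemma leray_of_isDivFree {w : VFunctional} (hw : IsDivFree w) : leray w = w := by
  rw [leray_eq]
  refine VFunctional.ext_of_hodge (fun f => ?_) fun f => ?_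
  · rw [LinearMap.comp_apply, lerayField_grad, map_zero, hw]
  · rw [LinearMap.comp_apply, lerayField_perpGrad]

lemma lerayField_vsh_inl (i : Idx') : lerayField (vsh (.inl i)) = 0 := by
  rw [vsh_inl, map_smul, lerayField_grad, smul_zero]

lemma lerayField_vsh_inr (i : Idx') : lerayField (vsh (.inr i)) = vsh (.inr i) := by
  rw [vsh_inr, map_smul, lerayField_perpGrad]

lemma curl_lerayField (Φ : TestField) : curl (lerayField Φ) = curl Φ := by
  change curl (perpGrad (lapInv (curl Φ))) = _
  rw [curl_perpGrad, lap_lapInv (integral_curl Φ)]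

lemma divg_lerayField (Φ : TestField) : divg (lerayField Φ) = 0 := divg_perpGrad _

lemma leray_mem {w : VFunctional} {s : ℝ} (hw : w ∈ VSob s) : leray w ∈ VSob s := by
  obtain ⟨h1, h2⟩ := mem_VSob_iff.1 hw
  rw [leray_eq, mem_VSob_iff]
  refine ⟨Summable.of_nonneg_of_le (fun i => mul_nonneg (wt_rpow_pos _ _).le (sq_nonneg _))
    (fun i => mul_le_mul_of_nonneg_left ?_ (wt_rpow_pos _ _).le) h1, fun Φ => ?_⟩
  · rcases i with i | i
    · rw [LinearMap.comp_apply, lerayField_vsh_inl, map_zero, zero_pow two_ne_zero]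
      exact sq_nonneg _
    · rw [LinearMap.comp_apply, lerayField_vsh_inr]
  · rw [LinearMap.comp_apply]
    convert h2 (lerayField Φ) using 2 with i
    rcases i with i | i
    · rw [LinearMap.comp_apply, lerayField_vsh_inl, vcoeff_inl (lerayField Φ), divg_lerayField,
        l2_zero_left]
      simp
    · rw [LinearMap.comp_apply, lerayField_vsh_inr, vcoeff_inr, vcoeff_inr, curl_lerayField]

/-- The eigenvalue of a basis field. -/
def veigval (i : VIdx) : ℝ := (vdeg i : ℝ) * (vdeg i + 1)

lemma one_le_vdeg (i : VIdx) : 1 ≤ vdeg i := by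
  rcases i with i | i <;> exact Nat.one_le_iff_ne_zero.2 i.2

lemma two_le_veigval (i : VIdx) : 2 ≤ veigval i := by
  have : (1 : ℝ) ≤ vdeg i := by exact_mod_cast one_le_vdeg i
  unfold veigval; nlinarith

lemma invLap_eq (w : VFunctional) : invLap w = -(w ∘ₗ vlapInv) := by
  have hinv : ∀ Φ, vlapInv (vlap Φ) = Φ := fun Φ => vlap_injective (vlap_vlapInv _)
  have hex : ∀ Φ, (-(w ∘ₗ vlapInv)) (-vlap Φ) = w Φ := fun Φ => by
    rw [map_neg, LinearMap.neg_apply, neg_neg, LinearMap.comp_apply, hinv]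
  have h : ∃ u : VFunctional, ∀ Φ, u (-vlap Φ) = w Φ := ⟨_, hex⟩
  rw [invLap, dif_pos h]
  ext Φ
  have h1 := h.choose_spec (-vlapInv Φ)
  have h2 := hex (-vlapInv Φ)
  have h3 : vlap (-vlapInv Φ) = -Φ := by
    refine (vlapL.map_neg _).trans ?_
    exact congrArg Neg.neg (vlap_vlapInv Φ)
  rw [h3, neg_neg] at h1 h2
  exact h1.trans h2.symm

lemma vcoeff_vlapInv (Φ : TestField) (i : VIdx) :
    vl2 (vlapInv Φ) (vsh i) = -(veigval i)⁻¹ * vl2 Φ (vsh i) := by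
  have h1 := vl2_vlap_comm (vlapInv Φ) (vsh i)
  rw [vlap_vlapInv, vlap_vsh, vl2_smul_right] at h1
  have h2 : veigval i ≠ 0 := (zero_lt_two.trans_le (two_le_veigval i)).ne'
  rw [h1]
  change _ = -(veigval i)⁻¹ * (-veigval i * _)
  field_simp

lemma invLap_vsh (w : VFunctional) (i : VIdx) :
    invLap w (vsh i) = (veigval i)⁻¹ * w (vsh i) := by
  have h2 : veigval i ≠ 0 := (zero_lt_two.trans_le (two_le_veigval i)).ne'
  have h : vlapInv (vsh i) = (-(veigval i)⁻¹) • vsh i := by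
    refine vlap_injective ?_
    rw [vlap_vlapInv]
    refine Eq.trans ?_ (vlapL.map_smul _ _).symm
    change _ = _ • vlap _
    rw [vlap_vsh, smul_smul]
    change _ = (-(veigval i)⁻¹ * -veigval i) • _
    rw [neg_mul_neg, inv_mul_cancel₀ h2, one_smul]
  rw [invLap_eq, LinearMap.neg_apply, LinearMap.comp_apply, h, map_smul, smul_eq_mul]; ring

lemma invLap_mem {w : VFunctional} (hw : w ∈ VSob (-1)) : invLap w ∈ VSob 1 := by
  obtain ⟨h1, h2⟩ := mem_VSob_iff.1 hw
  rw [mem_VSob_iff]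
  constructor
  · refine Summable.of_nonneg_of_le (fun i => mul_nonneg (wt_rpow_pos _ _).le (sq_nonneg _))
      (fun i => ?_) (h1.mul_left 4)
    have h3 := two_le_veigval i
    have h4 : wt (vdeg i) = 1 + veigval i := rfl
    rw [invLap_vsh, Real.rpow_one, Real.rpow_neg_one, mul_pow, h4, ← mul_assoc, ← mul_assoc]
    refine mul_le_mul_of_nonneg_right ?_ (sq_nonneg _)
    rw [inv_pow, ← div_eq_mul_inv, ← div_eq_mul_inv, div_le_div_iff₀ (by positivity) (by positivity)]
    nlinarith
  · intro Φ
    have h3 := (h2 (vlapInv Φ)).neg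
    have e : (fun i => -(w (vsh i) * vl2 (vlapInv Φ) (vsh i)))
        = fun i => invLap w (vsh i) * vl2 Φ (vsh i) := by
      funext i
      rw [invLap_vsh, vcoeff_vlapInv]; ring
    rw [e] at h3
    rw [show invLap w Φ = -w (vlapInv Φ) by rw [invLap_eq]; rfl]
    exact h3

lemma hasSum_variance {w : VFunctional} (hw : w ∈ VSob (-1)) :
    HasSum (fun i : Idx' => (eigval i.1)⁻¹ * w (vsh (.inr i)) ^ 2)
      (dualPairing 1 w (invLap (leray w))) := by
  have hm := invLap_mem (leray_mem hw)
  rw [dualPairing_eq hw hm]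
  have hs := (summable_pairing hw hm)
  have hv : ∀ i : Idx', w (vsh (.inr i)) * invLap (leray w) (vsh (.inr i))
      = (eigval i.1)⁻¹ * w (vsh (.inr i)) ^ 2 := fun i => by
    rw [invLap_vsh, leray_eq, LinearMap.comp_apply, lerayField_vsh_inr]
    change _ * ((eigval i.1)⁻¹ * _) = _
    ring
  have h0 : ∀ i : Idx', w (vsh (.inl i)) * invLap (leray w) (vsh (.inl i)) = 0 := fun i => by
    rw [invLap_vsh, leray_eq, LinearMap.comp_apply, lerayField_vsh_inl, map_zero, mul_zero, mul_zero]
  have hr : Summable fun i : Idx' => w (vsh (.inr i)) * invLap (leray w) (vsh (.inr i)) :=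
    hs.comp_injective Sum.inr_injective
  have hsum : HasSum (fun i => w (vsh i) * invLap (leray w) (vsh i))
      (0 + ∑' i : Idx', w (vsh (.inr i)) * invLap (leray w) (vsh (.inr i))) := by
    refine HasSum.sum ?_ hr.hasSum
    simp only [Function.comp_def, h0]
    exact hasSum_zero
  rw [hsum.tsum_eq, zero_add]
  simp only [hv] at hr ⊢
  exact hr.hasSum

/-! ### Gaussian variables -/

lemma map_eq_gaussianReal_of_tendsto {Ω : Type*} [MeasurableSpace Ω] {P : Measure Ω}
    [IsProbabilityMeasure P] {X : ℕ → Ω → ℝ} {Y : Ω → ℝ} {v : ℕ → ℝ≥0} {v' : ℝ≥0}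
    (hX : ∀ n, AEMeasurable (X n) P) (hY : AEMeasurable Y P)
    (hlaw : ∀ n, P.map (X n) = gaussianReal 0 (v n)) (hv : Tendsto v atTop (𝓝 v'))
    (hlim : ∀ᵐ z ∂P, Tendsto (fun n => X n z) atTop (𝓝 (Y z))) :
    P.map Y = gaussianReal 0 v' := by
  have := Measure.isProbabilityMeasure_map hY
  refine Measure.ext_of_charFun ?_
  funext t
  have hch : ∀ {Z : Ω → ℝ}, AEMeasurable Z P →
      charFun (P.map Z) t = ∫ z, Complex.exp (t * Z z * Complex.I) ∂P := fun hZ => by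
    rw [charFun_apply_real, integral_map hZ]
    fun_prop
  have h1 : Tendsto (fun n => charFun (P.map (X n)) t) atTop (𝓝 (charFun (P.map Y) t)) := by
    rw [hch hY]
    simp only [hch (hX _)]
    refine tendsto_integral_of_dominated_convergence (fun _ => 1) (fun n => ?_)
      (integrable_const _) (fun n => Eventually.of_forall fun z => ?_) ?_
    · have : AEMeasurable (fun z => Complex.exp (t * X n z * Complex.I)) P := by
        have := hX n
        fun_prop
      exact this.aestronglyMeasurable
    · rw [← Complex.ofReal_mul, Complex.norm_exp_ofReal_mul_I]
    · filter_upwards [hlim] with z hz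
      refine (Complex.continuous_exp.tendsto _).comp ?_
      have h2 : Tendsto (fun n => (X n z : ℂ)) atTop (𝓝 (Y z : ℂ)) :=
        (Complex.continuous_ofReal.tendsto _).comp hz
      exact (h2.const_mul _).mul_const _
  have h2 : Tendsto (fun n => charFun (P.map (X n)) t) atTop
      (𝓝 (charFun (gaussianReal 0 v') t)) := by
    simp only [hlaw, charFun_gaussianReal]
    refine (Complex.continuous_exp.tendsto _).comp ?_
    have h3 : Tendsto (fun n => ((v n : ℝ) : ℂ)) atTop (𝓝 ((v' : ℝ) : ℂ)) :=
      (Complex.continuous_ofReal.tendsto _).comp ((NNReal.continuous_coe.tendsto _).comp hv)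
    exact tendsto_const_nhds.sub ((h3.mul_const _).div_const _)
  exact tendsto_nhds_unique h1 h2

lemma memLp_of_map_eq {Ω : Type*} [MeasurableSpace Ω] {P : Measure Ω} {X : Ω → ℝ} {v : ℝ≥0}
    (hX : AEMeasurable X P) (h : P.map X = gaussianReal 0 v) : MemLp X 2 P := by
  have h1 := memLp_id_gaussianReal' (μ := 0) (v := v) 2 (by simp)
  rw [← h] at h1
  exact (memLp_map_measure_iff aestronglyMeasurable_id hX).1 h1

lemma integral_sq_gaussianReal (v : ℝ≥0) : ∫ x, x * x ∂(gaussianReal 0 v) = v := by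
  have h := variance_id_gaussianReal (μ := 0) (v := v)
  rw [variance_of_integral_eq_zero aemeasurable_id (by simp [integral_id_gaussianReal])] at h
  rw [← h]
  exact integral_congr_ae (Eventually.of_forall fun x => (sq x).symm)

lemma integral_mul_self_of_map_eq {Ω : Type*} [MeasurableSpace Ω] {P : Measure Ω} {X : Ω → ℝ}
    {v : ℝ≥0} (hX : AEMeasurable X P) (h : P.map X = gaussianReal 0 v) :
    ∫ z, X z * X z ∂P = v := by
  rw [← integral_sq_gaussianReal v, ← h, integral_map hX (by fun_prop)]

/-! ### Uniqueness of the enstrophy measure -/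

lemma measurable_eval (f : TestFun) : Measurable fun η : SobBelowMinusOne => η.1 f :=
  (measurable_pi_apply f).comp (comap_measurable _)

lemma measurable_veval (Φ : TestField) : Measurable fun v : VSobBelowZero => v.1 Φ :=
  (measurable_pi_apply Φ).comp (comap_measurable _)

lemma IsEnstrophyMeasure.map_eq {μ : Measure SobBelowMinusOne} (hμ : IsEnstrophyMeasure μ)
    (f : TestFun) : μ.map (fun η => η.1 f) = gaussianReal 0 (l2 f f).toNNReal := by
  obtain ⟨v, hv⟩ := hμ.gaussian f
  rw [hv, ← hμ.covariance f f, integral_mul_self_of_map_eq (measurable_eval f).aemeasurable hv,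
    Real.toNNReal_coe]

lemma map_restrict_eq {μ ν : Measure SobBelowMinusOne} (hμ : IsEnstrophyMeasure μ)
    (hν : IsEnstrophyMeasure ν) (F : Finset TestFun) :
    μ.map (fun η (f : F) => η.1 f) = ν.map (fun η (f : F) => η.1 f) := by
  have := hμ.isProbability
  have := hν.isProbability
  classical
  have hm : Measurable fun (η : SobBelowMinusOne) (f : F) => η.1 f :=
    measurable_pi_lambda _ fun f => measurable_eval f
  refine Measure.ext_of_charFunDual ?_
  funext L
  have key : ∀ ρ : Measure SobBelowMinusOne, IsEnstrophyMeasure ρ →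
      charFunDual (ρ.map fun η (f : F) => η.1 f) L
        = charFun (gaussianReal 0 (l2 (∑ f : F, L (Pi.single f 1) • f.1)
          (∑ f : F, L (Pi.single f 1) • f.1)).toNNReal) 1 := by
    intro ρ hρ
    rw [charFunDual_eq_charFun_map_one, Measure.map_map (by fun_prop) hm, ← hρ.map_eq]
    congr 2
    funext η
    rw [Function.comp_apply, map_sum]
    have h : (fun f : F => η.1 f.1) = ∑ f : F, η.1 f.1 • (Pi.single f 1 : F → ℝ) := by
      funext g
      rw [Finset.sum_apply, Finset.sum_eq_single g]
      · simp
      · intro f _ hf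
        simp [Pi.single_eq_of_ne hf.symm]
      · simp
    rw [h, map_sum]
    refine Finset.sum_congr rfl fun f _ => ?_
    rw [map_smul, map_smul, smul_eq_mul, smul_eq_mul, mul_comm]
  rw [key μ hμ, key ν hν]

lemma IsEnstrophyMeasure.unique {μ ν : Measure SobBelowMinusOne} (hμ : IsEnstrophyMeasure μ)
    (hν : IsEnstrophyMeasure ν) : μ = ν := by
  have := hμ.isProbability
  have := hν.isProbability
  have hm : Measurable fun (η : SobBelowMinusOne) (f : TestFun) => η.1 f := comap_measurable _
  have hmap : μ.map (fun η (f : TestFun) => η.1 f) = ν.map (fun η (f : TestFun) => η.1 f) := by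
    have : ∀ F : Finset TestFun, IsFiniteMeasure
        ((μ.map fun η (f : TestFun) => η.1 f).map F.restrict) := fun F => inferInstance
    refine IsProjectiveLimit.unique (P := fun F : Finset TestFun =>
      (μ.map fun η (f : TestFun) => η.1 f).map F.restrict) (fun F => rfl) fun F => ?_
    beta_reduce
    rw [Measure.map_map (Finset.measurable_restrict F) hm,
      Measure.map_map (Finset.measurable_restrict F) hm]
    exact (map_restrict_eq hμ hν F).symm
  ext s hs
  obtain ⟨t, ht, rfl⟩ := hs
  rw [← Measure.map_apply hm ht, hmap, Measure.map_apply hm ht]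

/-! ### Existence of the enstrophy measure -/

lemma summable_card {s : ℝ} (hs : 1 < s) : Summable fun i : Idx => wt i.1 ^ (-s) := by
  obtain ⟨C, hC, h⟩ := card_le_of_orthonormal
  have := summable_weight_mul (fun i : Idx => i.1) (fun _ => 1) (fun _ => zero_le_one) (C := C)
    (α := 2) (fun F N hN hF => by
      rw [Finset.sum_const, nsmul_eq_mul, mul_one]
      exact h F (fun i => i.1) sh (fun i _ => sh_mem i) (fun i _ j _ => l2_sh i j) N hN hF)
    (s := s) (by push_cast; linarith)
  simpa using this

lemma summable_mul_coeff {t : Idx → ℝ} {s : ℝ} (ht : Summable fun i => wt i.1 ^ s * t i ^ 2)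
    (f : TestFun) : Summable fun i => t i * l2 f (sh i) := by
  have hf : Summable fun i : Idx => wt i.1 ^ (-s) * l2 f (sh i) ^ 2 :=
    scalarSys.summable_weighted (-s) f
  simpa only [mul_comm] using summable_mul_of_weighted (fun i : Idx => i.1) hf ht

open Classical in
/-- The distribution with the given coefficients. -/
def ofCoeff (t : Idx → ℝ) : Functional :=
  if h : ∀ f, Summable fun i => t i * l2 f (sh i) then
    { toFun := fun f => ∑' i, t i * l2 f (sh i)
      map_add' := fun f g => by
        simp only [l2_add_left, mul_add]
        exact (h f).tsum_add (h g)
      map_smul' := fun c f => by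
        simp only [l2_smul_left, mul_left_comm _ c, RingHom.id_apply, smul_eq_mul]
        exact tsum_mul_left }
  else 0

lemma hasSum_ofCoeff {t : Idx → ℝ} {s : ℝ} (ht : Summable fun i => wt i.1 ^ s * t i ^ 2)
    (f : TestFun) : HasSum (fun i => t i * l2 f (sh i)) (ofCoeff t f) := by
  rw [ofCoeff, dif_pos fun f => summable_mul_coeff ht f]
  exact (summable_mul_coeff ht f).hasSum

lemma ofCoeff_sh {t : Idx → ℝ} {s : ℝ} (ht : Summable fun i => wt i.1 ^ s * t i ^ 2)
    (i : Idx) : ofCoeff t (sh i) = t i := by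
  have h := hasSum_ofCoeff ht (sh i)
  refine h.unique ?_
  convert hasSum_ite_eq i (t i) using 2 with j
  rw [l2_sh]
  by_cases hij : i = j
  · rw [if_pos hij, if_pos hij.symm, mul_one, hij]
  · rw [if_neg hij, if_neg (Ne.symm hij), mul_zero]

lemma ofCoeff_mem {t : Idx → ℝ} {s : ℝ} (ht : Summable fun i => wt i.1 ^ s * t i ^ 2) :
    ofCoeff t ∈ Sob s := by
  rw [mem_Sob_iff]
  simp only [ofCoeff_sh ht]
  exact ⟨ht, hasSum_ofCoeff ht⟩

lemma Sob_mono {s t : ℝ} (h : s ≤ t) : Sob t ≤ Sob s := by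
  intro T hT
  obtain ⟨h1, h2⟩ := mem_Sob_iff.1 hT
  refine mem_Sob_iff.2 ⟨Summable.of_nonneg_of_le
    (fun i => mul_nonneg (wt_rpow_pos _ _).le (sq_nonneg _)) (fun i => ?_) h1, h2⟩
  exact mul_le_mul_of_nonneg_right (Real.rpow_le_rpow_of_exponent_le (one_le_wt _) h)
    (sq_nonneg _)

/-- The sequences of coefficients of distributions of order below `-1`. -/
def goodCoeff : Set (Idx → ℝ) :=
  {t | ∀ k : ℕ, Summable fun i => wt i.1 ^ (-1 - 1 / ((k : ℝ) + 1)) * t i ^ 2}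

lemma ofCoeff_mem_below {t : Idx → ℝ} (ht : t ∈ goodCoeff) : ofCoeff t ∈ SobBelowMinusOne := by
  simp only [SobBelowMinusOne, Submodule.mem_iInf]
  intro ε hε
  obtain ⟨k, hk⟩ := exists_nat_one_div_lt hε
  exact Sob_mono (by linarith) (ofCoeff_mem (ht k))

lemma summable_iff_tsum_ne_top {ι : Type*} {a : ι → ℝ} (ha : ∀ i, 0 ≤ a i) :
    Summable a ↔ ∑' i, ENNReal.ofReal (a i) ≠ (⊤ : ℝ≥0∞) := by
  constructor
  · exact fun h => h.tsum_ofReal_ne_top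
  · intro h
    have := ENNReal.summable_toReal h
    simpa only [ENNReal.toReal_ofReal (ha _)] using this

lemma measurableSet_goodCoeff : MeasurableSet goodCoeff := by
  have h : goodCoeff = ⋂ k : ℕ, {t | ∑' i : Idx,
      ENNReal.ofReal (wt i.1 ^ (-1 - 1 / ((k : ℝ) + 1)) * t i ^ 2) ≠ (⊤ : ℝ≥0∞)} := by
    ext t
    simp only [goodCoeff, Set.mem_ofPred_eq, Set.mem_iInter]
    exact forall_congr' fun k => summable_iff_tsum_ne_top fun i =>
      mul_nonneg (wt_rpow_pos _ _).le (sq_nonneg _)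
  rw [h]
  refine MeasurableSet.iInter fun k => ?_
  have hm : Measurable fun t : Idx → ℝ => ∑' i : Idx,
      ENNReal.ofReal (wt i.1 ^ (-1 - 1 / ((k : ℝ) + 1)) * t i ^ 2) :=
    Measurable.tsum fun i => by fun_prop
  exact hm (measurableSet_singleton _).compl

/-- The law of a sequence of independent standard Gaussian variables. -/
def gaussSeq : Measure (Idx → ℝ) := Measure.infinitePi fun _ => gaussianReal 0 1

instance : IsProbabilityMeasure gaussSeq := by unfold gaussSeq; infer_instance

lemma map_eval_gaussSeq (i : Idx) : gaussSeq.map (fun t => t i) = gaussianReal 0 1 :=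
  Measure.infinitePi_map_eval _ i

lemma ae_goodCoeff : ∀ᵐ t ∂gaussSeq, t ∈ goodCoeff := by
  simp only [goodCoeff, Set.mem_ofPred_eq]
  rw [ae_all_iff]
  intro k
  simp only [summable_iff_tsum_ne_top fun i : Idx => mul_nonneg (wt_rpow_pos _ _).le (sq_nonneg _)]
  set s : ℝ := 1 + 1 / ((k : ℝ) + 1) with hs
  have hs1 : 1 < s := by
    have : (0 : ℝ) < 1 / ((k : ℝ) + 1) := by positivity
    linarith
  have hs2 : -1 - 1 / ((k : ℝ) + 1) = -s := by rw [hs]; ring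
  rw [hs2]
  have hm : ∀ i : Idx, Measurable fun t : Idx → ℝ => ENNReal.ofReal (wt i.1 ^ (-s) * t i ^ 2) :=
    fun i => by fun_prop
  refine (ae_lt_top (Measurable.tsum hm) ?_).mono fun t ht => ht.ne
  rw [lintegral_tsum fun i => (hm i).aemeasurable]
  have hint : ∀ i : Idx, ∫⁻ t : Idx → ℝ, ENNReal.ofReal (wt i.1 ^ (-s) * t i ^ 2) ∂gaussSeq
      = ENNReal.ofReal (wt i.1 ^ (-s)) := by
    intro i
    have hL := memLp_of_map_eq (measurable_pi_apply i).aemeasurable (map_eval_gaussSeq i)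
    rw [← ofReal_integral_eq_lintegral_ofReal (hL.integrable_sq.const_mul _)
      (Eventually.of_forall fun t => mul_nonneg (wt_rpow_pos _ _).le (sq_nonneg _)),
      integral_const_mul]
    have h2 := integral_mul_self_of_map_eq (measurable_pi_apply i).aemeasurable (map_eval_gaussSeq i)
    simp only [← sq] at h2
    rw [h2, NNReal.coe_one, mul_one]
  simp only [hint]
  exact (summable_card hs1).tsum_ofReal_ne_top

open Classical in
/-- The random distribution with given coefficients. -/
def noise (t : Idx → ℝ) : SobBelowMinusOne :=
  if ht : t ∈ goodCoeff then ⟨ofCoeff t, ofCoeff_mem_below ht⟩ else 0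

lemma hasSum_noise {t : Idx → ℝ} (ht : t ∈ goodCoeff) (f : TestFun) :
    HasSum (fun i => t i * l2 f (sh i)) ((noise t).1 f) := by
  rw [noise, dif_pos ht]
  exact hasSum_ofCoeff (ht 0) f

/-- The indices of degree less than `n`. -/
def degLT (n : ℕ) : Finset Idx :=
  (Finset.range n).sigma fun _ => Finset.univ

lemma tendsto_degLT : Tendsto degLT atTop atTop := by
  refine tendsto_atTop_finset_of_monotone (fun m n h => ?_) fun i => ⟨i.1 + 1, ?_⟩
  · exact Finset.sigma_mono (Finset.range_mono h) fun _ => le_rfl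
  · simp [degLT]

lemma tendsto_noise {t : Idx → ℝ} (ht : t ∈ goodCoeff) (f : TestFun) :
    Tendsto (fun n => ∑ i ∈ degLT n, t i * l2 f (sh i)) atTop (𝓝 ((noise t).1 f)) :=
  (hasSum_noise ht f).comp tendsto_degLT

lemma measurable_noise : Measurable noise := by
  refine measurable_comap_iff.2 (measurable_pi_lambda _ fun f => ?_)
  refine measurable_of_tendsto_metrizable (f := fun n => goodCoeff.indicator
    fun t => ∑ i ∈ degLT n, t i * l2 f (sh i)) (fun n => ?_) ?_
  · refine Measurable.indicator ?_ measurableSet_goodCoeff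
    fun_prop
  · rw [tendsto_pi_nhds]
    intro t
    by_cases ht : t ∈ goodCoeff
    · simp only [Set.indicator_of_mem ht]
      exact tendsto_noise ht f
    · simp only [Set.indicator_of_notMem ht]
      have h : (noise t).1 f = 0 := by rw [noise, dif_neg ht]; rfl
      exact h ▸ tendsto_const_nhds

lemma map_sum_gaussSeq (F : Finset Idx) (c : Idx → ℝ) :
    gaussSeq.map (fun t => ∑ i ∈ F, t i * c i)
      = gaussianReal 0 (∑ i ∈ F, (c i ^ 2).toNNReal) := by
  classical
  have hind : iIndepFun (fun (i : Idx) (t : Idx → ℝ) => t i * c i) gaussSeq :=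
    iIndepFun_infinitePi (X := fun i x => x * c i) fun i => by fun_prop
  have hone : ∀ i, gaussSeq.map (fun t => t i * c i) = gaussianReal 0 (c i ^ 2).toNNReal := by
    intro i
    have h := gaussianReal_map_mul_const (μ := 0) (v := 1) (c i)
    rw [← map_eval_gaussSeq i, Measure.map_map (by fun_prop) (by fun_prop)] at h
    refine h.trans ?_
    rw [mul_zero, mul_one]
    congr 1
    ext
    simp [sq_nonneg]
  have hsum : ∀ F : Finset Idx, (fun t : Idx → ℝ => ∑ i ∈ F, t i * c i)
      = ∑ i ∈ F, fun t : Idx → ℝ => t i * c i := fun F => by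
    funext t; rw [Finset.sum_apply]
  induction F using Finset.induction_on with
  | empty => simp [Measure.map_const]
  | insert i F hi ih =>
    rw [Finset.sum_insert hi, add_comm, hsum, Finset.sum_insert hi, add_comm]
    have h := gaussianReal_add_gaussianReal_of_indepFun
      (hind.indepFun_finsetSum_of_notMem (fun i => by fun_prop) hi) (hsum F ▸ ih) (hone i)
    rwa [add_zero] at h

lemma map_noise_eval (f : TestFun) :
    gaussSeq.map (fun t => (noise t).1 f) = gaussianReal 0 (l2 f f).toNNReal := by
  refine map_eq_gaussianReal_of_tendsto (X := fun n t => ∑ i ∈ degLT n, t i * l2 f (sh i))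
    (fun n => Measurable.aemeasurable (by fun_prop)) ((measurable_eval f).comp measurable_noise).aemeasurable
    (fun n => map_sum_gaussSeq (degLT n) _) ?_ (ae_goodCoeff.mono fun t ht => tendsto_noise ht f)
  have h := (hasSum_l2 f f).comp tendsto_degLT
  have h2 := (continuous_real_toNNReal.tendsto _).comp h
  refine h2.congr fun n => ?_
  simp only [Function.comp_apply, ← sq]
  exact Real.toNNReal_sum_of_nonneg fun i _ => sq_nonneg _

lemma isEnstrophyMeasure_noise : IsEnstrophyMeasure (gaussSeq.map noise) := by
  have hmap : ∀ f : TestFun, (gaussSeq.map noise).map (fun η => η.1 f)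
      = gaussianReal 0 (l2 f f).toNNReal := fun f => by
    rw [Measure.map_map (measurable_eval f) measurable_noise]
    exact map_noise_eval f
  have hsq : ∀ f : TestFun, ∫ η : SobBelowMinusOne, η.1 f * η.1 f ∂(gaussSeq.map noise) = l2 f f :=
    fun f => by
      rw [integral_mul_self_of_map_eq (measurable_eval f).aemeasurable (hmap f),
        Real.coe_toNNReal _ (l2_self_nonneg f)]
  have hL : ∀ f : TestFun, MemLp (fun η : SobBelowMinusOne => η.1 f) 2 (gaussSeq.map noise) :=
    fun f => memLp_of_map_eq (measurable_eval f).aemeasurable (hmap f)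
  refine ⟨Measure.isProbabilityMeasure_map measurable_noise.aemeasurable,
    fun f => ⟨_, hmap f⟩, fun f g => ?_⟩
  have h1 := hsq (f + g)
  simp only [map_add] at h1
  have h2 : ∀ η : SobBelowMinusOne, (η.1 f + η.1 g) * (η.1 f + η.1 g)
      = η.1 f * η.1 f + (2 * (η.1 f * η.1 g) + η.1 g * η.1 g) := fun η => by ring
  have hi : ∀ f g : TestFun, Integrable (fun η : SobBelowMinusOne => η.1 f * η.1 g)
      (gaussSeq.map noise) := fun f g => (hL f).integrable_mul (hL g)
  simp only [h2] at h1
  rw [integral_add (g := fun η : SobBelowMinusOne => 2 * (η.1 f * η.1 g) + η.1 g * η.1 g)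
    (hi f f) (((hi f g).const_mul 2).add (hi g g)),
    integral_add ((hi f g).const_mul 2) (hi g g), integral_const_mul, hsq, hsq, l2_add_left,
    l2_comm f (f + g), l2_comm g (f + g), l2_add_left, l2_add_left, l2_comm g f] at h1
  linarith

/-! ### The Biot–Savart map -/

/-- The divergence-free field with a given curl. -/
def velocityOf (η : Functional) : VFunctional := -(η ∘ₗ lapInv ∘ₗ curlL)

lemma velocityOf_apply (η : Functional) (Φ : TestField) :
    velocityOf η Φ = -η (lapInv (curl Φ)) := rfl

lemma lapInv_sh (i : Idx) : lapInv (sh i) = (-(eigval i)⁻¹) • sh i := by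
  refine eq_of_coeff fun j => ?_
  rw [coeff_lapInv, l2_smul_left, l2_sh]
  by_cases h : i = j
  · rw [h]
  · simp [h]

lemma lapInv_curl_vsh_inr (i : Idx') :
    lapInv (curl (vsh (.inr i))) = (Real.sqrt (eigval i.1))⁻¹ • sh i.1 := by
  have hp := eigval_pos i.2
  have h2 := (Real.sqrt_pos.2 hp).ne'
  rw [curl_vsh_inr, map_smul, lapInv_sh, smul_smul, neg_mul_neg]
  congr 1
  rw [← div_eq_mul_inv, div_eq_iff hp.ne', inv_mul_eq_div, eq_div_iff h2, Real.mul_self_sqrt hp.le]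

lemma velocityOf_vsh_inl (η : Functional) (i : Idx') : velocityOf η (vsh (.inl i)) = 0 := by
  rw [velocityOf_apply, curl_vsh_inl, map_zero, map_zero, neg_zero]

lemma velocityOf_vsh_inr (η : Functional) (i : Idx') :
    velocityOf η (vsh (.inr i)) = -((Real.sqrt (eigval i.1))⁻¹ * η (sh i.1)) := by
  rw [velocityOf_apply, lapInv_curl_vsh_inr, map_smul, smul_eq_mul]

lemma wt_eq_eigval (i : Idx) : wt i.1 = 1 + eigval i := rfl

lemma two_le_eigval (i : Idx') : 2 ≤ eigval i.1 := two_le_veigval (.inr i)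

lemma inv_eigval_le (i : Idx') : (eigval i.1)⁻¹ ≤ 2 * wt i.1.1 ^ (-1 : ℝ) := by
  have h := two_le_eigval i
  rw [Real.rpow_neg_one, wt_eq_eigval, ← div_eq_mul_inv, inv_eq_one_div,
    div_le_div_iff₀ (by linarith) (by linarith)]
  linarith

lemma inv_sqrt_sq (i : Idx') : (Real.sqrt (eigval i.1))⁻¹ ^ 2 = (eigval i.1)⁻¹ := by
  rw [inv_pow, Real.sq_sqrt (eigval_pos i.2).le]

lemma velocityOf_mem {η : Functional} {ε : ℝ} (hη : η ∈ Sob (-1 - ε)) :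
    velocityOf η ∈ VSob (-ε) := by
  obtain ⟨h1, h2⟩ := mem_Sob_iff.1 hη
  rw [mem_VSob_iff]
  constructor
  · refine Summable.sum _ ?_ ?_
    · simp only [Function.comp_def, velocityOf_vsh_inl]
      simp
    · have h3 := (h1.comp_injective (Subtype.val_injective (p := fun i : Idx => i.1 ≠ 0))).mul_left 2
      refine Summable.of_nonneg_of_le (fun i => mul_nonneg (wt_rpow_pos _ _).le (sq_nonneg _))
        (fun i => ?_) h3
      simp only [Function.comp_apply]
      change wt i.1.1 ^ (-ε) * _ ≤ _
      rw [velocityOf_vsh_inr, neg_sq, mul_pow, inv_sqrt_sq, sub_eq_add_neg,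
        Real.rpow_add (wt_pos _)]
      have h4 := mul_le_mul_of_nonneg_right (inv_eigval_le i)
        (mul_nonneg (wt_rpow_pos i.1.1 (-ε)).le (sq_nonneg (η (sh i.1))))
      linarith
  · intro Φ
    rw [velocityOf_apply, ← zero_add (-η _)]
    refine HasSum.sum ?_ ?_
    · simp only [Function.comp_def, velocityOf_vsh_inl, zero_mul]
      exact hasSum_zero
    · have h3 := (h2 (lapInv (curl Φ))).neg
      have h0 : Function.support (fun i => -(η (sh i) * l2 (lapInv (curl Φ)) (sh i)))
          ⊆ {i | i.1 ≠ 0} := by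
        intro i hi h0
        refine hi ?_
        simp [coeff_lapInv, eigval, h0]
      rw [← hasSum_subtype_iff_of_support_subset h0] at h3
      have h4 : HasSum (fun i : Idx' => -(η (sh i.1) * l2 (lapInv (curl Φ)) (sh i.1)))
        (-η (lapInv (curl Φ))) := h3
      convert h4 using 2 with i
      rw [Function.comp_apply, velocityOf_vsh_inr, vcoeff_inr, coeff_lapInv, ← inv_sqrt_sq]
      ring

lemma velocityOf_mem_below {η : Functional} (hη : η ∈ SobBelowMinusOne) :
    velocityOf η ∈ VSobBelowZero := by
  simp only [SobBelowMinusOne, VSobBelowZero, Submodule.mem_iInf] at hη ⊢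
  exact fun ε hε => velocityOf_mem (hη ε hε)

lemma mem_VSob_of_below (v : VSobBelowZero) {ε : ℝ} (hε : 0 < ε) : v.1 ∈ VSob (-ε) := by
  have h := v.2
  simp only [VSobBelowZero, Submodule.mem_iInf] at h
  exact h ε hε

lemma isVelocityOf_velocityOf (η : Functional) : IsVelocityOf η (velocityOf η) := by
  refine ⟨fun f => ?_, fun f hf => ?_⟩
  · rw [velocityOf_apply, curl_grad, map_zero, map_zero, neg_zero]
  · rw [velocityOf_apply, neg_neg, curl_perpGrad, lapInv_lap hf]

lemma IsVelocityOf.unique {η : Functional} {u v : VFunctional} (hu : IsVelocityOf η u)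
    (hv : IsVelocityOf η v) : u = v := by
  refine VFunctional.ext_of_hodge (fun f => (hu.1 f).trans (hv.1 f).symm) fun f => ?_
  rw [← perpGrad_lapInv_lap]
  have h := (hu.2 _ (integral_lapInv (lap f))).trans (hv.2 _ (integral_lapInv (lap f))).symm
  exact neg_injective h

lemma biotSavart_val (η : SobBelowMinusOne) : (biotSavart η).1 = velocityOf η.1 := by
  have h : ∃ v : VSobBelowZero, IsVelocityOf η.1 v.1 :=
    ⟨⟨_, velocityOf_mem_below η.2⟩, isVelocityOf_velocityOf η.1⟩
  rw [biotSavart, dif_pos h]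
  exact h.choose_spec.unique (isVelocityOf_velocityOf η.1)

lemma measurable_biotSavart : Measurable biotSavart := by
  refine measurable_comap_iff.2 (measurable_pi_lambda _ fun Φ => ?_)
  simp only [Function.comp_apply, biotSavart_val, velocityOf_apply]
  exact (measurable_eval _).neg

/-! ### The law of the velocity -/

namespace IsEnstrophyMeasure

variable {μ : Measure SobBelowMinusOne}

lemma isProbability_velocityLaw (hμ : IsEnstrophyMeasure μ) : IsProbabilityMeasure (velocityLaw μ) :=
  have := hμ.isProbability
  Measure.isProbabilityMeasure_map measurable_biotSavart.aemeasurable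

lemma map_veval (hμ : IsEnstrophyMeasure μ) (Φ : TestField) : (velocityLaw μ).map (fun v => v.1 Φ)
    = gaussianReal 0 (l2 (lapInv (curl Φ)) (lapInv (curl Φ))).toNNReal := by
  rw [velocityLaw, Measure.map_map (measurable_veval Φ) measurable_biotSavart]
  have h : (fun v : VSobBelowZero => v.1 Φ) ∘ biotSavart
      = fun η => η.1 (-lapInv (curl Φ)) := by
    funext η
    rw [Function.comp_apply, biotSavart_val, velocityOf_apply, map_neg]
  have hn : ∀ f g : TestFun, l2 (-f) g = -l2 f g := fun f g => LinearMap.map_neg₂ l2B f g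
  rw [h, hμ.map_eq, hn, l2_comm, hn, neg_neg]

lemma integral_veval_mul (hμ : IsEnstrophyMeasure μ) (Φ Ψ : TestField) : ∫ v, v.1 Φ * v.1 Ψ ∂(velocityLaw μ)
    = l2 (lapInv (curl Φ)) (lapInv (curl Ψ)) := by
  have h := integral_map (μ := μ) measurable_biotSavart.aemeasurable
    ((measurable_veval Φ).mul (measurable_veval Ψ)).aestronglyMeasurable
  refine h.trans ?_
  rw [← hμ.covariance]
  simp only [Pi.mul_apply, biotSavart_val, velocityOf_apply, neg_mul_neg]

lemma memLp_veval (hμ : IsEnstrophyMeasure μ) (Φ : TestField) :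
    MemLp (fun v : VSobBelowZero => v.1 Φ) 2 (velocityLaw μ) :=
  memLp_of_map_eq (measurable_veval Φ).aemeasurable (hμ.map_veval Φ)

lemma ae_inl : ∀ᵐ v ∂(velocityLaw μ), ∀ i : Idx', v.1 (vsh (.inl i)) = 0 := by
  rw [ae_all_iff]
  intro i
  refine (ae_map_iff measurable_biotSavart.aemeasurable
    (measurable_veval _ (measurableSet_singleton 0))).2 ?_
  exact Eventually.of_forall fun η => by
    simp only [Set.mem_singleton_iff, biotSavart_val, velocityOf_vsh_inl]

/-- The evaluation of the velocity at a smooth field, as an element of `L²`. -/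
def velLp (hμ : IsEnstrophyMeasure μ) : TestField →ₗ[ℝ] Lp ℝ 2 (velocityLaw μ) where
  toFun Φ := (hμ.memLp_veval Φ).toLp
  map_add' Φ Ψ := by
    rw [← MemLp.toLp_add]
    exact MemLp.toLp_congr _ _ (Eventually.of_forall fun v => v.1.map_add Φ Ψ)
  map_smul' c Φ := by
    rw [RingHom.id_apply, ← MemLp.toLp_const_smul]
    exact MemLp.toLp_congr _ _ (Eventually.of_forall fun v => v.1.map_smul c Φ)

lemma coe_velLp (hμ : IsEnstrophyMeasure μ) (Φ : TestField) :
    hμ.velLp Φ =ᵐ[velocityLaw μ] fun v => v.1 Φ := MemLp.coeFn_toLp (hμ.memLp_veval Φ)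

lemma inner_velLp (hμ : IsEnstrophyMeasure μ) (Φ Ψ : TestField) :
    ⟪hμ.velLp Φ, hμ.velLp Ψ⟫ = l2 (lapInv (curl Φ)) (lapInv (curl Ψ)) := by
  rw [L2.inner_def, ← hμ.integral_veval_mul]
  refine integral_congr_ae ?_
  filter_upwards [hμ.coe_velLp Φ, hμ.coe_velLp Ψ] with v h1 h2
  rw [h1, h2]
  exact mul_comm _ _

/-- The evaluations at the divergence-free basis fields, normalized in `L²`. -/
def velBasis (hμ : IsEnstrophyMeasure μ) (i : Idx') : Lp ℝ 2 (velocityLaw μ) :=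
  Real.sqrt (eigval i.1) • hμ.velLp (vsh (.inr i))

lemma orthonormal_velBasis (hμ : IsEnstrophyMeasure μ) : Orthonormal ℝ hμ.velBasis := by
  rw [orthonormal_iff_ite]
  intro i j
  have hi := (Real.sqrt_pos.2 (eigval_pos i.2)).ne'
  have hj := (Real.sqrt_pos.2 (eigval_pos j.2)).ne'
  rw [velBasis, velBasis, real_inner_smul_left, real_inner_smul_right, inner_velLp,
    lapInv_curl_vsh_inr, lapInv_curl_vsh_inr, l2_smul_left, l2_smul_right, l2_sh]
  by_cases h : i = j
  · subst h
    simp only [if_true]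
    field_simp
  · rw [if_neg h, if_neg fun h' => h (Subtype.ext h')]; ring

lemma smul_velLp_eq (hμ : IsEnstrophyMeasure μ) (c : ℝ) (i : Idx') :
    c • hμ.velLp (vsh (.inr i)) = LinearIsometry.toSpanSingleton ℝ _
      (hμ.orthonormal_velBasis.1 i) ((Real.sqrt (eigval i.1))⁻¹ * c) := by
  have hi := (Real.sqrt_pos.2 (eigval_pos i.2)).ne'
  change _ = ((Real.sqrt (eigval i.1))⁻¹ * c) • (Real.sqrt (eigval i.1) • hμ.velLp _)
  rw [smul_smul]
  congr 1
  field_simp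

lemma norm_coeff_sq (c : ℝ) (i : Idx') :
    ‖(Real.sqrt (eigval i.1))⁻¹ * c‖ ^ 2 = (eigval i.1)⁻¹ * c ^ 2 := by
  rw [Real.norm_eq_abs, sq_abs, mul_pow, inv_sqrt_sq]

lemma summable_velLp (hμ : IsEnstrophyMeasure μ) {w : VFunctional} (hw : w ∈ VSob (-1)) :
    Summable fun i : Idx' => w (vsh (.inr i)) • hμ.velLp (vsh (.inr i)) := by
  simp only [smul_velLp_eq]
  rw [hμ.orthonormal_velBasis.orthogonalFamily.summable_iff_norm_sq_summable]
  simp only [norm_coeff_sq]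
  exact (hasSum_variance hw).summable

/-- The pairing of the random velocity with a field of order `-1`. -/
def pairing (hμ : IsEnstrophyMeasure μ) : VSob (-1) →ₗ[ℝ] Lp ℝ 2 (velocityLaw μ) where
  toFun w := ∑' i : Idx', w.1 (vsh (.inr i)) • hμ.velLp (vsh (.inr i))
  map_add' w u := by
    rw [← (hμ.summable_velLp w.2).tsum_add (hμ.summable_velLp u.2)]
    exact tsum_congr fun i => add_smul _ _ _
  map_smul' c w := by
    rw [RingHom.id_apply, ← (hμ.summable_velLp w.2).tsum_const_smul]
    exact tsum_congr fun i => mul_smul _ _ _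

lemma hasSum_pairing (hμ : IsEnstrophyMeasure μ) (w : VSob (-1)) :
    HasSum (fun i : Idx' => w.1 (vsh (.inr i)) • hμ.velLp (vsh (.inr i))) (hμ.pairing w) :=
  (hμ.summable_velLp w.2).hasSum

lemma norm_pairing_sq (hμ : IsEnstrophyMeasure μ) (w : VSob (-1)) :
    ‖hμ.pairing w‖ ^ 2 = ∑' i : Idx', (eigval i.1)⁻¹ * w.1 (vsh (.inr i)) ^ 2 := by
  have h1 := ((hμ.hasSum_pairing w).norm).pow 2
  refine tendsto_nhds_unique h1 ?_
  refine (hasSum_variance w.2).summable.hasSum.congr fun F => ?_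
  simp only [smul_velLp_eq]
  rw [hμ.orthonormal_velBasis.orthogonalFamily.norm_sum]
  simp only [norm_coeff_sq]

lemma enorm_pairing_le (hμ : IsEnstrophyMeasure μ) (w : VSob (-1)) :
    ‖hμ.pairing w‖ₑ ≤ (2 : ℝ≥0) * vnorm (-1) w.1 := by
  obtain ⟨h1, -⟩ := mem_VSob_iff.1 w.2
  rw [vnorm_eq w.2, ← ofReal_norm, ← ENNReal.ofReal_coe_nnreal,
    ← ENNReal.ofReal_mul (NNReal.coe_nonneg _)]
  refine ENNReal.ofReal_le_ofReal (abs_le_of_sq_le_sq' ?_ (by positivity)).2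
  have h0 : (0 : ℝ) ≤ ∑' i : VIdx, wt (vdeg i) ^ (-1 : ℝ) * w.1 (vsh i) ^ 2 :=
    tsum_nonneg fun i => mul_nonneg (wt_rpow_pos _ _).le (sq_nonneg _)
  rw [norm_pairing_sq, mul_pow, Real.sq_sqrt h0]
  set a : VIdx → ℝ := fun i => wt (vdeg i) ^ (-1 : ℝ) * w.1 (vsh i) ^ 2
  have h2 : Summable fun i : Idx' => a (.inr i) := h1.comp_injective Sum.inr_injective
  have h3 : ∑' i : Idx', a (.inr i) ≤ ∑' i : VIdx, a i :=
    tsum_comp_le_tsum_of_inj h1 (fun i => mul_nonneg (wt_rpow_pos _ _).le (sq_nonneg _))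
      Sum.inr_injective
  have h4 : ∑' i : Idx', (eigval i.1)⁻¹ * w.1 (vsh (.inr i)) ^ 2
      ≤ ∑' i : Idx', 2 * a (.inr i) := by
    refine (hasSum_variance w.2).summable.tsum_le_tsum (fun i => ?_) (h2.mul_left 2)
    have h5 := mul_le_mul_of_nonneg_right (inv_eigval_le i) (sq_nonneg (w.1 (vsh (.inr i))))
    rwa [mul_assoc] at h5
  rw [tsum_mul_left] at h4
  have h5 : ((2 : ℝ≥0) : ℝ) ^ 2 = 4 := by norm_num
  rw [h5]
  linarith

lemma exists_seq_pairing (hμ : IsEnstrophyMeasure μ) (w : VSob (-1)) :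
    ∃ ns : ℕ → Finset Idx', Tendsto ns atTop atTop ∧ ∀ᵐ v ∂(velocityLaw μ),
      Tendsto (fun n => v.1 (∑ i ∈ ns n, w.1 (vsh (.inr i)) • vsh (.inr i))) atTop
        (𝓝 (hμ.pairing w v)) := by
  have h1 : Tendsto (fun F : Finset Idx' => hμ.velLp (∑ i ∈ F, w.1 (vsh (.inr i)) • vsh (.inr i)))
      atTop (𝓝 (hμ.pairing w)) := by
    simp only [map_sum, map_smul]
    exact hμ.hasSum_pairing w
  obtain ⟨ns, h2, h3⟩ := (tendstoInMeasure_of_tendsto_Lp h1).exists_seq_tendsto_ae'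
  refine ⟨ns, h2, ?_⟩
  have h4 := ae_all_iff.2 fun n =>
    hμ.coe_velLp (∑ i ∈ ns n, w.1 (vsh (.inr i)) • vsh (.inr i))
  filter_upwards [h3, h4] with v h5 h6
  exact h5.congr h6

lemma pairing_eq_dualPairing (hμ : IsEnstrophyMeasure μ) {ε : ℝ} (hε : 0 < ε) (w : VSob (-1))
    (hw : w.1 ∈ VSob ε) : hμ.pairing w =ᵐ[velocityLaw μ] fun v => dualPairing ε v.1 w.1 := by
  obtain ⟨ns, h1, h2⟩ := hμ.exists_seq_pairing w
  filter_upwards [h2, ae_inl] with v h3 h4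
  refine tendsto_nhds_unique h3 ?_
  have hv := mem_VSob_of_below v hε
  rw [dualPairing_eq hv hw]
  have hs := summable_pairing hv hw
  set a : VIdx → ℝ := fun i => v.1 (vsh i) * w.1 (vsh i)
  have hr : Summable fun i : Idx' => a (.inr i) := hs.comp_injective Sum.inr_injective
  have h5 : HasSum a (0 + ∑' i : Idx', a (.inr i)) := by
    refine HasSum.sum ?_ hr.hasSum
    have h0 : a ∘ Sum.inl = fun _ => 0 := funext fun i => by
      change v.1 (vsh (.inl i)) * w.1 (vsh (.inl i)) = 0
      rw [h4, zero_mul]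
    rw [h0]
    exact hasSum_zero
  rw [h5.tsum_eq, zero_add]
  have h6 : Tendsto (fun n => ∑ i ∈ ns n, a (.inr i)) atTop (𝓝 (∑' i : Idx', a (.inr i))) :=
    hr.hasSum.comp h1
  refine h6.congr fun n => ?_
  rw [map_sum]
  refine Finset.sum_congr rfl fun i _ => ?_
  rw [map_smul, smul_eq_mul, mul_comm]

lemma dualPairing_toFunctional (v : VSobBelowZero) {ε : ℝ} (hε : 0 < ε) (Φ : TestField) :
    dualPairing ε v.1 (toFunctional Φ) = v.1 Φ := by
  have hv := mem_VSob_of_below v hε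
  rw [dualPairing_eq hv (toFunctional_mem Φ ε)]
  exact ((mem_VSob_iff.1 hv).2 Φ).tsum_eq

lemma isPairingExtension_pairing (hμ : IsEnstrophyMeasure μ) :
    IsPairingExtension (velocityLaw μ) hμ.pairing :=
  ⟨fun _ hε w hw => hμ.pairing_eq_dualPairing hε w hw, 2, hμ.enorm_pairing_le⟩

lemma isCenteredGaussian_pairing (hμ : IsEnstrophyMeasure μ) (w : VSob (-1)) :
    IsCenteredGaussian (velocityLaw μ) (hμ.pairing w)
      (dualPairing 1 w.1 (invLap (leray w.1))) := by
  have := hμ.isProbability_velocityLaw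
  have hs := hasSum_variance w.2
  have hn : ∀ i : Idx', 0 ≤ (eigval i.1)⁻¹ * w.1 (vsh (.inr i)) ^ 2 := fun i =>
    mul_nonneg (inv_nonneg.2 (eigval_pos i.2).le) (sq_nonneg _)
  obtain ⟨ns, h1, h2⟩ := hμ.exists_seq_pairing w
  refine ⟨hs.nonneg hn, (Lp.aestronglyMeasurable _).aemeasurable, ?_⟩
  refine map_eq_gaussianReal_of_tendsto (fun n => (measurable_veval _).aemeasurable)
    (Lp.aestronglyMeasurable _).aemeasurable (fun n => hμ.map_veval _) ?_ h2
  refine (continuous_real_toNNReal.tendsto _).comp ((hs.comp h1).congr fun n => ?_)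
  rw [← inner_velLp hμ, map_sum, real_inner_self_eq_norm_sq]
  simp only [map_smul, smul_velLp_eq]
  rw [hμ.orthonormal_velBasis.orthogonalFamily.norm_sum]
  simp only [norm_coeff_sq, Function.comp_apply]

end IsEnstrophyMeasure

lemma IsPairingExtension.apply_toFunctional {ξ : Measure VSobBelowZero}
    {J : VSob (-1) →ₗ[ℝ] Lp ℝ 2 ξ} (hJ : IsPairingExtension ξ J) (Φ : TestField) :
    J ⟨toFunctional Φ, toFunctional_mem Φ (-1)⟩ =ᵐ[ξ] fun v => v.1 Φ := by
  refine (hJ.1 1 one_pos _ (toFunctional_mem Φ 1)).trans (Eventually.of_forall fun v => ?_)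
  exact IsEnstrophyMeasure.dualPairing_toFunctional v one_pos Φ

lemma tendsto_const_mul_vnorm (C : ℝ≥0) (s : ℝ) (w : VFunctional) :
    Tendsto (fun Φ => (C : ℝ≥0∞) * vnorm s (toFunctional Φ - w)) (approaching s w) (𝓝 0) := by
  have h := ENNReal.Tendsto.const_mul (a := (C : ℝ≥0∞))
    (tendsto_comap : Tendsto (fun Φ => vnorm s (toFunctional Φ - w)) (approaching s w) (𝓝 0))
    (Or.inr ENNReal.coe_ne_top)
  rwa [mul_zero] at h

lemma IsPairingExtension.tendsto_enorm {ξ : Measure VSobBelowZero}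
    {J : VSob (-1) →ₗ[ℝ] Lp ℝ 2 ξ} (hJ : IsPairingExtension ξ J) (w : VSob (-1)) :
    Tendsto (fun Φ => ‖J ⟨toFunctional Φ, toFunctional_mem Φ (-1)⟩ - J w‖ₑ)
      (approaching (-1) w.1) (𝓝 0) := by
  obtain ⟨-, C, hC⟩ := hJ
  refine tendsto_of_tendsto_of_tendsto_of_le_of_le tendsto_const_nhds
    (tendsto_const_mul_vnorm C (-1) w.1) (fun _ => zero_le) fun Φ => ?_
  rw [← map_sub]
  exact hC _

lemma IsPairingExtension.unique {ξ : Measure VSobBelowZero}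
    {J J' : VSob (-1) →ₗ[ℝ] Lp ℝ 2 ξ} (hJ : IsPairingExtension ξ J)
    (hJ' : IsPairingExtension ξ J') : J' = J := by
  ext1 w
  have hne := approaching_neBot w.2
  have h := fun (K : VSob (-1) →ₗ[ℝ] Lp ℝ 2 ξ) (hK : IsPairingExtension ξ K) =>
    (tendsto_iff_edist_tendsto_0 (l := approaching (-1) w.1)
      (f := fun Φ => K ⟨toFunctional Φ, toFunctional_mem Φ (-1)⟩) (y := K w)).2 (by
        simp only [edist_eq_enorm_sub]
        exact hK.tendsto_enorm w)
  refine tendsto_nhds_unique (h J' hJ') ((h J hJ).congr fun Φ => ?_)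
  exact Lp.ext ((hJ.apply_toFunctional Φ).trans (hJ'.apply_toFunctional Φ).symm)

lemma IsPairingExtension.tendsto_eLpNorm {ξ : Measure VSobBelowZero}
    {J : VSob (-1) →ₗ[ℝ] Lp ℝ 2 ξ} (hJ : IsPairingExtension ξ J) (w : VSob (-1)) :
    Tendsto (fun Φ : TestField => eLpNorm (fun v : VSobBelowZero => v.1 Φ - J w v) 2 ξ)
      (approaching (-1) w.1) (𝓝 0) := by
  refine (hJ.tendsto_enorm w).congr fun Φ => ?_
  rw [Lp.enorm_def]
  refine eLpNorm_congr_ae ?_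
  filter_upwards [hJ.apply_toFunctional Φ,
    Lp.coeFn_sub (J ⟨toFunctional Φ, toFunctional_mem Φ (-1)⟩) (J w)] with v h1 h2
  rw [h2, Pi.sub_apply, h1]

/-! ### Boundary curves are locally bi-Lipschitz -/

lemma mul_sub_le_of_monotoneOn {h : ℝ → ℝ} {K : ℝ≥0} (hK : LipschitzWith K h) {t u κ : ℝ}
    (htu : t ≤ u) (hm : MonotoneOn h (Set.Icc t u))
    (hκ : ∀ᵐ s ∂(volume.restrict (Set.Icc t u)), κ ≤ |deriv h s|) :
    κ * (u - t) ≤ h u - h t := by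
  have hac := (hK.lipschitzOnWith (s := Set.uIcc t u)).absolutelyContinuousOnInterval
  have hint : IntervalIntegrable (deriv h) volume t u := hac.intervalIntegrable_deriv
  rw [← hac.integral_deriv_eq_sub]
  have h1 : ∫ _ in t..u, κ = κ * (u - t) := by
    rw [intervalIntegral.integral_const, smul_eq_mul, mul_comm]
  rw [← h1]
  refine intervalIntegral.integral_mono_ae_restrict htu intervalIntegrable_const hint ?_
  have h2 : ∀ᵐ s ∂(volume.restrict (Set.Icc t u)), s ∈ Set.Ioo t u := by
    rw [← restrict_Ioo_eq_restrict_Icc]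
    exact ae_restrict_mem measurableSet_Ioo
  filter_upwards [hκ, h2] with s h3 h4
  have h5 := (hm.mono Set.Ioo_subset_Icc_self).derivWithin_nonneg (x := s)
  rw [derivWithin_of_isOpen isOpen_Ioo h4] at h5
  rwa [abs_of_nonneg h5] at h3

lemma mul_sub_le_of_injOn {h : ℝ → ℝ} {K : ℝ≥0} (hK : LipschitzWith K h) {t u κ : ℝ}
    (htu : t ≤ u) (hi : Set.InjOn h (Set.Icc t u))
    (hκ : ∀ᵐ s ∂(volume.restrict (Set.Icc t u)), κ ≤ |deriv h s|) :
    κ * (u - t) ≤ |h u - h t| := by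
  rcases hK.continuous.continuousOn.strictMonoOn_of_injOn_Icc' htu hi with hm | hm
  · exact (mul_sub_le_of_monotoneOn hK htu hm.monotoneOn hκ).trans (le_abs_self _)
  · have hκ' : ∀ᵐ s ∂(volume.restrict (Set.Icc t u)), κ ≤ |deriv (-h) s| := by
      filter_upwards [hκ] with s hs
      rwa [deriv.neg', abs_neg]
    have h1 := mul_sub_le_of_monotoneOn hK.neg htu hm.antitoneOn.neg hκ'
    refine h1.trans ?_
    rw [abs_sub_comm]
    refine le_trans (le_of_eq ?_) (le_abs_self _)
    simp only [Pi.neg_apply]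
    ring

lemma norm_deriv_le_mul_abs_deriv {c : ℝ → E3} {h : ℝ → ℝ} {s C : ℝ}
    (hc : DifferentiableAt ℝ c s) (hh : DifferentiableAt ℝ h s)
    (hle : ∀ᶠ u in 𝓝 s, ‖c u - c s‖ ≤ C * |h u - h s|) :
    ‖deriv c s‖ ≤ C * |deriv h s| := by
  have h1 := (hasDerivAt_iff_tendsto_slope.1 hc.hasDerivAt).norm
  have h2 := ((hasDerivAt_iff_tendsto_slope.1 hh.hasDerivAt).norm).const_mul C
  refine le_of_tendsto_of_tendsto h1 h2 ?_
  filter_upwards [hle.filter_mono nhdsWithin_le_nhds] with u hu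
  rw [slope_def_module, slope_def_module, norm_smul, norm_smul, mul_left_comm]
  exact mul_le_mul_of_nonneg_left hu (norm_nonneg _)

lemma sum_sq_sub_le {x1 x2 x3 y1 y2 y3 L : ℝ} (hL : 0 ≤ L)
    (hnx : 1 ^ 2 = x1 ^ 2 + x2 ^ 2 + x3 ^ 2) (hny : 1 ^ 2 = y1 ^ 2 + y2 ^ 2 + y3 ^ 2)
    (hx3 : 1 / 2 < x3) (hy3 : 1 / 2 < y3) (hx1 : -1 ≤ x1 ∧ x1 ≤ 1) (hy1 : -1 ≤ y1 ∧ y1 ≤ 1)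
    (hx2 : -1 ≤ x2 ∧ x2 ≤ 1) (hy2 : -1 ≤ y2 ∧ y2 ≤ 1) (hlip : |x2 - y2| ≤ L * |x1 - y1|) :
    (x1 - y1) ^ 2 + (x2 - y2) ^ 2 + (x3 - y3) ^ 2 ≤ (3 + 3 * L) ^ 2 * (x1 - y1) ^ 2 := by
  have h3 : |x3 - y3| ≤ 2 * |x1 - y1| + 2 * |x2 - y2| := by
    have h4 : (x3 - y3) * (x3 + y3) = -((x1 - y1) * (x1 + y1) + (x2 - y2) * (x2 + y2)) := by
      linear_combination hny - hnx
    have h5 : |x3 - y3| * (x3 + y3) ≤ |x1 - y1| * 2 + |x2 - y2| * 2 := by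
      rw [← abs_of_pos (show 0 < x3 + y3 by linarith), ← abs_mul, h4, abs_neg]
      refine (abs_add_le _ _).trans (add_le_add ?_ ?_) <;> rw [abs_mul] <;>
        exact mul_le_mul_of_nonneg_left (abs_le.2 ⟨by linarith, by linarith⟩) (abs_nonneg _)
    have h6 := mul_le_mul_of_nonneg_left (show 1 ≤ x3 + y3 by linarith) (abs_nonneg (x3 - y3))
    linarith
  rw [← sq_abs (x1 - y1), ← sq_abs (x2 - y2), ← sq_abs (x3 - y3)]
  set a1 := |x1 - y1|
  have h6 : |x3 - y3| ≤ (2 + 2 * L) * a1 := by linarith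
  have h7 := pow_le_pow_left₀ (abs_nonneg _) h6 2
  have h8 := pow_le_pow_left₀ (abs_nonneg _) hlip 2
  have h10 : 1 + L ^ 2 + (2 + 2 * L) ^ 2 ≤ (3 + 3 * L) ^ 2 := by nlinarith
  have h11 := mul_le_mul_of_nonneg_right h10 (sq_nonneg a1)
  rw [mul_pow] at h7 h8
  linarith

/-- Near a boundary point, the first coordinate controls the position on the boundary. -/
lemma HasLipschitzBoundary.exists_coordinate {A : Set S2} (hA : HasLipschitzBoundary A)
    (ho : IsOpen A) {p : S2} (hp : p ∈ frontier A) :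
    ∃ (e : E3) (r C : ℝ), ‖e‖ = 1 ∧ 0 < r ∧ 0 < C ∧ ∀ x ∈ frontier A, ∀ y ∈ frontier A,
      dist x p < r → dist y p < r → ‖(x : E3) - y‖ ≤ C * |⟪e, (x : E3)⟫ - ⟪e, (y : E3)⟫| := by
  obtain ⟨e₁, e₂, h1, h2, h12, h1p, h2p, r, L, g, hr, hg, hgr⟩ := hA p hp
  have hcont : ∀ e : E3, Continuous fun x : S2 => ⟪e, (x : E3)⟫ := fun e => by fun_prop
  have hgraph : ∀ x ∈ frontier A, dist x p < r → ⟪e₂, (x : E3)⟫ = g ⟪e₁, (x : E3)⟫ := by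
    intro x hx hxp
    have hxA : x ∉ A := by
      rw [ho.frontier_eq] at hx
      exact hx.2
    refine le_antisymm (not_lt.1 fun h => hxA ((hgr x hxp).2 h)) (not_lt.1 fun h => ?_)
    have hU : IsOpen {y : S2 | dist y p < r ∧ ⟪e₂, (y : E3)⟫ < g ⟪e₁, (y : E3)⟫} :=
      (isOpen_lt (continuous_id.dist continuous_const) continuous_const).and
        (isOpen_lt (hcont e₂) (hg.continuous.comp (hcont e₁)))
    obtain ⟨y, hy, hyA⟩ := mem_closure_iff.1 hx.1 _ hU ⟨hxp, h⟩
    exact absurd ((hgr y hy.1).1 hyA) (not_lt.2 hy.2.le)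
  have hon : Orthonormal ℝ ![e₁, e₂, (p : E3)] := by
    rw [orthonormal_iff_ite]
    have hpp : ⟪(p : E3), (p : E3)⟫ = 1 := by
      rw [real_inner_self_eq_norm_sq, norm_coe_sphere]; norm_num
    intro i j
    fin_cases i <;> fin_cases j <;>
      simp [h1, h2, h12, h1p, h2p, real_inner_comm]
  let b := (basisOfOrthonormalOfCardEqFinrank hon (by simp)).toOrthonormalBasis (by
    rw [coe_basisOfOrthonormalOfCardEqFinrank]; exact hon)
  have hb : ⇑b = ![e₁, e₂, (p : E3)] := by
    simp [b]
  have hnorm : ∀ z : E3, ‖z‖ ^ 2 = ⟪e₁, z⟫ ^ 2 + ⟪e₂, z⟫ ^ 2 + ⟪(p : E3), z⟫ ^ 2 := by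
    intro z
    have h := b.sum_sq_inner_right z
    rw [Fin.sum_univ_three, hb] at h
    simpa using h.symm
  have hL : (0 : ℝ) ≤ L := L.2
  refine ⟨e₁, min r 1, 3 + 3 * (L : ℝ), h1, lt_min hr one_pos, by positivity, ?_⟩
  intro x hx y hy hxp hyp
  have hxr := hgraph x hx (hxp.trans_le (min_le_left _ _))
  have hyr := hgraph y hy (hyp.trans_le (min_le_left _ _))
  have hx1 := hxp.trans_le (min_le_right _ _)
  have hy1 := hyp.trans_le (min_le_right _ _)
  have hthird : ∀ z : S2, dist z p < 1 → 1 / 2 < ⟪(p : E3), (z : E3)⟫ := by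
    intro z hz
    have h3 : ‖(z : E3) - p‖ < 1 := by rwa [← dist_eq_norm, ← Subtype.dist_eq]
    have h4 := norm_sub_sq_real (z : E3) (p : E3)
    rw [norm_coe_sphere, norm_coe_sphere, real_inner_comm] at h4
    nlinarith [norm_nonneg ((z : E3) - p)]
  have hx3 := hthird x hx1
  have hy3 := hthird y hy1
  have hnx := hnorm x
  have hny := hnorm y
  rw [norm_coe_sphere] at hnx hny
  have hd := hnorm ((x : E3) - y)
  simp only [inner_sub_right] at hd
  have hlip : |⟪e₂, (x : E3)⟫ - ⟪e₂, (y : E3)⟫| ≤ L * |⟪e₁, (x : E3)⟫ - ⟪e₁, (y : E3)⟫| := by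
    rw [hxr, hyr]
    exact hg.dist_le_mul _ _
  have hb1 : ∀ e : E3, ‖e‖ = 1 → ∀ z : S2, |⟪e, (z : E3)⟫| ≤ 1 := fun e he z => by
    have := abs_real_inner_le_norm e (z : E3)
    rwa [he, norm_coe_sphere, one_mul] at this
  have hx1' := abs_le.1 (hb1 e₁ h1 x)
  have hy1' := abs_le.1 (hb1 e₁ h1 y)
  have hx2' := abs_le.1 (hb1 e₂ h2 x)
  have hy2' := abs_le.1 (hb1 e₂ h2 y)
  refine abs_le_of_sq_le_sq' ?_ (by positivity) |>.2
  rw [hd, mul_pow, sq_abs]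
  exact sum_sq_sub_le hL hnx hny hx3 hy3 hx1' hy1' hx2' hy2' hlip

lemma exists_local_occupation {A : Set S2} (hA : HasLipschitzBoundary A) (ho : IsOpen A)
    {c : ℝ → S2} {L : ℝ≥0} (hc : LipschitzWith L c) {a b κ : ℝ} (hκ : 0 < κ)
    (hreg : ∀ᵐ t ∂(volume.restrict (Set.Icc a b)), κ ≤ ‖deriv (fun τ => (c τ : E3)) t‖)
    (hinj : Set.InjOn c (Set.Ico a b)) (hbd : ∀ t ∈ Set.Icc a b, c t ∈ frontier A)
    {t₀ : ℝ} (ht₀ : t₀ ∈ Set.Icc a b) :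
    ∃ δ K : ℝ, 0 < δ ∧ 0 ≤ K ∧ ∀ (y : E3) (r : ℝ), 0 < r →
      volume {t ∈ Metric.ball t₀ δ ∩ Set.Ioo a b | dist (c t : E3) y < r}
        ≤ ENNReal.ofReal (K * r) := by
  obtain ⟨e, ρ, C, he, hρ, hC, hcoord⟩ := hA.exists_coordinate ho (hbd t₀ ht₀)
  obtain ⟨δ, hδ, hball⟩ := Metric.continuousAt_iff.1 (hc.continuous.continuousAt (x := t₀)) ρ hρ
  set I : Set ℝ := Metric.ball t₀ δ ∩ Set.Ioo a b with hI
  have hIo : IsOpen I := Metric.isOpen_ball.inter isOpen_Ioo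
  have hIc : I.OrdConnected := by
    rw [hI, Real.ball_eq_Ioo]
    exact Set.ordConnected_Ioo.inter Set.ordConnected_Ioo
  have hCle : ∀ s ∈ I, ∀ u ∈ I, ‖(c s : E3) - c u‖ ≤ C * |⟪e, (c s : E3)⟫ - ⟪e, (c u : E3)⟫| :=
    fun s hs u hu => hcoord _ (hbd s (Set.Ioo_subset_Icc_self hs.2)) _
      (hbd u (Set.Ioo_subset_Icc_self hu.2)) (hball hs.1) (hball hu.1)
  have hcl : LipschitzWith L fun t => (c t : E3) := LipschitzWith.of_dist_le_mul fun s u =>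
    hc.dist_le_mul s u
  have hsub : ∀ s u, |⟪e, (c s : E3)⟫ - ⟪e, (c u : E3)⟫| ≤ ‖(c s : E3) - c u‖ := fun s u => by
    rw [← inner_sub_right]
    have := abs_real_inner_le_norm e ((c s : E3) - c u)
    rwa [he, one_mul] at this
  have hhl : LipschitzWith L fun t => ⟪e, (c t : E3)⟫ := LipschitzWith.of_dist_le_mul fun s u => by
    rw [Real.dist_eq]
    refine (hsub s u).trans ?_
    rw [← dist_eq_norm]
    exact hcl.dist_le_mul s u
  have hgrow : ∀ t ∈ I, ∀ u ∈ I, t ≤ u → κ / C * (u - t) ≤ ‖(c u : E3) - c t‖ := by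
    intro t ht u hu htu
    have hsubI : Set.Icc t u ⊆ I := hIc.out ht hu
    refine (mul_sub_le_of_injOn hhl htu ?_ ?_).trans (hsub u t)
    · intro s hs s' hs' hss
      have h1 := hCle s (hsubI hs) s' (hsubI hs')
      have h2 : ⟪e, (c s : E3)⟫ - ⟪e, (c s' : E3)⟫ = 0 := sub_eq_zero.2 hss
      rw [h2, abs_zero, mul_zero] at h1
      have h3 : (c s : E3) = c s' := sub_eq_zero.1 (norm_le_zero_iff.1 h1)
      exact hinj (Set.Ioo_subset_Ico_self (hsubI hs).2) (Set.Ioo_subset_Ico_self (hsubI hs').2)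
        (Subtype.ext h3)
    · have hreg' := ae_mono (Measure.restrict_mono_set volume
        (hsubI.trans (Set.inter_subset_right.trans Set.Ioo_subset_Icc_self))) hreg
      filter_upwards [hreg', ae_restrict_mem measurableSet_Icc,
        ae_restrict_of_ae hcl.ae_differentiableAt_real,
        ae_restrict_of_ae hhl.ae_differentiableAt_real] with s h1 h2 h3 h4
      have h5 := norm_deriv_le_mul_abs_deriv h3 h4 (C := C) (by
        filter_upwards [hIo.mem_nhds (hsubI h2)] with v hv
        exact hCle v hv s (hsubI h2))
      rw [div_le_iff₀' hC]
      exact h1.trans h5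
  refine ⟨δ, 2 * C / κ, hδ, by positivity, fun y r hr => ?_⟩
  refine (Real.volume_le_diam _).trans (Metric.ediam_le fun t ht u hu => ?_)
  rw [edist_dist]
  refine ENNReal.ofReal_le_ofReal ?_
  have hwlog : ∀ t u, t ∈ I → u ∈ I → dist (c t : E3) y < r → dist (c u : E3) y < r → t ≤ u →
      dist t u ≤ 2 * C / κ * r := by
    intro t u ht hu h1 h2 htu
    have h3 := hgrow t ht u hu htu
    have h4 : ‖(c u : E3) - c t‖ ≤ 2 * r := by
      rw [← dist_eq_norm]
      have := dist_triangle_right (c u : E3) (c t : E3) y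
      linarith
    rw [Real.dist_eq, abs_sub_comm, abs_of_nonneg (sub_nonneg.2 htu), div_mul_eq_mul_div,
      le_div_iff₀ hκ]
    have h5 := h3.trans h4
    rw [div_mul_eq_mul_div, div_le_iff₀ hC] at h5
    linarith
  rcases le_total t u with h | h
  · exact hwlog t u ht.1 hu.1 ht.2 hu.2 h
  · rw [dist_comm]
    exact hwlog u t hu.1 ht.1 hu.2 ht.2 h

lemma exists_occupation {A : Set S2} (hA : HasLipschitzBoundary A) (ho : IsOpen A)
    {c : ℝ → S2} {L : ℝ≥0} (hc : LipschitzWith L c) {a b κ : ℝ} (hκ : 0 < κ)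
    (hreg : ∀ᵐ t ∂(volume.restrict (Set.Icc a b)), κ ≤ ‖deriv (fun τ => (c τ : E3)) t‖)
    (hinj : Set.InjOn c (Set.Ico a b)) (hbd : ∀ t ∈ Set.Icc a b, c t ∈ frontier A) :
    ∃ K : ℝ, 0 ≤ K ∧ ∀ (y : E3) (r : ℝ), 0 < r →
      volume {t ∈ Set.Icc a b | dist (c t : E3) y < r} ≤ ENNReal.ofReal (K * r) := by
  have key : ∃ K : ℝ, 0 ≤ K ∧ ∀ (y : E3) (r : ℝ), 0 < r →
      volume {t ∈ Set.Icc a b ∩ Set.Ioo a b | dist (c t : E3) y < r} ≤ ENNReal.ofReal (K * r) := by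
    refine isCompact_Icc.induction_on (p := fun s => ∃ K : ℝ, 0 ≤ K ∧ ∀ (y : E3) (r : ℝ), 0 < r →
      volume {t ∈ s ∩ Set.Ioo a b | dist (c t : E3) y < r} ≤ ENNReal.ofReal (K * r)) ?_ ?_ ?_ ?_
    · exact ⟨0, le_rfl, fun y r _ => by simp⟩
    · rintro s t hst ⟨K, hK, h⟩
      refine ⟨K, hK, fun y r hr => le_trans (measure_mono ?_) (h y r hr)⟩
      exact fun x hx => ⟨⟨hst hx.1.1, hx.1.2⟩, hx.2⟩
    · rintro s t ⟨K, hK, h⟩ ⟨K', hK', h'⟩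
      refine ⟨K + K', add_nonneg hK hK', fun y r hr => ?_⟩
      rw [add_mul, ENNReal.ofReal_add (by positivity) (by positivity)]
      refine le_trans (measure_mono ?_) ((measure_union_le _ _).trans
        (add_le_add (h y r hr) (h' y r hr)))
      rintro x ⟨⟨hx | hx, hx'⟩, hx2⟩
      · exact Or.inl ⟨⟨hx, hx'⟩, hx2⟩
      · exact Or.inr ⟨⟨hx, hx'⟩, hx2⟩
    · intro t₀ ht₀
      obtain ⟨δ, K, hδ, hK, h⟩ := exists_local_occupation hA ho hc hκ hreg hinj hbd ht₀
      exact ⟨_, mem_nhdsWithin_of_mem_nhds (Metric.ball_mem_nhds t₀ hδ), K, hK, h⟩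
  obtain ⟨K, hK, h⟩ := key
  refine ⟨K, hK, fun y r hr => ?_⟩
  refine le_trans (measure_mono_ae ?_) (h y r hr)
  have h1 : (Set.Ioo a b : Set ℝ) =ᵐ[volume] Set.Icc a b := Ioo_ae_eq_Icc
  filter_upwards [h1.mem_iff] with t ht hx
  exact ⟨⟨hx.1, ht.2 hx.1⟩, hx.2⟩

/-! ### Currents of Lipschitz curves -/

lemma exists_lipschitzOnWith_sphere (f : TestFun) :
    ∃ K : ℝ≥0, LipschitzOnWith K (homExt f.1) (Metric.sphere (0 : E3) 1) := by
  refine LocallyLipschitzOn.exists_lipschitzOnWith_of_compact (isCompact_sphere 0 1) fun x hx => ?_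
  have hx0 : x ≠ 0 := ne_zero_of_sphere ⟨x, hx⟩
  have h : ContDiffAt ℝ 1 (homExt f.1) x :=
    (ContDiffOn.contDiffAt f.2 (isOpen_punctured.mem_nhds hx0)).of_le (by norm_cast)
  obtain ⟨K, t, ht, hK⟩ := h.exists_lipschitzOnWith
  exact ⟨K, t, mem_nhdsWithin_of_mem_nhds ht, hK⟩

section Current

variable {c : ℝ → S2} {L : ℝ≥0}

lemma lipschitzWith_coe (hc : LipschitzWith L c) : LipschitzWith L fun t => (c t : E3) :=
  LipschitzWith.of_dist_le_mul fun s u => hc.dist_le_mul s u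

lemma norm_curveDeriv_le (hc : LipschitzWith L c) (t : ℝ) : ‖curveDeriv c t‖ ≤ L :=
  norm_deriv_le_of_lipschitz (lipschitzWith_coe hc)

lemma measurable_curveDeriv (c : ℝ → S2) : Measurable (curveDeriv c) := measurable_deriv _

lemma abs_inner_le (hc : LipschitzWith L c) (Φ : TestField) (t : ℝ) :
    |⟪Φ.1 (c t), curveDeriv c t⟫| ≤ ‖Φ.1 (c t)‖ * L :=
  (abs_real_inner_le_norm _ _).trans
    (mul_le_mul_of_nonneg_left (norm_curveDeriv_le hc t) (norm_nonneg _))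

lemma intervalIntegrable_inner (hc : LipschitzWith L c) (Φ : TestField) (a b : ℝ) :
    IntervalIntegrable (fun t => ⟪Φ.1 (c t), curveDeriv c t⟫) volume a b := by
  have hcont : Continuous fun t => Φ.1 (c t) := Φ.2.1.continuous.comp hc.continuous
  refine IntervalIntegrable.mono_fun (f := fun t => ‖Φ.1 (c t)‖ * L)
    ((hcont.norm.mul continuous_const).intervalIntegrable a b)
    (hcont.measurable.inner (measurable_curveDeriv c)).aestronglyMeasurable
    (Eventually.of_forall fun t => ?_)
  exact (abs_inner_le hc Φ t).trans (le_abs_self _)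

/-- The line integral along a Lipschitz curve as a functional on tangent fields. -/
def lineCurrent (hc : LipschitzWith L c) (a b : ℝ) : VFunctional where
  toFun Φ := ∫ t in a..b, ⟪Φ.1 (c t), curveDeriv c t⟫
  map_add' Φ Ψ := by
    rw [← intervalIntegral.integral_add (intervalIntegrable_inner hc Φ a b)
      (intervalIntegrable_inner hc Ψ a b)]
    congr 1; funext t
    exact inner_add_left _ _ _
  map_smul' r Φ := by
    rw [RingHom.id_apply, smul_eq_mul, ← intervalIntegral.integral_const_mul]
    congr 1; funext t
    exact real_inner_smul_left _ _ _

lemma lineCurrent_apply (hc : LipschitzWith L c) (a b : ℝ) (Φ : TestField) :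
    lineCurrent hc a b Φ = ∫ t in a..b, ⟪Φ.1 (c t), curveDeriv c t⟫ := rfl

lemma lineCurrent_grad (hc : LipschitzWith L c) (a b : ℝ) (f : TestFun) :
    lineCurrent hc a b (grad f) = f.1 (c b) - f.1 (c a) := by
  obtain ⟨K, hK⟩ := exists_lipschitzOnWith_sphere f
  have hlip : LipschitzWith (K * L) fun t => f.1 (c t) := by
    refine LipschitzWith.of_dist_le_mul fun s u => ?_
    rw [← homExt_coe f.1, ← homExt_coe f.1]
    refine (hK.dist_le_mul _ (c s).2 _ (c u).2).trans ?_
    rw [NNReal.coe_mul, mul_assoc]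
    exact mul_le_mul_of_nonneg_left ((lipschitzWith_coe hc).dist_le_mul s u) K.2
  have hac := (hlip.lipschitzOnWith (s := Set.uIcc a b)).absolutelyContinuousOnInterval
  rw [← hac.integral_deriv_eq_sub, lineCurrent_apply]
  refine intervalIntegral.integral_congr_ae ?_
  filter_upwards [(lipschitzWith_coe hc).ae_differentiableAt_real] with t ht _
  have hd : DifferentiableAt ℝ (homExt f.1) (c t : E3) :=
    (smoothOff_homExt f).differentiableAt (ne_zero_of_sphere (c t))
  have h1 := hd.hasFDerivAt.comp_hasDerivAt t ht.hasDerivAt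
  have h2 : (homExt f.1 ∘ fun τ => (c τ : E3)) = fun τ => f.1 (c τ) :=
    funext fun τ => homExt_coe f.1 (c τ)
  rw [h2] at h1
  rw [h1.deriv]
  exact InnerProductSpace.toDual_symm_apply (𝕜 := ℝ)

lemma norm_perpGrad_sq (g : TestFun) (x : S2) :
    ‖(perpGrad g).1 x‖ ^ 2 = ∑ j, (ang j g).1 x ^ 2 := by
  rw [EuclideanSpace.norm_sq_eq]
  exact Finset.sum_congr rfl fun j _ => by rw [Real.norm_eq_abs, sq_abs]; rfl

lemma exists_lineCurrent_le (hc : LipschitzWith L c) {a b C : ℝ} (hab : a ≤ b) (hC : 0 ≤ C)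
    (hocc : ∀ (y : E3) (r : ℝ), 0 < r →
      volume {t ∈ Set.Icc a b | dist (c t : E3) y < r} ≤ ENNReal.ofReal (C * r)) :
    ∃ K : ℝ, ∀ p : ℕ → TestFun, (∀ l, p l ∈ harm l) → ∀ N : ℕ, 0 < N →
      |lineCurrent hc a b (perpGrad (∑ l ∈ Finset.range N, p l))|
        ≤ vl2 (perpGrad (∑ l ∈ Finset.range N, p l)) (perpGrad (∑ l ∈ Finset.range N, p l)) / 2
          + K * N := by
  obtain ⟨C', hC', htr⟩ := trace_inequality hc.continuous hC hocc
  refine ⟨(b - a) * (C' * L ^ 2 / 2), fun p hp N hN => ?_⟩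
  set g := ∑ l ∈ Finset.range N, p l with hg
  have hN' : (0 : ℝ) < N := by exact_mod_cast hN
  have hcont : Continuous fun t => ‖(perpGrad g).1 (c t)‖ ^ 2 :=
    ((perpGrad g).2.1.continuous.comp hc.continuous).norm.pow 2
  have hint : ∫ t in a..b, ‖(perpGrad g).1 (c t)‖ ^ 2 ≤ C' * N * vl2 (perpGrad g) (perpGrad g) := by
    rw [intervalIntegral.integral_of_le hab, ← integral_Icc_eq_integral_Ioc, vl2_eq,
      Finset.mul_sum]
    simp only [norm_perpGrad_sq]
    have hi : ∀ j : Fin 3, IntegrableOn (fun t => (ang j g).1 (c t) ^ 2) (Set.Icc a b) volume :=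
      fun j => Continuous.integrableOn_Icc
        (((continuous_testFun (ang j g)).comp hc.continuous).pow 2)
    rw [integral_finsetSum _ fun j _ => hi j]
    refine Finset.sum_le_sum fun j _ => ?_
    have h := htr (fun l => ang j (p l)) (fun l => ang_mem_harm (hp l) j) N hN
    have h2 : ∑ l ∈ Finset.range N, ang j (p l) = ang j g := (map_sum (angL j) p _).symm
    rw [h2] at h
    exact h
  have hpt : ∀ t, |⟪(perpGrad g).1 (c t), curveDeriv c t⟫|
      ≤ (C' * N)⁻¹ / 2 * ‖(perpGrad g).1 (c t)‖ ^ 2 + C' * L ^ 2 / 2 * N := by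
    intro t
    refine (abs_inner_le hc _ t).trans ?_
    set x := ‖(perpGrad g).1 (c t)‖
    have hpos : 0 < C' * N := by positivity
    have h : 0 ≤ (C' * N)⁻¹ / 2 * (x - C' * N * L) ^ 2 := by positivity
    have h2 : (C' * N)⁻¹ / 2 * (x - C' * N * L) ^ 2
        = (C' * N)⁻¹ / 2 * x ^ 2 - x * L + C' * L ^ 2 / 2 * N := by
      field_simp
      ring
    linarith
  have h1 : |lineCurrent hc a b (perpGrad g)|
      ≤ ∫ t in a..b, ((C' * N)⁻¹ / 2 * ‖(perpGrad g).1 (c t)‖ ^ 2 + C' * L ^ 2 / 2 * N) := by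
    rw [lineCurrent_apply, ← Real.norm_eq_abs]
    refine intervalIntegral.norm_integral_le_of_norm_le hab
      (Eventually.of_forall fun t _ => hpt t) ?_
    exact ((hcont.const_mul _).add continuous_const).intervalIntegrable _ _
  rw [intervalIntegral.integral_add ((hcont.const_mul _).intervalIntegrable _ _)
    intervalIntegrable_const, intervalIntegral.integral_const_mul,
    intervalIntegral.integral_const, smul_eq_mul] at h1
  have h2 := mul_le_mul_of_nonneg_left hint (by positivity : (0 : ℝ) ≤ (C' * N)⁻¹ / 2)
  have h3 : (C' * N)⁻¹ / 2 * (C' * N * vl2 (perpGrad g) (perpGrad g))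
      = vl2 (perpGrad g) (perpGrad g) / 2 := by field_simp
  rw [h3] at h2
  linarith

lemma Rapid.ang_toTestFun {p : ℕ → TestFun} (hp : Rapid p) (j : Fin 3) :
    (hp.ang j).toTestFun = SphereEuler.ang j hp.toTestFun := by
  refine eq_of_coeff fun i => ?_
  rw [l2_ang]
  refine ((hp.ang j).hasSum_l2 (sh i)).unique ?_
  simpa only [l2_ang] using (hp.hasSum_l2 (SphereEuler.ang j (sh i))).neg

lemma hasSum_ang_projL (g : TestFun) (j : Fin 3) (x : S2) :
    HasSum (fun l => (ang j (projL l g)).1 x) ((ang j g).1 x) := by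
  have h := (rapid_projL g).ang_toTestFun j
  rw [rapid_projL_toTestFun] at h
  rw [← h]
  exact (((rapid_projL g).ang j).summable x).hasSum

lemma inner_perpGrad (g : TestFun) (x : S2) (e : E3) :
    ⟪(perpGrad g).1 x, e⟫ = ∑ j, e j * (ang j g).1 x := by
  rw [PiLp.inner_apply]
  rfl

lemma hasSum_lineCurrent (hc : LipschitzWith L c) (a b : ℝ) (g : TestFun) :
    HasSum (fun l => lineCurrent hc a b (perpGrad (projL l g)))
      (lineCurrent hc a b (perpGrad g)) := by
  choose u hu hub using fun j => ((rapid_projL g).ang j).exists_bound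
  have hu0 : ∀ j l, 0 ≤ u j l := fun j l => (abs_nonneg _).trans (hub j l (c 0))
  have hs : Summable fun l => (∑ j, u j l) * L := (summable_sum fun j _ => hu j).mul_right _
  simp only [lineCurrent_apply]
  refine intervalIntegral.hasSum_integral_of_dominated_convergence
    (fun l _ => (∑ j, u j l) * L) (fun l => ?_) (fun l => Eventually.of_forall fun t _ => ?_)
    (Eventually.of_forall fun t _ => hs) intervalIntegrable_const
    (Eventually.of_forall fun t _ => ?_)
  · exact ((perpGrad (projL l g)).2.1.continuous.comp hc.continuous).measurable.inner
      (measurable_curveDeriv c) |>.aestronglyMeasurable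
  · rw [inner_perpGrad, Finset.sum_mul, Real.norm_eq_abs]
    refine (Finset.abs_sum_le_sum_abs _ _).trans (Finset.sum_le_sum fun j _ => ?_)
    rw [abs_mul, mul_comm]
    refine mul_le_mul (hub j l _) ?_ (abs_nonneg _) (hu0 j l)
    exact (by simpa using PiLp.norm_apply_le (curveDeriv c t) j :
      |curveDeriv c t j| ≤ ‖curveDeriv c t‖).trans (norm_curveDeriv_le hc t)
  · simp only [inner_perpGrad]
    exact hasSum_sum fun j _ => (hasSum_ang_projL g j (c t)).mul_left _

end Current

/-- A divergence-free functional is recovered from its coefficients if it can be evaluated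
degree by degree and the squares of its coefficients grow linearly. -/
lemma mem_VSob_of_growth {T : VFunctional} (hdiv : IsDivFree T)
    (hsum : ∀ g, HasSum (fun l => T (perpGrad (projL l g))) (T (perpGrad g))) {C : ℝ}
    (hgrow : ∀ (F : Finset Idx') (N : ℕ), 0 < N → (∀ i ∈ F, i.1.1 < N) →
      ∑ i ∈ F, T (vsh (.inr i)) ^ 2 ≤ C * N) {s : ℝ} (hs : 1 / 2 < s) : T ∈ VSob (-s) := by
  have hinl : ∀ i : Idx', T (vsh (.inl i)) = 0 := fun i => by
    rw [vsh_inl, map_smul, hdiv, smul_zero]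
  have h1 : Summable fun i : VIdx => wt (vdeg i) ^ (-s) * T (vsh i) ^ 2 := by
    refine Summable.sum _ ?_ ?_
    · simp [Function.comp_def, hinl]
    · exact summable_weight_mul (fun i : Idx' => i.1.1) (fun i => T (vsh (.inr i)) ^ 2)
        (fun i => sq_nonneg _) (C := C) (α := 1) (fun F N hN hF => by
          rw [pow_one]; exact hgrow F N hN hF) (by push_cast; linarith)
  refine mem_VSob_iff.2 ⟨h1, fun Φ => ?_⟩
  set a : VIdx → ℝ := fun i => T (vsh i) * vl2 Φ (vsh i) with ha
  have h2 : Summable a := summable_mul_of_weighted vdeg h1 (fieldSys.summable_weighted s Φ)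
  have h3 : Summable fun i : Idx' => a (.inr i) := h2.comp_injective Sum.inr_injective
  set g := lapInv (curl Φ) with hg
  have hinr : ∀ i : Idx', a (.inr i) = T (perpGrad (sh i.1)) * l2 g (sh i.1) := fun i => by
    simp only [ha]
    rw [vcoeff_inr, hg, coeff_lapInv, vsh_inr, map_smul, smul_eq_mul, ← inv_sqrt_sq]
    ring
  have h0 : Function.support (fun i : Idx => T (perpGrad (sh i)) * l2 g (sh i))
      ⊆ {i | i.1 ≠ 0} := by
    intro i hi h0
    refine hi ?_
    simp [hg, coeff_lapInv, eigval, h0]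
  have h4 : HasSum (fun i : Idx => T (perpGrad (sh i)) * l2 g (sh i))
      (∑' i : Idx', a (.inr i)) := by
    rw [← hasSum_subtype_iff_of_support_subset h0]
    have h5 := h3.hasSum
    simp only [hinr] at h5 ⊢
    exact h5
  have h5 : HasSum (fun l => T (perpGrad (projL l g))) (∑' i : Idx', a (.inr i)) := by
    refine h4.sigma fun l => ?_
    have e : T (perpGrad (projL l g))
        = ∑ j, T (perpGrad (sh ⟨l, j⟩)) * l2 g (sh ⟨l, j⟩) := by
      rw [projL_apply]
      change T (perpGradL _) = _
      rw [map_sum, map_sum]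
      refine Finset.sum_congr rfl fun j _ => ?_
      rw [map_smul, map_smul, smul_eq_mul, mul_comm]
      rfl
    rw [e]
    exact hasSum_fintype _
  have h6 : T Φ = 0 + ∑' i : Idx', a (.inr i) := by
    rw [zero_add, ← (hsum g).unique h5]
    conv_lhs => rw [hodge Φ, map_add, hdiv, zero_add]
  rw [h6]
  refine HasSum.sum ?_ h3.hasSum
  have h7 : a ∘ Sum.inl = fun _ => 0 := funext fun i => by
    change T (vsh (.inl i)) * _ = 0
    rw [hinl, zero_mul]
  rw [h7]
  exact hasSum_zero

lemma sum_sq_lineCurrent_le {c : ℝ → S2} {L : ℝ≥0} (hc : LipschitzWith L c) {a b K : ℝ}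
    (hK : ∀ p : ℕ → TestFun, (∀ l, p l ∈ harm l) → ∀ N : ℕ, 0 < N →
      |lineCurrent hc a b (perpGrad (∑ l ∈ Finset.range N, p l))|
        ≤ vl2 (perpGrad (∑ l ∈ Finset.range N, p l)) (perpGrad (∑ l ∈ Finset.range N, p l)) / 2
          + K * N) (F : Finset Idx') (N : ℕ) (hN : 0 < N) (hF : ∀ i ∈ F, i.1.1 < N) :
    ∑ i ∈ F, lineCurrent hc a b (vsh (.inr i)) ^ 2 ≤ 2 * K * N := by
  set T := lineCurrent hc a b
  set q : Idx' → TestFun := fun i => (T (vsh (.inr i)) * (Real.sqrt (eigval i.1))⁻¹) • sh i.1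
  obtain ⟨p, hp, he⟩ := exists_grouped F (fun i => i.1.1) q
    (fun i _ => Submodule.smul_mem _ _ (sh_mem i.1)) hF
  have h1 := hK p hp N hN
  rw [he] at h1
  have h2 : perpGrad (∑ i ∈ F, q i) = ∑ i ∈ F, T (vsh (.inr i)) • vsh (.inr i) := by
    change perpGradL _ = _
    rw [map_sum]
    refine Finset.sum_congr rfl fun i _ => ?_
    rw [map_smul, mul_smul, vsh_inr]
    rfl
  rw [h2] at h1
  have h3 : T (∑ i ∈ F, T (vsh (.inr i)) • vsh (.inr i)) = ∑ i ∈ F, T (vsh (.inr i)) ^ 2 := by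
    rw [map_sum]
    exact Finset.sum_congr rfl fun i _ => by rw [map_smul, smul_eq_mul, sq]
  have h4 : vl2 (∑ i ∈ F, T (vsh (.inr i)) • vsh (.inr i))
      (∑ i ∈ F, T (vsh (.inr i)) • vsh (.inr i)) = ∑ i ∈ F, T (vsh (.inr i)) ^ 2 := by
    change vl2B _ _ = _
    rw [map_sum]
    refine Finset.sum_congr rfl fun i hi => ?_
    rw [LinearMap.map_sum₂, Finset.sum_eq_single_of_mem i hi]
    · change vl2 _ _ = _
      rw [vl2_smul_left, vl2_smul_right, vl2_vsh, if_pos rfl, sq, mul_one]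
    · intro j _ hj
      change vl2 _ _ = _
      rw [vl2_smul_left, vl2_smul_right, vl2_vsh, if_neg fun h => hj (Sum.inr_injective h)]
      ring
  rw [h3, h4] at h1
  have h5 := le_abs_self (∑ i ∈ F, T (vsh (.inr i)) ^ 2)
  linarith

lemma IsRegularBoundaryCurve.exists_current {a b : ℝ} {γ : ℝ → S2}
    (hγ : IsRegularBoundaryCurve a b γ) : ∃ Γ : VFunctional, IsCurrentOf a b γ Γ ∧
      (∀ s : ℝ, 1 / 2 < s → Γ ∈ VSob (-s)) ∧ IsDivFree Γ := by
  obtain ⟨L, hL⟩ := hγ.lipschitz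
  obtain ⟨κ, hκ, hreg⟩ := hγ.regular
  obtain ⟨A, ho, -, hA, hbd⟩ := hγ.boundary
  have hab := hγ.lt.le
  set c : ℝ → S2 := Set.IccExtend hab (Set.domRestrict (Set.Icc a b) γ) with hcdef
  have hcγ : ∀ t ∈ Set.Icc a b, c t = γ t := fun t ht => by
    rw [hcdef, Set.IccExtend_of_mem _ _ ht]; rfl
  have hc : LipschitzWith (L * 1) c := hL.to_restrict.comp (LipschitzWith.projIcc hab)
  have hderiv : ∀ t ∈ Set.Ioo a b, curveDeriv c t = curveDeriv γ t := fun t ht => by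
    refine Filter.EventuallyEq.deriv_eq ?_
    filter_upwards [isOpen_Ioo.mem_nhds ht] with u hu
    rw [hcγ u (Set.Ioo_subset_Icc_self hu)]
  have hIoo : ∀ᵐ t ∂(volume.restrict (Set.Icc a b)), t ∈ Set.Ioo a b := by
    rw [← restrict_Ioo_eq_restrict_Icc]
    exact ae_restrict_mem measurableSet_Ioo
  have hreg' : ∀ᵐ t ∂(volume.restrict (Set.Icc a b)), κ ≤ ‖deriv (fun τ => (c τ : E3)) t‖ := by
    filter_upwards [hreg, hIoo] with t h1 h2
    exact h1.trans_eq (congrArg norm (hderiv t h2).symm)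
  have hinj : Set.InjOn c (Set.Ico a b) := fun s hs u hu h => by
    rw [hcγ s (Set.Ico_subset_Icc_self hs), hcγ u (Set.Ico_subset_Icc_self hu)] at h
    exact hγ.injOn hs hu h
  have hbd' : ∀ t ∈ Set.Icc a b, c t ∈ frontier A := fun t ht => by
    rw [hcγ t ht, ← hbd]
    exact Set.mem_image_of_mem γ ht
  obtain ⟨C, hC, hocc⟩ := exists_occupation hA ho hc hκ hreg' hinj hbd'
  obtain ⟨K, hK⟩ := exists_lineCurrent_le hc hab hC hocc
  have hdiv : IsDivFree (lineCurrent hc a b) := fun f => by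
    rw [lineCurrent_grad, hcγ b (Set.right_mem_Icc.2 hab), hcγ a (Set.left_mem_Icc.2 hab),
      hγ.closed, sub_self]
  refine ⟨lineCurrent hc a b, fun Φ => ?_, fun s hs => mem_VSob_of_growth hdiv
    (hasSum_lineCurrent hc a b) (sum_sq_lineCurrent_le hc hK) hs, hdiv⟩
  have hae : (fun t => ⟪Φ.1 (c t), curveDeriv c t⟫)
      =ᵐ[volume.restrict (Set.uIoc a b)] fun t => ⟪Φ.1 (γ t), curveDeriv γ t⟫ := by
    rw [Set.uIoc_of_le hab, ← restrict_Ioo_eq_restrict_Ioc]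
    filter_upwards [ae_restrict_mem measurableSet_Ioo] with t ht
    rw [hcγ t (Set.Ioo_subset_Icc_self ht), hderiv t ht]
  exact ⟨(intervalIntegrable_inner hc Φ a b).congr_ae hae,
    intervalIntegral.integral_congr_ae_restrict hae⟩

end SphereEuler

end

theorem mainTheorem7 :
    (∃! μ : MeasureTheory.Measure SphereEuler.SobBelowMinusOne,
      SphereEuler.IsEnstrophyMeasure μ) ∧
    ∀ μ : MeasureTheory.Measure SphereEuler.SobBelowMinusOne,
      SphereEuler.IsEnstrophyMeasure μ →
      ∃ J : SphereEuler.VSob (-1) →ₗ[ℝ]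
          MeasureTheory.Lp ℝ 2 (SphereEuler.velocityLaw μ),
        -- `J w` is the random variable `⟨v, w⟩`: the only continuous linear extension
        SphereEuler.IsPairingExtension (SphereEuler.velocityLaw μ) J ∧
        (∀ J' : SphereEuler.VSob (-1) →ₗ[ℝ]
            MeasureTheory.Lp ℝ 2 (SphereEuler.velocityLaw μ),
          SphereEuler.IsPairingExtension (SphereEuler.velocityLaw μ) J' → J' = J) ∧
        -- it is the limit in mean square of `⟨v, Φ⟩` for smooth `Φ` approaching `w`
        (∀ w : SphereEuler.VSob (-1),
          (SphereEuler.approaching (-1) w.1).NeBot ∧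
          Filter.Tendsto
            (fun Φ : SphereEuler.TestField =>
              MeasureTheory.eLpNorm (fun v : SphereEuler.VSobBelowZero => v.1 Φ - J w v) 2
                (SphereEuler.velocityLaw μ))
            (SphereEuler.approaching (-1) w.1) (nhds 0)) ∧
        -- it is centered Gaussian
        (∀ w : SphereEuler.VSob (-1),
          SphereEuler.IsCenteredGaussian (SphereEuler.velocityLaw μ) (J w)
            (SphereEuler.dualPairing 1 w.1 (SphereEuler.invLap (SphereEuler.leray w.1)))) ∧
        (∀ w : SphereEuler.VSob (-1), SphereEuler.IsDivFree w.1 →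
          SphereEuler.IsCenteredGaussian (SphereEuler.velocityLaw μ) (J w)
            (SphereEuler.dualPairing 1 w.1 (SphereEuler.invLap w.1))) ∧
        -- line integrals along curves
        ∀ (a b : ℝ) (γ : ℝ → SphereEuler.S2), SphereEuler.IsRegularBoundaryCurve a b γ →
          ∃ Γ : SphereEuler.VSob (-1),
            SphereEuler.IsCurrentOf a b γ Γ.1 ∧
            (∀ s : ℝ, 1 / 2 < s → Γ.1 ∈ SphereEuler.VSob (-s)) ∧
            SphereEuler.IsDivFree Γ.1 ∧
            SphereEuler.IsCenteredGaussian (SphereEuler.velocityLaw μ) (J Γ)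
              (SphereEuler.dualPairing 1 Γ.1 (SphereEuler.invLap Γ.1)) := by
  refine ⟨⟨_, SphereEuler.isEnstrophyMeasure_noise,
    fun ν hν => hν.unique SphereEuler.isEnstrophyMeasure_noise⟩, fun μ hμ => ?_⟩
  have hJ := hμ.isPairingExtension_pairing
  have hdiv : ∀ w : SphereEuler.VSob (-1), SphereEuler.IsDivFree w.1 →
      SphereEuler.IsCenteredGaussian (SphereEuler.velocityLaw μ) (hμ.pairing w)
        (SphereEuler.dualPairing 1 w.1 (SphereEuler.invLap w.1)) := fun w hw => by
    have h := hμ.isCenteredGaussian_pairing w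
    rwa [SphereEuler.leray_of_isDivFree hw] at h
  refine ⟨hμ.pairing, hJ, fun J' hJ' => hJ.unique hJ',
    fun w => ⟨SphereEuler.approaching_neBot w.2, hJ.tendsto_eLpNorm w⟩,
    hμ.isCenteredGaussian_pairing, hdiv, fun a b γ hγ => ?_⟩
  obtain ⟨Γ, h1, h2, h3⟩ := hγ.exists_current
  exact ⟨⟨Γ, h2 1 (by norm_num)⟩, h1, h2, h3, hdiv _ h3⟩
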